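/- **Setting.** Let $M$ be a connected smooth 3-manifold (Hausdorff, second countable) with a CR structure of hypersurface type, i.e. a smooth complex line subbundle $T^{1,0}M\subset \mathbb C\otimes TM$, closed under the Lie bracket, with $T^{1,0}M\cap T^{0,1}M=0$, where $T^{0,1}M=\overline{T^{1,0}M}$. Let $\theta$ be a pseudohermitian structure on $M$, i.e. a nowhere vanishing real smooth 1-form whose kernel is $T^{1,0}M\oplus T^{0,1}M$ after complexification. Assume that $M$ is strongly pseudoconvex, with $\theta$ chosen such that the Levi form $L_\theta(Z,W)=i\,d\theta(Z,\overline W)$, $Z,W\in T^{1,0}M$, is positive definite; here $d\theta(X,Y)=X(\theta(Y))-Y(\theta(X))-\theta([X,Y])$. The Reeb field $T$ is defined by $\theta(T)=1$, $d\theta(T,\cdot)=0$. The Webster metric $g_\theta$ is the Riemannian metric on $M$ with $g_\theta(X,Y)=\operatorname{Re}L_\theta(Z,W)$ for $X=(Z+\overline Z)/\sqrt2$, $Y=(W+\overline W)/\sqrt2$ with $Z,W\in T^{1,0}M$, and with $g_\theta(X,T)=0$ for such $X$ and $g_\theta(T,T)=1$. A smooth map $f\colon M\to\mathbb R^4$ is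 CR pluriharmonic if every point of $M$ has a neighbourhood on which $f=\operatorname{Re}F$ for a smooth map $F$ to $\mathbb C^4$ with $\overline Z F=0$ for all $Z\in T^{1,0}M$. Real hypersurfaces of $\mathbb C^2$ carry the induced CR structure, whose $(1,0)$-vectors are the complex tangent vectors of the hypersurface that are of type $(1,0)$ in $\mathbb C^2$. **Corollary.** Assume that $M$ is complete with respect to the Webster metric $g_\theta$, and let $f\colon M\to\mathbb R^4$ be a CR pluriharmonic immersion that is isometric for $g_\theta$ and the Euclidean metric. 1. If $M$ is not compact, then there are a local CR diffeomorphism $\psi\colon M\to\tilde M$ that is a (surjective) covering map onto the cylinder $\tilde M=\{(z,w)\in\mathbb C^2\mid(\operatorname{Re}z)^2+(\operatorname{Re}w)^2=1\}$, and an isometry $\phi\colon\mathbb C^2\to\mathbb R^4$, such that $f=\phi\circ\psi$. 2. If $M$ is compact, then there are a CR diffeomorphism $\psi\colon M\to\tilde M$ onto the sphere $\tilde M=\{(z,w)\in\mathbb C^2\mid|z|^2+|w|^2=4\}$ of radius $2$, and an isometry $\phi\colon\mathbb C^2\to\mathbb R^4$, such that $f=\phi\circ\psi$. -/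

import Mathlib

open scoped Manifold ContDiff TensorProduct Topology ENNReal

noncomputable section

namespace CRGeom

/-! ### Complexification of a real vector space -/

section Complexification

variable {V : Type*} [AddCommGroup V] [Module ℝ V]

/-- The real part `u` of the complex vector `1 ⊗ u + i ⊗ v`. -/
def reC : ℂ ⊗[ℝ] V →ₗ[ℝ] V :=
  (TensorProduct.lid ℝ V).toLinearMap ∘ₗ LinearMap.rTensor V Complex.reLm

/-- The imaginary part `v` of the complex vector `1 ⊗ u + i ⊗ v`. -/
def imC : ℂ ⊗[ℝ] V →ₗ[ℝ] V :=
  (TensorProduct.lid ℝ V).toLinearMap ∘ₗ LinearMap.rTensor V Complex.imLm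

/-- The complex vector `u + i v`. -/
def mkC (u v : V) : ℂ ⊗[ℝ] V := (1 : ℂ) ⊗ₜ[ℝ] u + Complex.I ⊗ₜ[ℝ] v

/-- Complex conjugation on the complexification. -/
def conjC : ℂ ⊗[ℝ] V →ₗ[ℝ] ℂ ⊗[ℝ] V :=
  LinearMap.rTensor V Complex.conjAe.toLinearMap

/-- The complex linear extension of a real linear map with values in `ℂ`. -/
def extC (L : V →ₗ[ℝ] ℂ) (w : ℂ ⊗[ℝ] V) : ℂ := L (reC w) + Complex.I * L (imC w)

@[simp] theorem reC_mkC (u v : V) : reC (mkC u v) = u := by simp [reC, mkC]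

@[simp] theorem imC_mkC (u v : V) : imC (mkC u v) = v := by simp [imC, mkC]

theorem mkC_reC_imC (w : ℂ ⊗[ℝ] V) : mkC (reC w) (imC w) = w := by
  induction w using TensorProduct.induction_on with
  | zero => simp [mkC]
  | tmul z v =>
    simp only [mkC, reC, imC, LinearMap.comp_apply, LinearMap.rTensor_tmul,
      LinearEquiv.coe_coe, TensorProduct.lid_tmul, Complex.reLm_coe, Complex.imLm_coe]
    rw [← TensorProduct.smul_tmul, ← TensorProduct.smul_tmul, ← TensorProduct.add_tmul]
    congr 1
    apply Complex.ext <;> simp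
  | add x y hx hy =>
    have h : mkC (reC (x + y)) (imC (x + y)) = mkC (reC x) (imC x) + mkC (reC y) (imC y) := by
      simp only [mkC, map_add, TensorProduct.tmul_add]
      abel
    rw [h, hx, hy]

@[simp] theorem conjC_mkC (u v : V) : conjC (mkC u v) = mkC u (-v) := by
  simp [conjC, mkC, TensorProduct.neg_tmul, TensorProduct.tmul_neg]

end Complexification

/-! ### Vector fields and `1`-forms on a smooth `3`-manifold -/

section Manifold

variable {M : Type*} [TopologicalSpace M] [ChartedSpace (EuclideanSpace ℝ (Fin 3)) M]
  [IsManifold (𝓡 3) ∞ M]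

/-- The complexified tangent space `ℂ ⊗ T_x M`. -/
abbrev CTangent (x : M) : Type := ℂ ⊗[ℝ] TangentSpace (𝓡 3) x

/-- A (real) vector field is smooth on the set `O`. -/
def SmoothFieldOn (O : Set M) (X : ∀ x : M, TangentSpace (𝓡 3) x) : Prop :=
  ContMDiffOn (𝓡 3) (𝓡 3).tangent ∞ (fun x => (⟨x, X x⟩ : TangentBundle (𝓡 3) M)) O

/-- A complex vector field `Z = X + i Y` is smooth on the set `O`. -/
def SmoothCFieldOn (O : Set M) (Z : ∀ x : M, CTangent x) : Prop :=
  SmoothFieldOn O (fun x => reC (Z x)) ∧ SmoothFieldOn O (fun x => imC (Z x))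

/-- The complex bilinear extension of the Lie bracket to complex vector fields. -/
def bracketC (Z W : ∀ x : M, CTangent x) (x : M) : CTangent x :=
  mkC
    (VectorField.mlieBracket (𝓡 3) (fun y => reC (Z y)) (fun y => reC (W y)) x
      - VectorField.mlieBracket (𝓡 3) (fun y => imC (Z y)) (fun y => imC (W y)) x)
    (VectorField.mlieBracket (𝓡 3) (fun y => reC (Z y)) (fun y => imC (W y)) x
      + VectorField.mlieBracket (𝓡 3) (fun y => imC (Z y)) (fun y => reC (W y)) x)

/-- A real `1`-form is smooth: its values on smooth local vector fields are smooth. -/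
def SmoothOneForm (θ : ∀ x : M, TangentSpace (𝓡 3) x →L[ℝ] ℝ) : Prop :=
  ∀ (O : Set M) (X : ∀ x : M, TangentSpace (𝓡 3) x), IsOpen O → SmoothFieldOn O X →
    ContMDiffOn (𝓡 3) 𝓘(ℝ, ℝ) ∞ (fun x => θ x (X x)) O

/-- The coordinate expression of a `1`-form in the preferred chart at `x₀`. -/
def formInChart (θ : ∀ x : M, TangentSpace (𝓡 3) x →L[ℝ] ℝ) (x₀ : M)
    (y : EuclideanSpace ℝ (Fin 3)) : EuclideanSpace ℝ (Fin 3) →L[ℝ] ℝ :=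
  (θ ((extChartAt (𝓡 3) x₀).symm y)).comp
    (mfderiv 𝓘(ℝ, EuclideanSpace ℝ (Fin 3)) (𝓡 3) (extChartAt (𝓡 3) x₀).symm y)

/-- The exterior derivative of a `1`-form at `x`, computed in the chart at `x`, normalized by
`dθ(X, Y) = X(θ(Y)) - Y(θ(X)) - θ([X, Y])`. -/
def dForm (θ : ∀ x : M, TangentSpace (𝓡 3) x →L[ℝ] ℝ) (x : M)
    (u v : TangentSpace (𝓡 3) x) : ℝ :=
  let D := fderiv ℝ (formInChart θ x) (extChartAt (𝓡 3) x x)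
  let c : TangentSpace (𝓡 3) x → EuclideanSpace ℝ (Fin 3) :=
    mfderiv (𝓡 3) 𝓘(ℝ, EuclideanSpace ℝ (Fin 3)) (extChartAt (𝓡 3) x) x
  D (c u) (c v) - D (c v) (c u)

/-- The complex bilinear extension of `dθ` to `ℂ ⊗ T_x M`. -/
def dFormC (θ : ∀ x : M, TangentSpace (𝓡 3) x →L[ℝ] ℝ) (x : M) (z w : CTangent x) : ℂ :=
  ((dForm θ x (reC z) (reC w) - dForm θ x (imC z) (imC w) : ℝ) : ℂ)
    + Complex.I * ((dForm θ x (reC z) (imC w) + dForm θ x (imC z) (reC w) : ℝ) : ℂ)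

end Manifold

/-! ### CR structures and pseudohermitian structures -/

/-- A CR structure of hypersurface type on a `3`-manifold: a smooth complex line subbundle
`T^{1,0}M` of the complexified tangent bundle, with `T^{1,0}M ∩ T^{0,1}M = 0`, whose sections are
closed under the Lie bracket. -/
structure CRStructure (M : Type*) [TopologicalSpace M]
    [ChartedSpace (EuclideanSpace ℝ (Fin 3)) M] [IsManifold (𝓡 3) ∞ M] where
  /-- The fibres of `T^{1,0}M`. -/
  T10 : ∀ x : M, Submodule ℂ (CTangent x)
  exists_frame : ∀ x : M, ∃ (O : Set M) (Z : ∀ y : M, CTangent y), IsOpen O ∧ x ∈ O ∧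
    SmoothCFieldOn O Z ∧ ∀ y ∈ O, Z y ≠ 0 ∧ T10 y = Submodule.span ℂ {Z y}
  inf_conj : ∀ (x : M) (w : CTangent x), w ∈ T10 x → conjC w ∈ T10 x → w = 0
  involutive : ∀ (O : Set M) (Z W : ∀ y : M, CTangent y), IsOpen O →
    SmoothCFieldOn O Z → SmoothCFieldOn O W → (∀ y ∈ O, Z y ∈ T10 y) → (∀ y ∈ O, W y ∈ T10 y) →
    ∀ y ∈ O, bracketC Z W y ∈ T10 y

/-- A pseudohermitian structure: a nowhere vanishing real `1`-form whose (complexified) kernel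
is `T^{1,0}M ⊕ T^{0,1}M`. -/
structure Pseudohermitian {M : Type*} [TopologicalSpace M]
    [ChartedSpace (EuclideanSpace ℝ (Fin 3)) M] [IsManifold (𝓡 3) ∞ M] (S : CRStructure M) where
  /-- The underlying `1`-form. -/
  θ : ∀ x : M, TangentSpace (𝓡 3) x →L[ℝ] ℝ
  smooth : SmoothOneForm θ
  ne_zero : ∀ x : M, θ x ≠ 0
  ker_eq : ∀ (x : M) (w : CTangent x),
    (θ x (reC w) = 0 ∧ θ x (imC w) = 0) ↔ ∃ a ∈ S.T10 x, ∃ b ∈ S.T10 x, w = a + conjC b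

section Webster

variable {M : Type*} [TopologicalSpace M] [ChartedSpace (EuclideanSpace ℝ (Fin 3)) M]
  [IsManifold (𝓡 3) ∞ M]
  {S : CRStructure M}

/-- The Levi form `L_θ(Z, W) = i dθ(Z, W̄)`. -/
def levi (P : Pseudohermitian S) (x : M) (z w : CTangent x) : ℂ :=
  Complex.I * dFormC P.θ x z (conjC w)

/-- Strong pseudoconvexity, for a `θ` chosen such that the Levi form is positive definite. -/
def LeviPositive (P : Pseudohermitian S) : Prop :=
  ∀ (x : M), ∀ z ∈ S.T10 x, z ≠ 0 → 0 < (levi P x z z).re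

/-- The Reeb vector field: the vector `T` with `θ(T) = 1` and `dθ(T, ·) = 0`, which exists and is
unique if the Levi form is nondegenerate. -/
def reeb (P : Pseudohermitian S) (x : M) : TangentSpace (𝓡 3) x :=
  Classical.epsilon fun T => P.θ x T = 1 ∧ ∀ v, dForm P.θ x T v = 0

/-- The vector `Z ∈ T^{1,0}M` with `(Z + Z̄) / √2 = u - θ(u) T`, the component of `u` in the contact
distribution `ker θ`; it exists and is unique if the Levi form is nondegenerate. -/
def lift10 (P : Pseudohermitian S) (x : M) (u : TangentSpace (𝓡 3) x) : CTangent x :=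
  Classical.epsilon fun Z => Z ∈ S.T10 x ∧
    Z + conjC Z = mkC (Real.sqrt 2 • (u - P.θ x u • reeb P x)) 0

/-- The Webster metric: `g(X, Y) = Re L_θ(Z, W)` for `X = (Z + Z̄)/√2`, `Y = (W + W̄)/√2` with
`Z, W ∈ T^{1,0}M`, while `g(X, T) = 0` and `g(T, T) = 1`. -/
def webster (P : Pseudohermitian S) (x : M) (u v : TangentSpace (𝓡 3) x) : ℝ :=
  (levi P x (lift10 P x u) (lift10 P x v)).re + P.θ x u * P.θ x v

/-- The Riemannian distance of the Webster metric. -/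
def websterEDist (P : Pseudohermitian S) (x y : M) : ℝ≥0∞ :=
  letI : ∀ z : M, ENorm (TangentSpace (𝓡 3) z) :=
    fun z => ⟨fun v => ENNReal.ofReal (Real.sqrt (webster P z v v))⟩
  Manifold.riemannianEDist (𝓡 3) x y

/-- Completeness of `M` with the Webster metric: Cauchy sequences for the Riemannian distance
converge. -/
def WebsterComplete (P : Pseudohermitian S) : Prop :=
  ∀ u : ℕ → M,
    (∀ ε : ℝ≥0∞, 0 < ε → ∃ N : ℕ, ∀ m ≥ N, ∀ n ≥ N, websterEDist P (u m) (u n) < ε) →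
    ∃ x : M, Filter.Tendsto (fun n => websterEDist P (u n) x) Filter.atTop (𝓝 0)

/-- `f : M → ℝ⁴` is a (smooth) isometric immersion for the Webster metric. -/
def IsIsometricImmersion (P : Pseudohermitian S) (f : M → EuclideanSpace ℝ (Fin 4)) : Prop :=
  ContMDiff (𝓡 3) 𝓘(ℝ, EuclideanSpace ℝ (Fin 4)) ∞ f ∧
  ∀ x : M,
    let df : TangentSpace (𝓡 3) x → EuclideanSpace ℝ (Fin 4) :=
      mfderiv (𝓡 3) 𝓘(ℝ, EuclideanSpace ℝ (Fin 4)) f x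
    Function.Injective df ∧ ∀ u v, inner ℝ (df u) (df v) = webster P x u v

end Webster

section CRMaps

variable {M : Type*} [TopologicalSpace M] [ChartedSpace (EuclideanSpace ℝ (Fin 3)) M]
  [IsManifold (𝓡 3) ∞ M]

/-- `h` is a CR function on the open set `O`: it is smooth and `Z̄ h = 0` for `Z ∈ T^{1,0}M`. -/
def IsCRFunctionOn (S : CRStructure M) (O : Set M) (h : M → ℂ) : Prop :=
  ContMDiffOn (𝓡 3) 𝓘(ℝ, ℂ) ∞ h O ∧
  ∀ x ∈ O, ∀ z ∈ S.T10 x,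
    let dh : TangentSpace (𝓡 3) x →ₗ[ℝ] ℂ := (mfderiv (𝓡 3) 𝓘(ℝ, ℂ) h x).toLinearMap
    extC dh (conjC z) = 0

/-- `f : M → ℝ⁴` is CR pluriharmonic: locally the real part of a CR map to `ℂ⁴`. -/
def IsCRPluriharmonic (S : CRStructure M) (f : M → EuclideanSpace ℝ (Fin 4)) : Prop :=
  ∀ x : M, ∃ (O : Set M) (F : Fin 4 → M → ℂ), IsOpen O ∧ x ∈ O ∧
    ∀ i, IsCRFunctionOn S O (F i) ∧ ∀ y ∈ O, f y i = (F i y).re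

/-- The space `ℂ²`, whose underlying real Euclidean space is `ℝ⁴`. -/
abbrev C2 : Type := EuclideanSpace ℂ (Fin 2)

/-- The real hypersurface `{ρ = 0}` of `ℂ²`. -/
abbrev Hypersurface (ρ : C2 → ℝ) : Type := {p : C2 // ρ p = 0}

/-- The space `T^{1,0}` at `p` of the CR structure induced by `ℂ²` on `{ρ = 0}`: the complex tangent
vectors `u + i v` of `{ρ = 0}` that are of type `(1,0)` in `ℂ²`, i.e. `v = -J u`, where `J` is the
multiplication by `i` on `ℂ²`. -/
def hypT10 (ρ : C2 → ℝ) (p : C2) : Set (ℂ ⊗[ℝ] C2) :=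
  {w | fderiv ℝ ρ p (reC w) = 0 ∧ fderiv ℝ ρ p (imC w) = 0 ∧ imC w = -(Complex.I • reC w)}

/-- `ψ : M → {ρ = 0}` is a local CR diffeomorphism: it is smooth, near every point it is a
homeomorphism onto an open subset of `{ρ = 0}` whose inverse is (the restriction of) a smooth map,
and its differential maps `T^{1,0}M` onto `T^{1,0}{ρ = 0}`. -/
def IsLocalCRDiffeo (S : CRStructure M) (ρ : C2 → ℝ) (ψ : M → Hypersurface ρ) : Prop :=
  ContMDiff (𝓡 3) 𝓘(ℝ, C2) ∞ (fun x => (ψ x : C2)) ∧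
  (∀ x : M, ∃ (U : Set M) (V : Set C2) (G : C2 → M), IsOpen U ∧ x ∈ U ∧ IsOpen V ∧
    ψ '' U = {q : Hypersurface ρ | (q : C2) ∈ V} ∧ ContMDiffOn 𝓘(ℝ, C2) (𝓡 3) ∞ G V ∧
    ∀ y ∈ U, G (ψ y) = y) ∧
  ∀ x : M,
    let dψ : TangentSpace (𝓡 3) x →ₗ[ℝ] C2 :=
      (mfderiv (𝓡 3) 𝓘(ℝ, C2) (fun y => (ψ y : C2)) x).toLinearMap
    (LinearMap.baseChange ℂ dψ) '' (S.T10 x : Set (CTangent x)) = hypT10 ρ (ψ x)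

/-- A CR diffeomorphism is a bijective local CR diffeomorphism. -/
def IsCRDiffeo (S : CRStructure M) (ρ : C2 → ℝ) (ψ : M → Hypersurface ρ) : Prop :=
  Function.Bijective ψ ∧ IsLocalCRDiffeo S ρ ψ

/-- The cylinder `(Re z)² + (Re w)² = 1` is the zero set of this function. -/
def rhoCylinder (p : C2) : ℝ := (p 0).re ^ 2 + (p 1).re ^ 2 - 1

/-- The sphere `|z|² + |w|² = 4` is the zero set of this function. -/
def rhoSphere (p : C2) : ℝ := ‖p 0‖ ^ 2 + ‖p 1‖ ^ 2 - 4

end CRMaps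

end CRGeom

end

/-! The proof has three stages.

A conjugate for `f`. Locally `f` is the real part of a CR map `F = f + i g`. Write a local section
of T^{1,0} as `u + i v`. Since `f` is isometric, `df u` and `df v` are orthogonal and of equal
length, so the complex bilinear square of `dF` vanishes in the (1,0) direction. Differentiating this
along (0,1) vectors produces the bracket `[u, v]`. Together with `u` and `v` it spans the tangent
space by strong pseudoconvexity, so all of `dF` is isotropic (`isotropic_of_frame`). Isotropy gives
`dg = K ∘ df` with `K` an orthogonal complex structure on ℝ⁴ depending on the point. A
symmetric-in-two, skew-in-two argument shows that `K` is locally constant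
(`exists_parallel_complex_structure`), and uniqueness of `K` makes it constant on the connected `M`.
When ℝ⁴ with `-K` is identified with ℂ², `f` becomes a CR isometric immersion `ψ` into ℂ².

Rigidity. Let `N = dψ(T)`, a unit field, and let `J` be the quaternionic structure `quatJ`. Then `dψ
= η JN + θ N` with `θ` real and `dθ = Im(η ⊗ η̄)`. The structure equations of flat ℂ² force `dN =
(-(i/2) η + q η̄) JN + i μ θ N` with `μ = 2|q|² - 1/2`. Their integrability conditions leave only `q
= 0`, or a constant `q` with `|q| = 1/2` (`IsAdapted.eventually_const`). If `q = 0`, then `N + (i/2)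
ψ` is constant and `ψ` lies on a sphere of radius 2. If `|q| = 1/2`, then `iN` rotates inside a
fixed totally real plane, and `ψ` lies on a cylinder over the unit circle of that plane.

Globalization. Both models have the form `‖L p‖ = r` for an orthogonal projection `L`, and `ψ` is a
local diffeomorphism onto the model. Completeness lifts C¹ paths of the model (`exists_liftsUpTo`).
Lifting the chords that issue from a point trivializes `ψ` away from the antipodal locus, so `ψ` is
a surjective covering. On the sphere two such trivializations glue to a global section, so `ψ` is
bijective. The sphere is compact and the cylinder is not, so compactness of `M` decides which model
occurs. -/

noncomputable section

namespace CRGeom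

/-! ### The quaternionic structure of `ℂ²` -/

/-- The map `(z, w) ↦ (-w̄, z̄)` as a real linear map. -/
def quatJₗ : C2 →ₗ[ℝ] C2 where
  toFun z := !₂[-(starRingEnd ℂ) (z 1), (starRingEnd ℂ) (z 0)]
  map_add' x y := by
    ext i; fin_cases i <;> simp [add_comm]
  map_smul' c x := by
    ext i; fin_cases i <;> simp

/-- The map `(z, w) ↦ (-w̄, z̄)` as a continuous real linear map. -/
def quatJ : C2 →L[ℝ] C2 := quatJₗ.toContinuousLinearMap

@[simp] theorem quatJ_apply_zero (z : C2) : quatJ z 0 = -(starRingEnd ℂ) (z 1) := rfl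

@[simp] theorem quatJ_apply_one (z : C2) : quatJ z 1 = (starRingEnd ℂ) (z 0) := rfl

theorem inner_C2 (x y : C2) :
    inner ℂ x y = (starRingEnd ℂ) (x 0) * y 0 + (starRingEnd ℂ) (x 1) * y 1 := by
  rw [PiLp.inner_apply, Fin.sum_univ_two]
  simp [mul_comm]

theorem quatJ_smul (c : ℂ) (z : C2) : quatJ (c • z) = (starRingEnd ℂ) c • quatJ z := by
  ext i; fin_cases i <;> simp

theorem quatJ_quatJ (z : C2) : quatJ (quatJ z) = -z := by
  ext i; fin_cases i <;> simp

theorem inner_quatJ_quatJ (x y : C2) :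
    inner ℂ (quatJ x) (quatJ y) = (starRingEnd ℂ) (inner ℂ x y) := by
  simp [inner_C2]; ring

theorem inner_quatJ_left (x y : C2) : inner ℂ (quatJ x) y = -inner ℂ (quatJ y) x := by
  simp [inner_C2]; ring

theorem inner_quatJ_self (x : C2) : inner ℂ (quatJ x) x = 0 := by
  simp [inner_C2]; ring

theorem inner_self_quatJ (x : C2) : inner ℂ x (quatJ x) = 0 := by
  simp [inner_C2]; ring

theorem inner_self_of_norm_one {n : C2} (hn : ‖n‖ = 1) : inner ℂ n n = 1 := by
  rw [inner_self_eq_norm_sq_to_K, hn]; simp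

/-- The pair `quatJ n, n` is a unitary basis of ℂ². Each coordinate of the identity is `|n 0|² + |n
1|² = 1` multiplied by that coordinate of `v`. -/
theorem quatJ_decomp {n : C2} (hn : ‖n‖ = 1) (v : C2) :
    v = inner ℂ (quatJ n) v • quatJ n + inner ℂ n v • n := by
  have h := inner_self_of_norm_one hn
  rw [inner_C2] at h
  ext i
  fin_cases i
  · simp only [inner_C2, quatJ_apply_zero, quatJ_apply_one, map_neg, Complex.conj_conj,
      Fin.zero_eta, PiLp.add_apply, PiLp.smul_apply, smul_eq_mul]
    linear_combination (-v 0) * h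
  · simp only [inner_C2, quatJ_apply_zero, quatJ_apply_one, map_neg, Complex.conj_conj,
      Fin.mk_one, PiLp.add_apply, PiLp.smul_apply, smul_eq_mul]
    linear_combination (-v 1) * h

/-- The Hermitian product in the unitary frame `quatJ n, n`. -/
theorem inner_eq_of_norm_one {n : C2} (hn : ‖n‖ = 1) (v w : C2) :
    inner ℂ v w = (starRingEnd ℂ) (inner ℂ (quatJ n) v) * inner ℂ (quatJ n) w
      + (starRingEnd ℂ) (inner ℂ n v) * inner ℂ n w := by
  conv_lhs => rw [quatJ_decomp hn v]
  rw [inner_add_left, inner_smul_left, inner_smul_left]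

/-! ### Adapted pairs: a CR immersion and its Reeb direction, in a chart -/

section Adapted

variable {E : Type*} [NormedAddCommGroup E] [NormedSpace ℝ E]

/-- The component of `Dψ a` along `quatJ N`. -/
def etaForm (ψ N : E → C2) (a y : E) : ℂ := inner ℂ (quatJ (N y)) (fderiv ℝ ψ y a)

/-- The component of `Dψ a` along `N`. -/
def thetaForm (ψ N : E → C2) (a y : E) : ℝ := (inner ℂ (N y) (fderiv ℝ ψ y a)).re

/-- The imaginary part of the component of `DN a` along `N`. -/
def betaForm (N : E → C2) (a y : E) : ℝ := (inner ℂ (N y) (fderiv ℝ N y a)).im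

/-- An immersion `ψ` into `ℂ²` with a unit field `N` such that `Dψ` takes its values in
`ℂ (quatJ N) ⊕ ℝ N`, and such that the `N` component `θ` of `Dψ` satisfies
`dθ = Im (η ⊗ η̄)` where `η` is the other component. -/
structure IsAdapted (O : Set E) (ψ N : E → C2) : Prop where
  isOpen : IsOpen O
  smooth_psi : ContDiffOn ℝ ∞ ψ O
  smooth_N : ContDiffOn ℝ ∞ N O
  norm_N : ∀ y ∈ O, ‖N y‖ = 1
  im_inner : ∀ y ∈ O, ∀ a, (inner ℂ (N y) (fderiv ℝ ψ y a)).im = 0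
  contact : ∀ y ∈ O, ∀ a b,
    (inner ℂ (fderiv ℝ N y a) (fderiv ℝ ψ y b)).re
        - (inner ℂ (fderiv ℝ N y b) (fderiv ℝ ψ y a)).re
      = (etaForm ψ N a y * (starRingEnd ℂ) (etaForm ψ N b y)).im
  bij : ∀ y ∈ O, Function.Bijective fun a => (etaForm ψ N a y, thetaForm ψ N a y)

/-- Pointwise linear algebra: the form of `κ` and `β` forced by the first structure equation. -/
theorem structure_algebra {E : Type*} [AddCommGroup E] [Module ℝ E]
    (η κ : E →ₗ[ℝ] ℂ) (θ β : E →ₗ[ℝ] ℝ)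
    (hb : Function.Bijective fun a => (η a, θ a))
    (h : ∀ w a, (starRingEnd ℂ) (κ w) * η a - (starRingEnd ℂ) (κ a) * η w
      - Complex.I * (β w * θ a - β a * θ w) = ((η w * (starRingEnd ℂ) (η a)).im : ℂ)) :
    ∃ (q : ℂ) (μ : ℝ), ∀ a, κ a = -(Complex.I / 2) * η a + q * (starRingEnd ℂ) (η a) ∧
      β a = μ * θ a := by
  obtain ⟨a1, h1⟩ := hb.2 (1, 0)
  obtain ⟨a2, h2⟩ := hb.2 (Complex.I, 0)
  obtain ⟨a3, h3⟩ := hb.2 (0, 1)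
  simp only [Prod.mk.injEq] at h1 h2 h3
  have e12 := h a1 a2
  have e13 := h a1 a3
  have e23 := h a2 a3
  rw [h1.1, h1.2, h2.1, h2.2] at e12
  rw [h1.1, h1.2, h3.1, h3.2] at e13
  rw [h2.1, h2.2, h3.1, h3.2] at e23
  simp [Complex.ext_iff] at e12 e13 e23
  obtain ⟨e12r, e12i⟩ := e12
  obtain ⟨e13r, e13i⟩ := e13
  obtain ⟨e23r, e23i⟩ := e23
  have dec : ∀ a, a = (η a).re • a1 + (η a).im • a2 + θ a • a3 := by
    intro a
    apply hb.1
    simp only [map_add, map_smul, h1.1, h1.2, h2.1, h2.2, h3.1, h3.2, Prod.mk.injEq]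
    refine ⟨?_, by simp⟩
    apply Complex.ext <;> simp
  -- At `a1`, where `η = 1`, the claimed formula reads `κ a1 = -i/2 + q`; at `a3`, where `θ = 1`, it
  -- reads `β a3 = μ`.
  refine ⟨κ a1 + Complex.I / 2, β a3, fun a => ?_⟩
  have k : κ a = (η a).re • κ a1 + (η a).im • κ a2 + θ a • κ a3 := by
    conv_lhs => rw [dec a]
    simp only [map_add, map_smul]
  have b : β a = (η a).re • β a1 + (η a).im • β a2 + θ a • β a3 := by
    conv_lhs => rw [dec a]
    simp only [map_add, map_smul]
  constructor
  · rw [k]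
    apply Complex.ext
    · simp
      have : (κ a3).re = 0 := by linarith
      rw [this]
      linear_combination (-(η a).im) * e12r
    · simp
      have : (κ a3).im = 0 := by linarith
      rw [this]
      linear_combination (η a).im * e12i
  · rw [b]
    have : β a1 = 0 := by linarith
    have h' : β a2 = 0 := by linarith
    rw [this, h']; simp [mul_comm]

/-- This plays the role of `d² = 0`: all exterior derivatives below are antisymmetrized derivatives
on constant fields, so no bracket term appears. -/
theorem fderiv_fderiv_comm {F : Type*} [NormedAddCommGroup F] [NormedSpace ℝ F] {g : E → F}
    {y : E} (hg : ContDiffAt ℝ ∞ g y) (w a : E) :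
    fderiv ℝ (fun z => fderiv ℝ g z a) y w = fderiv ℝ (fun z => fderiv ℝ g z w) y a := by
  have hs : IsSymmSndFDerivAt ℝ g y := hg.isSymmSndFDerivAt (by
    simp only [minSmoothness_of_isRCLikeNormedField]
    exact WithTop.coe_le_coe.2 (le_top : (2 : ℕ∞) ≤ ⊤))
  have hd : DifferentiableAt ℝ (fderiv ℝ g) y :=
    (hg.fderiv_right (m := 1) (by norm_cast)).differentiableAt (by norm_num)
  rw [fderiv_clm_apply hd (differentiableAt_const a),
    fderiv_clm_apply hd (differentiableAt_const w)]
  simpa using hs w a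

theorem contDiffAt_fderiv_apply {F : Type*} [NormedAddCommGroup F] [NormedSpace ℝ F] {g : E → F}
    {y : E} (hg : ContDiffAt ℝ ∞ g y) (a : E) : ContDiffAt ℝ ∞ (fun z => fderiv ℝ g z a) y :=
  (hg.fderiv_right (m := ∞) (by norm_cast)).clm_apply contDiffAt_const

theorem fderiv_innerC_apply {f g : E → C2} {y : E} (hf : DifferentiableAt ℝ f y)
    (hg : DifferentiableAt ℝ g y) (w : E) :
    fderiv ℝ (fun z => inner ℂ (f z) (g z)) y w
      = inner ℂ (fderiv ℝ f y w) (g y) + inner ℂ (f y) (fderiv ℝ g y w) := by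
  rw [(HasFDerivAt.inner ℂ hf.hasFDerivAt hg.hasFDerivAt).fderiv]
  simp [fderivInnerCLM_apply, add_comm]

theorem fderiv_re_apply {f : E → ℂ} {y : E} (hf : DifferentiableAt ℝ f y) (w : E) :
    fderiv ℝ (fun z => (f z).re) y w = (fderiv ℝ f y w).re := by
  have := (Complex.reCLM.hasFDerivAt.comp y hf.hasFDerivAt).fderiv
  exact congrArg (fun L => L w) this

theorem fderiv_im_apply {f : E → ℂ} {y : E} (hf : DifferentiableAt ℝ f y) (w : E) :
    fderiv ℝ (fun z => (f z).im) y w = (fderiv ℝ f y w).im := by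
  have := (Complex.imCLM.hasFDerivAt.comp y hf.hasFDerivAt).fderiv
  exact congrArg (fun L => L w) this

/-- Pointwise linear algebra of the second structure equation. -/
theorem second_structure_algebra {E : Type*} [AddCommGroup E] [Module ℝ E]
    (η dq : E →ₗ[ℝ] ℂ) (θ dμ : E →ₗ[ℝ] ℝ) (q : ℂ) (μ : ℝ) (κ : E → ℂ)
    (hκ : ∀ a, κ a = -(Complex.I / 2) * η a + q * (starRingEnd ℂ) (η a))
    (hb : Function.Bijective fun a => (η a, θ a)) (dη : E → E → ℂ)
    (hη : ∀ w a, dη w a = -κ w * θ a + Complex.I * (μ * θ w) * η a + κ a * θ w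
      - Complex.I * (μ * θ a) * η w)
    (h1 : ∀ w a, -(Complex.I / 2) * dη w a + dq w * (starRingEnd ℂ) (η a)
        - dq a * (starRingEnd ℂ) (η w) + q * (starRingEnd ℂ) (dη w a)
      = 2 * Complex.I * (μ * θ w * κ a - μ * θ a * κ w))
    (h2 : ∀ w a, dμ w * θ a - dμ a * θ w + μ * (η w * (starRingEnd ℂ) (η a)).im
      = 2 * ((starRingEnd ℂ) (κ w) * κ a).im) :
    μ = 2 * Complex.normSq q - 1 / 2 ∧ (∀ a, θ a = 0 → dμ a = 0) ∧
      ∃ s, ∀ a, dq a = 3 * Complex.I * μ * q * θ a + s * (starRingEnd ℂ) (η a) := by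
  obtain ⟨a1, e1⟩ := hb.2 (1, 0)
  obtain ⟨a2, e2⟩ := hb.2 (Complex.I, 0)
  obtain ⟨a3, e3⟩ := hb.2 (0, 1)
  simp only [Prod.mk.injEq] at e1 e2 e3
  have dec : ∀ a, a = (η a).re • a1 + (η a).im • a2 + θ a • a3 := by
    intro a
    apply hb.1
    simp only [map_add, map_smul, e1.1, e1.2, e2.1, e2.2, e3.1, e3.2, Prod.mk.injEq]
    refine ⟨?_, by simp⟩
    apply Complex.ext <;> simp
  have c2 : (starRingEnd ℂ) 2 = 2 := Complex.conj_ofNat 2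
  have k1 : κ a1 = -(Complex.I / 2) + q := by rw [hκ, e1.1]; simp
  have k2 : κ a2 = 1 / 2 - Complex.I * q := by
    rw [hκ, e2.1, Complex.conj_I]
    linear_combination (-1 / 2 : ℂ) * Complex.I_mul_I
  have k3 : κ a3 = 0 := by rw [hκ, e3.1]; simp
  -- The equation for `dβ` on the contact plane. Its values on pairs containing `a3`, where `κ`
  -- vanishes, then give `dμ = 0` on that plane.
  have hμ : μ = 2 * Complex.normSq q - 1 / 2 := by
    have := h2 a1 a2
    rw [e1.1, e1.2, e2.1, e2.2, k1, k2] at this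
    simp [c2] at this
    rw [Complex.normSq_apply]
    linarith
  have m1 : dμ a1 = 0 := by
    have := h2 a1 a3
    rw [e1.2, e3.1, e3.2, k3] at this
    simpa using this
  have m2 : dμ a2 = 0 := by
    have := h2 a2 a3
    rw [e2.2, e3.1, e3.2, k3] at this
    simpa using this
  -- The equation for `dκ` on the contact plane: modulo `θ`, `dq` is antilinear in `η`. Its value on
  -- `(a1, a3)` fixes the `θ` component, once `|q|²` is eliminated through `hμ`.
  have q2 : dq a2 = -Complex.I * dq a1 := by
    have := h1 a1 a2
    rw [hη, e1.1, e1.2, e2.1, e2.2] at this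
    simp at this
    linear_combination -this
  have q3 : dq a3 = 3 * Complex.I * μ * q := by
    have := h1 a1 a3
    rw [hη, e1.1, e1.2, e3.1, e3.2, k3, k1] at this
    simp [c2] at this
    have hn : (starRingEnd ℂ) q * q = Complex.normSq q := by
      rw [mul_comm, Complex.mul_conj]
    have hμ' : (μ : ℂ) = 2 * Complex.normSq q - 1 / 2 := by rw [hμ]; push_cast; ring
    linear_combination -this - hn + (1 / 2 : ℂ) * hμ'
      + (-μ / 2 - 1 / 4 : ℂ) * Complex.I_mul_I
  refine ⟨hμ, fun a ha => ?_, dq a1, fun a => ?_⟩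
  · rw [dec a, ha]
    simp [m1, m2]
  · have : dq a = (η a).re • dq a1 + (η a).im • dq a2 + θ a • dq a3 := by
      conv_lhs => rw [dec a]
      simp only [map_add, map_smul]
    have hc : (starRingEnd ℂ) (η a) = (η a).re - (η a).im * Complex.I := by
      apply Complex.ext <;> simp
    rw [this, q2, q3, hc]
    simp only [Complex.real_smul]
    ring

/-- The component of `DN a` along `quatJ N`. -/
def kappaForm (N : E → C2) (a y : E) : ℂ := inner ℂ (quatJ (N y)) (fderiv ℝ N y a)

namespace IsAdapted

variable {O : Set E} {ψ N : E → C2}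

theorem inner_N_psi (h : IsAdapted O ψ N) {y : E} (hy : y ∈ O) (a : E) :
    inner ℂ (N y) (fderiv ℝ ψ y a) = thetaForm ψ N a y := by
  apply Complex.ext
  · simp [thetaForm]
  · simpa using h.im_inner y hy a

theorem contDiffAt_psi (h : IsAdapted O ψ N) {y : E} (hy : y ∈ O) : ContDiffAt ℝ ∞ ψ y :=
  h.smooth_psi.contDiffAt (h.isOpen.mem_nhds hy)

theorem contDiffAt_N (h : IsAdapted O ψ N) {y : E} (hy : y ∈ O) : ContDiffAt ℝ ∞ N y :=
  h.smooth_N.contDiffAt (h.isOpen.mem_nhds hy)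

theorem contDiffAt_quatJ_N (h : IsAdapted O ψ N) {y : E} (hy : y ∈ O) :
    ContDiffAt ℝ ∞ (fun z => quatJ (N z)) y :=
  quatJ.contDiff.contDiffAt.comp y (h.contDiffAt_N hy)

theorem fderiv_quatJ_N (h : IsAdapted O ψ N) {y : E} (hy : y ∈ O) (w : E) :
    fderiv ℝ (fun z => quatJ (N z)) y w = quatJ (fderiv ℝ N y w) := by
  have := (quatJ.hasFDerivAt.comp y
    ((h.contDiffAt_N hy).differentiableAt (by simp)).hasFDerivAt).fderiv
  exact congrArg (fun L => L w) this

theorem inner_N_N (h : IsAdapted O ψ N) {y : E} (hy : y ∈ O) (a : E) :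
    inner ℂ (N y) (fderiv ℝ N y a) = Complex.I * betaForm N a y := by
  have hN := (h.contDiffAt_N hy).differentiableAt (by simp)
  have h1 : (fun z => inner ℂ (N z) (N z)) =ᶠ[𝓝 y] fun _ => (1 : ℂ) := by
    filter_upwards [h.isOpen.mem_nhds hy] with z hz
    exact inner_self_of_norm_one (h.norm_N z hz)
  have h2 := fderiv_innerC_apply hN hN a
  rw [h1.fderiv_eq] at h2
  have h3 : inner ℂ (fderiv ℝ N y a) (N y) = (starRingEnd ℂ) (inner ℂ (N y) (fderiv ℝ N y a)) :=
    (inner_conj_symm _ _).symm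
  rw [h3] at h2
  apply Complex.ext
  · have := congrArg Complex.re h2
    simp [-inner_conj_symm] at this ⊢
    linarith
  · simp [betaForm]

theorem inner_expand (h : IsAdapted O ψ N) {y : E} (hy : y ∈ O) (w a : E) :
    inner ℂ (fderiv ℝ N y w) (fderiv ℝ ψ y a)
      = (starRingEnd ℂ) (kappaForm N w y) * etaForm ψ N a y
        - Complex.I * betaForm N w y * thetaForm ψ N a y := by
  rw [inner_eq_of_norm_one (h.norm_N y hy), h.inner_N_N hy, h.inner_N_psi hy]
  simp [kappaForm, etaForm]
  ring

theorem fderiv_inner_N_psi (h : IsAdapted O ψ N) {y : E} (hy : y ∈ O) (w a : E) :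
    fderiv ℝ (fun z => inner ℂ (N z) (fderiv ℝ ψ z a)) y w
      = inner ℂ (fderiv ℝ N y w) (fderiv ℝ ψ y a)
        + inner ℂ (N y) (fderiv ℝ (fun z => fderiv ℝ ψ z a) y w) :=
  fderiv_innerC_apply ((h.contDiffAt_N hy).differentiableAt (by simp))
    ((contDiffAt_fderiv_apply (h.contDiffAt_psi hy) a).differentiableAt (by simp)) w

theorem differentiableAt_inner_N_psi (h : IsAdapted O ψ N) {y : E} (hy : y ∈ O) (a : E) :
    DifferentiableAt ℝ (fun z => inner ℂ (N z) (fderiv ℝ ψ z a)) y :=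
  DifferentiableAt.inner ℂ ((h.contDiffAt_N hy).differentiableAt (by simp))
    ((contDiffAt_fderiv_apply (h.contDiffAt_psi hy) a).differentiableAt (by simp))

/-- Antisymmetrizing the derivative of `⟨N, Dψ⟩` cancels the second derivatives of `ψ`. The
imaginary part vanishes because `⟨N, Dψ⟩` is real; the real part is the contact condition. -/
theorem inner_antisymm (h : IsAdapted O ψ N) {y : E} (hy : y ∈ O) (w a : E) :
    inner ℂ (fderiv ℝ N y w) (fderiv ℝ ψ y a) - inner ℂ (fderiv ℝ N y a) (fderiv ℝ ψ y w)
      = ((etaForm ψ N w y * (starRingEnd ℂ) (etaForm ψ N a y)).im : ℂ) := by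
  have key : ∀ b, (fun z => (inner ℂ (N z) (fderiv ℝ ψ z b)).im) =ᶠ[𝓝 y] fun _ => (0 : ℝ) := by
    intro b
    filter_upwards [h.isOpen.mem_nhds hy] with z hz
    exact h.im_inner z hz b
  have e : ∀ w a, (inner ℂ (fderiv ℝ N y w) (fderiv ℝ ψ y a)).im
        + (inner ℂ (N y) (fderiv ℝ (fun z => fderiv ℝ ψ z a) y w)).im = 0 := by
    intro w a
    have h2 := fderiv_im_apply (h.differentiableAt_inner_N_psi hy a) w
    rw [(key a).fderiv_eq, h.fderiv_inner_N_psi hy] at h2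
    simpa using h2.symm
  have e1 := e w a
  have e2 := e a w
  rw [fderiv_fderiv_comm (h.contDiffAt_psi hy) a w] at e2
  apply Complex.ext
  · simpa using h.contact y hy w a
  · simp; linarith

theorem first_structure (h : IsAdapted O ψ N) {y : E} (hy : y ∈ O) :
    ∃ (q : ℂ) (μ : ℝ), ∀ a,
      kappaForm N a y = -(Complex.I / 2) * etaForm ψ N a y
        + q * (starRingEnd ℂ) (etaForm ψ N a y) ∧
      betaForm N a y = μ * thetaForm ψ N a y := by
  let η : E →ₗ[ℝ] ℂ := ⟨⟨fun a => etaForm ψ N a y, fun a b => by simp [etaForm]⟩,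
    fun c a => by simp [etaForm]⟩
  let κ : E →ₗ[ℝ] ℂ := ⟨⟨fun a => kappaForm N a y, fun a b => by
    simp [kappaForm]⟩, fun c a => by simp [kappaForm]⟩
  let θ : E →ₗ[ℝ] ℝ := ⟨⟨fun a => thetaForm ψ N a y, fun a b => by
    simp [thetaForm]⟩, fun c a => by simp [thetaForm]⟩
  let β : E →ₗ[ℝ] ℝ := ⟨⟨fun a => betaForm N a y, fun a b => by
    simp [betaForm]⟩, fun c a => by simp [betaForm]⟩
  refine structure_algebra η κ θ β (h.bij y hy) fun w a => ?_
  have := h.inner_antisymm hy w a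
  rw [h.inner_expand hy, h.inner_expand hy] at this
  change (starRingEnd ℂ) (kappaForm N w y) * etaForm ψ N a y
    - (starRingEnd ℂ) (kappaForm N a y) * etaForm ψ N w y
      - Complex.I * (betaForm N w y * thetaForm ψ N a y - betaForm N a y * thetaForm ψ N w y)
    = ((etaForm ψ N w y * (starRingEnd ℂ) (etaForm ψ N a y)).im : ℂ)
  rw [← this]
  ring

/-- The derivative of the other frame vector needs no new forms: its components are those of `DN`,
because `quatJ` is antilinear and isometric. -/
theorem fderiv_quatJ_N_eq (h : IsAdapted O ψ N) {y : E} (hy : y ∈ O) (w : E) (v : C2) :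
    inner ℂ (quatJ (fderiv ℝ N y w)) v
      = -kappaForm N w y * inner ℂ (N y) v
        + Complex.I * betaForm N w y * inner ℂ (quatJ (N y)) v := by
  rw [inner_eq_of_norm_one (h.norm_N y hy), inner_quatJ_quatJ, h.inner_N_N hy,
    inner_conj_symm, inner_quatJ_left _ (N y)]
  simp only [kappaForm, Complex.conj_conj]
  ring

theorem contDiffAt_etaForm (h : IsAdapted O ψ N) {y : E} (hy : y ∈ O) (a : E) :
    ContDiffAt ℝ ∞ (etaForm ψ N a) y :=
  (h.contDiffAt_quatJ_N hy).inner ℂ (contDiffAt_fderiv_apply (h.contDiffAt_psi hy) a)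

theorem contDiffAt_kappaForm (h : IsAdapted O ψ N) {y : E} (hy : y ∈ O) (a : E) :
    ContDiffAt ℝ ∞ (kappaForm N a) y :=
  (h.contDiffAt_quatJ_N hy).inner ℂ (contDiffAt_fderiv_apply (h.contDiffAt_N hy) a)

theorem contDiffAt_thetaForm (h : IsAdapted O ψ N) {y : E} (hy : y ∈ O) (a : E) :
    ContDiffAt ℝ ∞ (thetaForm ψ N a) y :=
  Complex.reCLM.contDiff.contDiffAt.comp y
    ((h.contDiffAt_N hy).inner ℂ (contDiffAt_fderiv_apply (h.contDiffAt_psi hy) a))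

theorem contDiffAt_betaForm (h : IsAdapted O ψ N) {y : E} (hy : y ∈ O) (a : E) :
    ContDiffAt ℝ ∞ (betaForm N a) y :=
  Complex.imCLM.contDiff.contDiffAt.comp y
    ((h.contDiffAt_N hy).inner ℂ (contDiffAt_fderiv_apply (h.contDiffAt_N hy) a))

/-- First structure equation: `D(Dψ)` is symmetric, so only the rotation of the frame contributes.
-/
theorem d_etaForm (h : IsAdapted O ψ N) {y : E} (hy : y ∈ O) (w a : E) :
    fderiv ℝ (etaForm ψ N a) y w - fderiv ℝ (etaForm ψ N w) y a
      = -kappaForm N w y * thetaForm ψ N a y + Complex.I * betaForm N w y * etaForm ψ N a y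
        + kappaForm N a y * thetaForm ψ N w y
        - Complex.I * betaForm N a y * etaForm ψ N w y := by
  have e : ∀ w a, fderiv ℝ (etaForm ψ N a) y w
      = inner ℂ (quatJ (fderiv ℝ N y w)) (fderiv ℝ ψ y a)
        + inner ℂ (quatJ (N y)) (fderiv ℝ (fun z => fderiv ℝ ψ z a) y w) := by
    intro w a
    rw [← h.fderiv_quatJ_N hy]
    exact fderiv_innerC_apply ((h.contDiffAt_quatJ_N hy).differentiableAt (by simp))
      ((contDiffAt_fderiv_apply (h.contDiffAt_psi hy) a).differentiableAt (by simp)) w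
  rw [e, e, fderiv_fderiv_comm (h.contDiffAt_psi hy) a w, h.fderiv_quatJ_N_eq hy,
    h.fderiv_quatJ_N_eq hy, h.inner_N_psi hy, h.inner_N_psi hy]
  simp only [etaForm]
  ring

/-- Flatness of ℂ² in the frame `quatJ N, N`. The diagonal connection forms are `-iβ` and `iβ`,
hence the factor `2i`. The equation for `betaForm` is the other component. -/
theorem d_kappaForm (h : IsAdapted O ψ N) {y : E} (hy : y ∈ O) (w a : E) :
    fderiv ℝ (kappaForm N a) y w - fderiv ℝ (kappaForm N w) y a
      = 2 * Complex.I * (betaForm N w y * kappaForm N a y - betaForm N a y * kappaForm N w y) := by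
  have e : ∀ w a, fderiv ℝ (kappaForm N a) y w
      = inner ℂ (quatJ (fderiv ℝ N y w)) (fderiv ℝ N y a)
        + inner ℂ (quatJ (N y)) (fderiv ℝ (fun z => fderiv ℝ N z a) y w) := by
    intro w a
    rw [← h.fderiv_quatJ_N hy]
    exact fderiv_innerC_apply ((h.contDiffAt_quatJ_N hy).differentiableAt (by simp))
      ((contDiffAt_fderiv_apply (h.contDiffAt_N hy) a).differentiableAt (by simp)) w
  rw [e, e, fderiv_fderiv_comm (h.contDiffAt_N hy) a w, h.fderiv_quatJ_N_eq hy,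
    h.fderiv_quatJ_N_eq hy, h.inner_N_N hy, h.inner_N_N hy]
  simp only [kappaForm]
  ring

theorem d_thetaForm (h : IsAdapted O ψ N) {y : E} (hy : y ∈ O) (w a : E) :
    fderiv ℝ (thetaForm ψ N a) y w - fderiv ℝ (thetaForm ψ N w) y a
      = (etaForm ψ N w y * (starRingEnd ℂ) (etaForm ψ N a y)).im := by
  have e : ∀ w a, fderiv ℝ (thetaForm ψ N a) y w
      = (inner ℂ (fderiv ℝ N y w) (fderiv ℝ ψ y a)).re
        + (inner ℂ (N y) (fderiv ℝ (fun z => fderiv ℝ ψ z a) y w)).re := by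
    intro w a
    have := fderiv_re_apply (h.differentiableAt_inner_N_psi hy a) w
    rw [h.fderiv_inner_N_psi hy] at this
    exact this
  rw [e, e, fderiv_fderiv_comm (h.contDiffAt_psi hy) a w, ← h.contact y hy w a]
  ring

theorem d_betaForm (h : IsAdapted O ψ N) {y : E} (hy : y ∈ O) (w a : E) :
    fderiv ℝ (betaForm N a) y w - fderiv ℝ (betaForm N w) y a
      = 2 * ((starRingEnd ℂ) (kappaForm N w y) * kappaForm N a y).im := by
  have e : ∀ w a, fderiv ℝ (betaForm N a) y w
      = (inner ℂ (fderiv ℝ N y w) (fderiv ℝ N y a)).im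
        + (inner ℂ (N y) (fderiv ℝ (fun z => fderiv ℝ N z a) y w)).im := by
    intro w a
    have h1 := (h.contDiffAt_N hy).differentiableAt (by simp)
    have h2 := (contDiffAt_fderiv_apply (h.contDiffAt_N hy) a).differentiableAt (by simp)
    have := fderiv_im_apply (DifferentiableAt.inner ℂ h1 h2) w
    rw [fderiv_innerC_apply h1 h2] at this
    exact this
  rw [e, e, fderiv_fderiv_comm (h.contDiffAt_N hy) a w,
    inner_eq_of_norm_one (h.norm_N y hy), inner_eq_of_norm_one (h.norm_N y hy) (fderiv ℝ N y a),
    h.inner_N_N hy, h.inner_N_N hy]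
  simp [kappaForm, -inner_conj_symm]
  ring

end IsAdapted

end Adapted

/-! ### Rigidity of adapted pairs: the invariant `q` is locally constant -/

theorem fderiv_conj_apply {E : Type*} [NormedAddCommGroup E] [NormedSpace ℝ E] {f : E → ℂ} {y : E}
    (hf : DifferentiableAt ℝ f y) (w : E) :
    fderiv ℝ (fun z => (starRingEnd ℂ) (f z)) y w = (starRingEnd ℂ) (fderiv ℝ f y w) := by
  have := (Complex.conjCLE.toContinuousLinearMap.hasFDerivAt.comp y hf.hasFDerivAt).fderiv
  exact congrArg (fun L => L w) this

theorem fderiv_normSq_apply {E : Type*} [NormedAddCommGroup E] [NormedSpace ℝ E] {f : E → ℂ}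
    {y : E} (hf : DifferentiableAt ℝ f y) (w : E) :
    fderiv ℝ (fun z => Complex.normSq (f z)) y w
      = 2 * ((starRingEnd ℂ) (f y) * fderiv ℝ f y w).re := by
  have hr : HasFDerivAt (fun z => (f z).re) (Complex.reCLM.comp (fderiv ℝ f y)) y :=
    Complex.reCLM.hasFDerivAt.comp y hf.hasFDerivAt
  have hi : HasFDerivAt (fun z => (f z).im) (Complex.imCLM.comp (fderiv ℝ f y)) y :=
    Complex.imCLM.hasFDerivAt.comp y hf.hasFDerivAt
  have := ((hr.mul hr).add (hi.mul hi)).fderiv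
  have h2 : (fun z => Complex.normSq (f z))
      = (fun z => (f z).re) * (fun z => (f z).re) + (fun z => (f z).im) * (fun z => (f z).im) := by
    ext z; simp [Complex.normSq_apply]
  rw [h2, this]
  simp
  ring

/-- A function with vanishing derivative near a point is constant near that point. -/
theorem eventually_eq_of_fderiv_eq_zero {E F : Type*} [NormedAddCommGroup E] [NormedSpace ℝ E]
    [NormedAddCommGroup F] [NormedSpace ℝ F] {O : Set E} (hO : IsOpen O) {g : E → F}
    (hg : DifferentiableOn ℝ g O) (h : ∀ y ∈ O, fderiv ℝ g y = 0) {y₀ : E} (hy₀ : y₀ ∈ O) :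
    ∀ᶠ y in 𝓝 y₀, g y = g y₀ := by
  obtain ⟨r, hr, hb⟩ := Metric.isOpen_iff.1 hO y₀ hy₀
  filter_upwards [Metric.ball_mem_nhds y₀ hr] with y hy
  exact Metric.isOpen_ball.is_const_of_fderiv_eq_zero
    (convex_ball y₀ r).isPreconnected (hg.mono hb) (fun z hz => h z (hb hz)) hy
    (Metric.mem_ball_self hr)

namespace IsAdapted

variable {E : Type*} [NormedAddCommGroup E] [NormedSpace ℝ E] {O : Set E} {ψ N : E → C2}

section

variable {q : E → ℂ} {μ : E → ℝ}

/-- Here `q` comes pointwise from a choice. It is smooth because it is a quotient of smooth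
functions wherever some `η a` is nonzero. -/
theorem contDiffAt_q (h : IsAdapted O ψ N)
    (hq : ∀ y ∈ O, ∀ a, kappaForm N a y = -(Complex.I / 2) * etaForm ψ N a y
        + q y * (starRingEnd ℂ) (etaForm ψ N a y)) {y : E} (hy : y ∈ O) :
    ContDiffAt ℝ ∞ q y := by
  obtain ⟨a, ha⟩ := (h.bij y hy).2 (1, 0)
  simp only [Prod.mk.injEq] at ha
  have hc := h.contDiffAt_etaForm hy a
  have hcc : ContDiffAt ℝ ∞ (fun z => (starRingEnd ℂ) (etaForm ψ N a z)) y :=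
    Complex.conjCLE.contDiff.contDiffAt.comp y hc
  have hne : ∀ᶠ z in 𝓝 y, etaForm ψ N a z ≠ 0 :=
    hc.continuousAt.eventually_ne (by rw [ha.1]; exact one_ne_zero)
  have : q =ᶠ[𝓝 y] fun z => (kappaForm N a z + Complex.I / 2 * etaForm ψ N a z)
      * ((starRingEnd ℂ) (etaForm ψ N a z))⁻¹ := by
    filter_upwards [hne, h.isOpen.mem_nhds hy] with z hz hzO
    rw [hq z hzO a]
    have : (starRingEnd ℂ) (etaForm ψ N a z) ≠ 0 := by simpa using hz
    field_simp
    ring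
  refine ContDiffAt.congr_of_eventuallyEq ?_ this
  exact ((h.contDiffAt_kappaForm hy a).add (contDiffAt_const.mul hc)).mul
    (hcc.inv (by rw [ha.1]; simp))

theorem contDiffAt_mu (h : IsAdapted O ψ N)
    (hμ : ∀ y ∈ O, ∀ a, betaForm N a y = μ y * thetaForm ψ N a y) {y : E} (hy : y ∈ O) :
    ContDiffAt ℝ ∞ μ y := by
  obtain ⟨a, ha⟩ := (h.bij y hy).2 (0, 1)
  simp only [Prod.mk.injEq] at ha
  have hc := h.contDiffAt_thetaForm hy a
  have hne : ∀ᶠ z in 𝓝 y, thetaForm ψ N a z ≠ 0 :=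
    hc.continuousAt.eventually_ne (by rw [ha.2]; exact one_ne_zero)
  have : μ =ᶠ[𝓝 y] fun z => betaForm N a z * (thetaForm ψ N a z)⁻¹ := by
    filter_upwards [hne, h.isOpen.mem_nhds hy] with z hz hzO
    rw [hμ z hzO a]
    field_simp
  refine ContDiffAt.congr_of_eventuallyEq ?_ this
  exact (h.contDiffAt_betaForm hy a).mul (hc.inv (by rw [ha.2]; simp))

/-- Obtained by substituting `κ = -(i/2) η + q η̄` and `β = μ θ` into the structure equations for
`dη`, `dκ`, `dθ` and `dβ`. -/
theorem second_structure (h : IsAdapted O ψ N)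
    (hq : ∀ y ∈ O, ∀ a, kappaForm N a y = -(Complex.I / 2) * etaForm ψ N a y
        + q y * (starRingEnd ℂ) (etaForm ψ N a y))
    (hμ : ∀ y ∈ O, ∀ a, betaForm N a y = μ y * thetaForm ψ N a y) {y : E} (hy : y ∈ O) :
    μ y = 2 * Complex.normSq (q y) - 1 / 2 ∧
      (∀ a, thetaForm ψ N a y = 0 → fderiv ℝ μ y a = 0) ∧
      ∃ s, ∀ a, fderiv ℝ q y a = 3 * Complex.I * μ y * q y * thetaForm ψ N a y
        + s * (starRingEnd ℂ) (etaForm ψ N a y) := by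
  let η : E →ₗ[ℝ] ℂ := ⟨⟨fun a => etaForm ψ N a y, fun a b => by simp [etaForm]⟩,
    fun c a => by simp [etaForm]⟩
  let θ : E →ₗ[ℝ] ℝ := ⟨⟨fun a => thetaForm ψ N a y, fun a b => by
    simp [thetaForm]⟩, fun c a => by simp [thetaForm]⟩
  have dq := (h.contDiffAt_q hq hy).differentiableAt (by simp)
  have dμ := (h.contDiffAt_mu hμ hy).differentiableAt (by simp)
  have de : ∀ a, DifferentiableAt ℝ (etaForm ψ N a) y :=
    fun a => (h.contDiffAt_etaForm hy a).differentiableAt (by simp)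
  have dt : ∀ a, DifferentiableAt ℝ (thetaForm ψ N a) y :=
    fun a => (h.contDiffAt_thetaForm hy a).differentiableAt (by simp)
  refine second_structure_algebra η (fderiv ℝ q y).toLinearMap θ (fderiv ℝ μ y).toLinearMap
    (q y) (μ y) (fun a => kappaForm N a y) (hq y hy) (h.bij y hy)
    (fun w a => fderiv ℝ (etaForm ψ N a) y w - fderiv ℝ (etaForm ψ N w) y a) ?_ ?_ ?_
  · intro w a
    change fderiv ℝ (etaForm ψ N a) y w - fderiv ℝ (etaForm ψ N w) y a =
      -kappaForm N w y * thetaForm ψ N a y + Complex.I * (μ y * thetaForm ψ N w y)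
        * etaForm ψ N a y + kappaForm N a y * thetaForm ψ N w y
        - Complex.I * (μ y * thetaForm ψ N a y) * etaForm ψ N w y
    rw [h.d_etaForm hy, hμ y hy, hμ y hy]
    push_cast
    ring
  · intro w a
    change -(Complex.I / 2) * (fderiv ℝ (etaForm ψ N a) y w - fderiv ℝ (etaForm ψ N w) y a)
        + fderiv ℝ q y w * (starRingEnd ℂ) (etaForm ψ N a y)
        - fderiv ℝ q y a * (starRingEnd ℂ) (etaForm ψ N w y)
        + q y * (starRingEnd ℂ) (fderiv ℝ (etaForm ψ N a) y w - fderiv ℝ (etaForm ψ N w) y a)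
      = 2 * Complex.I * (μ y * thetaForm ψ N w y * kappaForm N a y
        - μ y * thetaForm ψ N a y * kappaForm N w y)
    have e : ∀ w a, fderiv ℝ (kappaForm N a) y w = -(Complex.I / 2) * fderiv ℝ (etaForm ψ N a) y w
        + (q y * (starRingEnd ℂ) (fderiv ℝ (etaForm ψ N a) y w)
        + fderiv ℝ q y w * (starRingEnd ℂ) (etaForm ψ N a y)) := by
      intro w a
      have e1 : kappaForm N a =ᶠ[𝓝 y] fun z => -(Complex.I / 2) * etaForm ψ N a z
          + q z * (starRingEnd ℂ) (etaForm ψ N a z) := by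
        filter_upwards [h.isOpen.mem_nhds hy] with z hz using hq z hz a
      have dc : DifferentiableAt ℝ (fun z => (starRingEnd ℂ) (etaForm ψ N a z)) y :=
        Complex.conjCLE.differentiableAt.comp y (de a)
      rw [e1.fderiv_eq, fderiv_fun_add ((de a).const_mul _) (dq.fun_mul dc),
        fderiv_fun_mul dq dc, fderiv_const_mul (de a)]
      simp [fderiv_conj_apply (de a), mul_comm]
    have := h.d_kappaForm hy w a
    rw [e, e, hμ y hy, hμ y hy] at this
    push_cast at this
    rw [← this, map_sub]
    ring
  · intro w a
    change fderiv ℝ μ y w * thetaForm ψ N a y - fderiv ℝ μ y a * thetaForm ψ N w y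
      + μ y * (etaForm ψ N w y * (starRingEnd ℂ) (etaForm ψ N a y)).im
      = 2 * ((starRingEnd ℂ) (kappaForm N w y) * kappaForm N a y).im
    have e : ∀ w a, fderiv ℝ (betaForm N a) y w = μ y * fderiv ℝ (thetaForm ψ N a) y w
        + fderiv ℝ μ y w * thetaForm ψ N a y := by
      intro w a
      have e1 : betaForm N a =ᶠ[𝓝 y] fun z => μ z * thetaForm ψ N a z := by
        filter_upwards [h.isOpen.mem_nhds hy] with z hz using hμ z hz a
      rw [e1.fderiv_eq, fderiv_fun_mul dμ (dt a)]
      simp [mul_comm]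
    rw [← h.d_betaForm hy, e, e, ← h.d_thetaForm hy]
    ring

end

/-- The structure theorem: near every point the second fundamental form of an adapted pair is
determined by a constant `q`, which is either `0` or of absolute value `1 / 2`. -/
theorem eventually_const (h : IsAdapted O ψ N) {y₀ : E} (hy₀ : y₀ ∈ O) :
    ∃ q : ℂ, (q = 0 ∨ Complex.normSq q = 1 / 4) ∧ ∀ᶠ y in 𝓝 y₀, ∀ a,
      kappaForm N a y = -(Complex.I / 2) * etaForm ψ N a y
        + q * (starRingEnd ℂ) (etaForm ψ N a y) ∧
      betaForm N a y = (2 * Complex.normSq q - 1 / 2) * thetaForm ψ N a y := by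
  have hex := fun y (hy : y ∈ O) => h.first_structure hy
  choose! q μ hqμ using hex
  have hq := fun y (hy : y ∈ O) a => (hqμ y hy a).1
  have hμ := fun y (hy : y ∈ O) a => (hqμ y hy a).2
  have hS := fun y (hy : y ∈ O) => h.second_structure hq hμ hy
  have dq : DifferentiableOn ℝ q O := fun y hy =>
    ((h.contDiffAt_q hq hy).differentiableAt (by simp)).differentiableWithinAt
  have dμ : DifferentiableOn ℝ μ O := fun y hy =>
    ((h.contDiffAt_mu hμ hy).differentiableAt (by simp)).differentiableWithinAt
  have key : ∀ y ∈ O, fderiv ℝ μ y = 0 ∧ (q y ≠ 0 →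
      ∀ a, fderiv ℝ q y a = 3 * Complex.I * μ y * q y * thetaForm ψ N a y) := by
    intro y hy
    obtain ⟨-, h2, s, h3⟩ := hS y hy
    have dqy := dq.differentiableAt (h.isOpen.mem_nhds hy)
    have e1 : μ =ᶠ[𝓝 y] fun z => 2 * Complex.normSq (q z) - 1 / 2 := by
      filter_upwards [h.isOpen.mem_nhds hy] with z hz using (hS z hz).1
    have dn : DifferentiableAt ℝ (fun z => Complex.normSq (q z)) y := by
      have h2 : (fun z => Complex.normSq (q z))
          = fun z => (q z).re * (q z).re + (q z).im * (q z).im := by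
        ext z; simp [Complex.normSq_apply]
      rw [h2]
      have hr : DifferentiableAt ℝ (fun z => (q z).re) y :=
        Complex.reCLM.differentiableAt.comp y dqy
      have hi : DifferentiableAt ℝ (fun z => (q z).im) y :=
        Complex.imCLM.differentiableAt.comp y dqy
      exact (hr.mul hr).add (hi.mul hi)
    have hm : ∀ w, fderiv ℝ μ y w = 4 * ((starRingEnd ℂ) (q y) * fderiv ℝ q y w).re := by
      intro w
      rw [e1.fderiv_eq, fderiv_sub_const, fderiv_const_mul dn]
      simp [fderiv_normSq_apply dqy]
      ring
    -- On the contact plane `dμ = 0`, while `dμ = 4 Re(q̄ dq) = 4 Re(q̄ s η̄)`. The values `η = 1`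
    -- and `η = i` kill both parts of `q̄ s`. The remaining term `3iμ|q|²θ` of `q̄ dq` is imaginary,
    -- so `dμ` vanishes altogether.
    have hqs : (starRingEnd ℂ) (q y) * s = 0 := by
      obtain ⟨a1, ha1⟩ := (h.bij y hy).2 (1, 0)
      obtain ⟨a2, ha2⟩ := (h.bij y hy).2 (Complex.I, 0)
      simp only [Prod.mk.injEq] at ha1 ha2
      have t1 := hm a1
      have t2 := hm a2
      rw [h2 a1 ha1.2, h3, ha1.1, ha1.2] at t1
      rw [h2 a2 ha2.2, h3, ha2.1, ha2.2] at t2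
      apply Complex.ext
      · simp at t1 ⊢; linarith
      · simp at t2 ⊢; linarith
    constructor
    · ext w
      rw [hm, h3]
      have : (starRingEnd ℂ) (q y) * (3 * Complex.I * μ y * q y * thetaForm ψ N w y
          + s * (starRingEnd ℂ) (etaForm ψ N w y))
          = Complex.I * ((3 * μ y * Complex.normSq (q y) * thetaForm ψ N w y : ℝ) : ℂ) := by
        push_cast
        rw [← Complex.mul_conj]
        linear_combination (starRingEnd ℂ) (etaForm ψ N w y) * hqs
      rw [this]
      simp
    · intro hne a
      have : s = 0 := by
        rcases mul_eq_zero.1 hqs with h0 | h0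
        · exact absurd (by simpa using h0) hne
        · exact h0
      rw [h3, this]; simp
  have hμc := eventually_eq_of_fderiv_eq_zero h.isOpen dμ (fun y hy => (key y hy).1) hy₀
  -- As `μ = 2|q|² - 1/2` is locally constant, `|q|` is too: either `q` vanishes near `y₀`, or it
  -- has no zero there and `dq = 3iμqθ`.
  by_cases hz : q y₀ = 0
  · have h0 := (hS y₀ hy₀).1
    rw [hz] at h0
    refine ⟨0, Or.inl rfl, ?_⟩
    filter_upwards [hμc, h.isOpen.mem_nhds hy₀] with y hy hyO a
    have hqy : q y = 0 := by
      have := (hS y hyO).1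
      rw [hy, h0] at this
      apply Complex.normSq_eq_zero.1
      rw [Complex.normSq_zero] at this
      linarith
    have := hqμ y hyO a
    rw [hqy, hy, h0] at this
    exact this
  · have hqc := (h.contDiffAt_q hq hy₀)
    have hne : ∀ᶠ y in 𝓝 y₀, q y ≠ 0 := hqc.continuousAt.eventually_ne hz
    have hd : ∀ᶠ y in 𝓝 y₀, ∀ a,
        fderiv ℝ q y a = 3 * Complex.I * μ y₀ * q y * thetaForm ψ N a y := by
      filter_upwards [hne, hμc, h.isOpen.mem_nhds hy₀] with y h1 h2 h3 a
      rw [(key y h3).2 h1 a, h2]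
    -- Symmetry of the second derivative of `q`: antisymmetrizing `dq = 3iμqθ` on the contact plane
    -- leaves `3iμq dθ = 0`, and `dθ` does not vanish there.
    have hm0 : μ y₀ = 0 := by
      obtain ⟨a1, ha1⟩ := (h.bij y₀ hy₀).2 (1, 0)
      obtain ⟨a2, ha2⟩ := (h.bij y₀ hy₀).2 (Complex.I, 0)
      simp only [Prod.mk.injEq] at ha1 ha2
      have e : ∀ w a, fderiv ℝ (fun z => fderiv ℝ q z a) y₀ w
          = 3 * Complex.I * μ y₀ * (q y₀ * fderiv ℝ (thetaForm ψ N a) y₀ w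
            + fderiv ℝ q y₀ w * thetaForm ψ N a y₀) := by
        intro w a
        have e1 : (fun z => fderiv ℝ q z a)
            =ᶠ[𝓝 y₀] fun z => 3 * Complex.I * μ y₀ * (q z * (thetaForm ψ N a z : ℂ)) := by
          filter_upwards [hd] with z hz
          rw [hz]; ring
        have dqy := dq.differentiableAt (h.isOpen.mem_nhds hy₀)
        have dt := (h.contDiffAt_thetaForm hy₀ a).differentiableAt (by simp)
        have ht : HasFDerivAt (fun z => (thetaForm ψ N a z : ℂ))
            (Complex.ofRealCLM.comp (fderiv ℝ (thetaForm ψ N a) y₀)) y₀ :=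
          Complex.ofRealCLM.hasFDerivAt.comp y₀ dt.hasFDerivAt
        rw [e1.fderiv_eq, ((dqy.hasFDerivAt.fun_mul ht).const_mul _).fderiv]
        simp
        ring
      have hsym := fderiv_fderiv_comm hqc a1 a2
      have hdt := h.d_thetaForm hy₀ a1 a2
      rw [ha1.1, ha2.1] at hdt
      rw [e, e, ha1.2, ha2.2] at hsym
      simp at hdt
      have hdt' : ((fderiv ℝ (thetaForm ψ N a2) y₀ a1 : ℝ) : ℂ)
          - ((fderiv ℝ (thetaForm ψ N a1) y₀ a2 : ℝ) : ℂ) = -1 := by exact_mod_cast hdt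
      have : 3 * Complex.I * μ y₀ * q y₀ = 0 := by
        simp only [Complex.ofReal_zero, mul_zero, add_zero] at hsym
        linear_combination (3 * Complex.I * μ y₀ * q y₀) * hdt' - hsym
      simpa [hz] using this
    have hn := (hS y₀ hy₀).1
    rw [hm0] at hn
    have hn' : Complex.normSq (q y₀) = 1 / 4 := by linarith
    refine ⟨q y₀, Or.inr hn', ?_⟩
    obtain ⟨r, hr, hb⟩ := Metric.eventually_nhds_iff_ball.1 (hd.and (h.isOpen.mem_nhds hy₀))
    have hconst := eventually_eq_of_fderiv_eq_zero Metric.isOpen_ball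
      (dq.mono fun y hy => (hb y hy).2) (fun y hy => by
        ext a
        rw [(hb y hy).1 a, hm0]
        simp) (Metric.mem_ball_self hr)
    filter_upwards [hμc, hconst, h.isOpen.mem_nhds hy₀] with y h1 h2 h3 a
    have := hqμ y h3 a
    rw [h2, h1, hm0] at this
    rw [hn']
    norm_num
    simpa using this

end IsAdapted

/-! ### Isotropic CR maps on a contact domain -/

section Isotropy

variable {E : Type*} [NormedAddCommGroup E] [NormedSpace ℝ E]

theorem fderiv_fderiv_apply_field {V : Type*} [NormedAddCommGroup V] [NormedSpace ℝ V]
    {F : E → V} {z : E → E} {y : E} (hF : ContDiffAt ℝ ∞ F y) (hz : DifferentiableAt ℝ z y)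
    (w : E) :
    fderiv ℝ (fun x => fderiv ℝ F x (z x)) y w
      = fderiv ℝ (fderiv ℝ F) y w (z y) + fderiv ℝ F y (fderiv ℝ z y w) := by
  have hd : DifferentiableAt ℝ (fderiv ℝ F) y :=
    (hF.fderiv_right (m := 1) (by norm_cast)).differentiableAt (by norm_num)
  rw [fderiv_clm_apply hd hz]
  simp [add_comm]

theorem differentiableAt_fderiv_apply_field {V : Type*} [NormedAddCommGroup V] [NormedSpace ℝ V]
    {F : E → V} {z : E → E} {y : E} (hF : ContDiffAt ℝ ∞ F y) (hz : DifferentiableAt ℝ z y) :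
    DifferentiableAt ℝ (fun x => fderiv ℝ F x (z x)) y := by
  have hd : DifferentiableAt ℝ (fderiv ℝ F) y :=
    (hF.fderiv_right (m := 1) (by norm_cast)).differentiableAt (by norm_num)
  exact hd.clm_apply hz

theorem snd_fderiv_symm {V : Type*} [NormedAddCommGroup V] [NormedSpace ℝ V]
    {F : E → V} {y : E} (hF : ContDiffAt ℝ ∞ F y) (a b : E) :
    fderiv ℝ (fderiv ℝ F) y a b = fderiv ℝ (fderiv ℝ F) y b a :=
  (hF.isSymmSndFDerivAt (by
    simp only [minSmoothness_of_isRCLikeNormedField]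
    exact WithTop.coe_le_coe.2 (le_top : (2 : ℕ∞) ≤ ⊤))) a b

/-- If the derivative of `r` vanishes on two fields then it vanishes on their bracket. -/
theorem fderiv_bracket_eq_zero {V : Type*} [NormedAddCommGroup V] [NormedSpace ℝ V]
    {r : E → V} {u v : E → E} {y : E} (hr : ContDiffAt ℝ ∞ r y)
    (hu : DifferentiableAt ℝ u y) (hv : DifferentiableAt ℝ v y)
    (h1 : ∀ᶠ z in 𝓝 y, fderiv ℝ r z (u z) = 0) (h2 : ∀ᶠ z in 𝓝 y, fderiv ℝ r z (v z) = 0) :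
    fderiv ℝ r y (fderiv ℝ v y (u y) - fderiv ℝ u y (v y)) = 0 := by
  have e1 := fderiv_fderiv_apply_field hr hu (v y)
  have e2 := fderiv_fderiv_apply_field hr hv (u y)
  have h1' : (fun x => fderiv ℝ r x (u x)) =ᶠ[𝓝 y] fun _ => (0 : V) := h1
  have h2' : (fun x => fderiv ℝ r x (v x)) =ᶠ[𝓝 y] fun _ => (0 : V) := h2
  rw [h1'.fderiv_eq] at e1
  rw [h2'.fderiv_eq] at e2
  simp only [fderiv_fun_const, Pi.zero_apply, zero_apply] at e1 e2
  rw [snd_fderiv_symm hr] at e1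
  rw [map_sub]
  have : fderiv ℝ r y (fderiv ℝ v y (u y)) - fderiv ℝ r y (fderiv ℝ u y (v y))
      = (fderiv ℝ (fderiv ℝ r) y (u y) (v y) + fderiv ℝ r y (fderiv ℝ v y (u y)))
        - (fderiv ℝ (fderiv ℝ r) y (u y) (v y) + fderiv ℝ r y (fderiv ℝ u y (v y))) := by abel
  rw [this, ← e1, ← e2, sub_zero]

/-- A CR map on a `3`-dimensional contact domain that is isotropic along the `(1,0)` direction has
an isotropic complexified differential. -/
theorem isotropic_of_frame {V : Type*} [NormedAddCommGroup V] [NormedSpace ℂ V]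
    (β : V →L[ℝ] V →L[ℝ] ℂ) (hsym : ∀ a b, β a b = β b a)
    (hI : ∀ a b, β (Complex.I • a) b = Complex.I * β a b)
    {O : Set E} (hO : IsOpen O) {F : E → V} (hF : ContDiffOn ℝ ∞ F O) {u v : E → E}
    (hu : DifferentiableOn ℝ u O) (hv : DifferentiableOn ℝ v O)
    (hCR : ∀ y ∈ O, fderiv ℝ F y (u y) = Complex.I • fderiv ℝ F y (v y))
    (hiso : ∀ y ∈ O, β (fderiv ℝ F y (u y)) (fderiv ℝ F y (u y)) = 0)
    (hspan : ∀ y ∈ O, ∀ c, c ∈ Submodule.span ℝ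
      {u y, v y, fderiv ℝ v y (u y) - fderiv ℝ u y (v y)}) :
    ∀ y ∈ O, ∀ a b, β (fderiv ℝ F y a) (fderiv ℝ F y b) = 0 := by
  have hI' : ∀ a b, β a (Complex.I • b) = Complex.I * β a b := fun a b => by
    rw [hsym, hI, hsym]
  have cF : ∀ y ∈ O, ContDiffAt ℝ ∞ F y := fun y hy => hF.contDiffAt (hO.mem_nhds hy)
  have du : ∀ y ∈ O, DifferentiableAt ℝ u y := fun y hy => hu.differentiableAt (hO.mem_nhds hy)
  have dv : ∀ y ∈ O, DifferentiableAt ℝ v y := fun y hy => hv.differentiableAt (hO.mem_nhds hy)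
  have hdCR : ∀ y ∈ O, ∀ w, fderiv ℝ (fun x => fderiv ℝ F x (u x)) y w
      = Complex.I • (fderiv ℝ (fderiv ℝ F) y w (v y) + fderiv ℝ F y (fderiv ℝ v y w)) := by
    intro y hy w
    have e : (fun x => fderiv ℝ F x (u x)) =ᶠ[𝓝 y] fun x => Complex.I • fderiv ℝ F x (v x) := by
      filter_upwards [hO.mem_nhds hy] with z hz using hCR z hz
    rw [e.fderiv_eq, fderiv_fun_const_smul
      (differentiableAt_fderiv_apply_field (cF y hy) (dv y hy)), smul_apply,
      fderiv_fderiv_apply_field (cF y hy) (dv y hy)]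
  -- With `Φ = dF(u)` and the (0,1) operator `u - i v`, this is `(u - i v) Φ = i dF([u, v])`: a
  -- (0,1) derivative of `Φ` produces the bracket direction.
  have hS : ∀ y ∈ O, fderiv ℝ (fun x => fderiv ℝ F x (u x)) y (u y)
      - Complex.I • fderiv ℝ (fun x => fderiv ℝ F x (u x)) y (v y)
      = Complex.I • fderiv ℝ F y (fderiv ℝ v y (u y) - fderiv ℝ u y (v y)) := by
    intro y hy
    rw [hdCR y hy, fderiv_fderiv_apply_field (cF y hy) (du y hy), snd_fderiv_symm (cF y hy),
      map_sub]
    module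
  have spanInd : ∀ y ∈ O, ∀ X : V, β X (fderiv ℝ F y (u y)) = 0 →
      β X (fderiv ℝ F y (fderiv ℝ v y (u y) - fderiv ℝ u y (v y))) = 0 →
      ∀ c, β X (fderiv ℝ F y c) = 0 := by
    intro y hy X h1 h3 c
    have hc := hspan y hy c
    have h2 : β X (fderiv ℝ F y (v y)) = 0 := by
      have := h1
      rw [hCR y hy, hI'] at this
      simpa using this
    induction hc using Submodule.span_induction with
    | mem x hx =>
      rcases hx with rfl | rfl | hx
      · exact h1
      · exact h2
      · rw [hx]; exact h3
    | zero => simp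
    | add x z _ _ hx hz => rw [map_add, map_add, hx, hz, add_zero]
    | smul t x _ hx => rw [map_smul, map_smul, hx, smul_zero]
  have hd : ∀ y ∈ O, DifferentiableAt ℝ (fun x => fderiv ℝ F x (u x)) y := fun y hy =>
    differentiableAt_fderiv_apply_field (cF y hy) (du y hy)
  -- By `spanInd` only `c = [u, v]` matters. Apply `u - i v` to `β(Φ, Φ) = 0` and use `hS`.
  have step1 : ∀ y ∈ O, ∀ c, β (fderiv ℝ F y (u y)) (fderiv ℝ F y c) = 0 := by
    intro y hy
    refine spanInd y hy _ (hiso y hy) ?_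
    have e : ∀ w, β (fderiv ℝ (fun x => fderiv ℝ F x (u x)) y w) (fderiv ℝ F y (u y)) = 0 := by
      intro w
      have h0 : (fun x => β (fderiv ℝ F x (u x)) (fderiv ℝ F x (u x))) =ᶠ[𝓝 y] fun _ => 0 := by
        filter_upwards [hO.mem_nhds hy] with z hz using hiso z hz
      have h1 := (β.hasFDerivAt_of_bilinear (hd y hy).hasFDerivAt (hd y hy).hasFDerivAt).fderiv
      rw [h0.fderiv_eq] at h1
      have h2 := congrArg (fun L => L w) h1
      simp only [fderiv_fun_const, Pi.zero_apply, zero_apply,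
        add_apply, ContinuousLinearMap.precompR_apply,
        ContinuousLinearMap.precompL_apply, 
        ContinuousLinearMap.compL_apply, ContinuousLinearMap.comp_apply] at h2
      rw [hsym (fderiv ℝ F y (u y))] at h2
      have : (2 : ℂ) * β (fderiv ℝ (fun x => fderiv ℝ F x (u x)) y w) (fderiv ℝ F y (u y)) = 0 := by
        rw [two_mul]; exact h2.symm
      simpa using this
    have h1 := congrArg (fun X => β X (fderiv ℝ F y (u y))) (hS y hy)
    simp only [map_sub, sub_apply, hI, e] at h1
    rw [hsym]
    simp only [map_sub, sub_apply]
    simpa using h1.symm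
  -- Apply `u - i v` to `β(Φ, dF c) = 0`. Differentiating the CR equation along `c` expresses `(u -
  -- i v)(dF c)` through first derivatives of `F`, and these pair to zero with `Φ` by `step1`.
  have step2 : ∀ y ∈ O, ∀ c,
      β (fderiv ℝ F y (fderiv ℝ v y (u y) - fderiv ℝ u y (v y))) (fderiv ℝ F y c) = 0 := by
    intro y hy c
    have e : ∀ w, β (fderiv ℝ (fun x => fderiv ℝ F x (u x)) y w) (fderiv ℝ F y c)
        = -β (fderiv ℝ F y (u y)) (fderiv ℝ (fderiv ℝ F) y w c) := by
      intro w
      have h0 : (fun x => β (fderiv ℝ F x (u x)) (fderiv ℝ F x c)) =ᶠ[𝓝 y] fun _ => 0 := by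
        filter_upwards [hO.mem_nhds hy] with z hz using step1 z hz c
      have hdc := differentiableAt_fderiv_apply_field (cF y hy) (differentiableAt_const (x := y) c)
      have h1 := (β.hasFDerivAt_of_bilinear (hd y hy).hasFDerivAt hdc.hasFDerivAt).fderiv
      rw [h0.fderiv_eq] at h1
      have h2 := congrArg (fun L => L w) h1
      simp only [fderiv_fun_const, Pi.zero_apply, zero_apply,
        add_apply, ContinuousLinearMap.precompR_apply,
        ContinuousLinearMap.precompL_apply, 
        ContinuousLinearMap.compL_apply, ContinuousLinearMap.comp_apply] at h2
      rw [fderiv_fderiv_apply_field (cF y hy) (differentiableAt_const (x := y) c)] at h2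
      simp only [fderiv_fun_const, Pi.zero_apply, zero_apply, map_zero,
        add_zero] at h2
      exact (neg_eq_of_add_eq_zero_right h2.symm).symm
    have h1 := congrArg (fun X => β X (fderiv ℝ F y c)) (hS y hy)
    simp only [map_sub, sub_apply, hI, e] at h1
    have hc := hdCR y hy c
    rw [fderiv_fderiv_apply_field (cF y hy) (du y hy)] at hc
    have hc2 : fderiv ℝ (fderiv ℝ F) y (u y) c = Complex.I • fderiv ℝ (fderiv ℝ F) y (v y) c
        + (Complex.I • fderiv ℝ F y (fderiv ℝ v y c) - fderiv ℝ F y (fderiv ℝ u y c)) := by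
      rw [snd_fderiv_symm (cF y hy) (u y), snd_fderiv_symm (cF y hy) (v y)]
      rw [eq_sub_of_add_eq hc]
      module
    rw [hc2] at h1
    simp only [map_add, map_sub, hI', step1 y hy] at h1
    have h3 : Complex.I * (β (fderiv ℝ F y (fderiv ℝ v y (u y))) (fderiv ℝ F y c)
        - β (fderiv ℝ F y (fderiv ℝ u y (v y))) (fderiv ℝ F y c)) = 0 := by
      linear_combination -h1
    simp only [map_sub, sub_apply]
    simpa using h3
  intro y hy a b
  refine spanInd y hy _ ?_ ?_ b
  · rw [hsym]; exact step1 y hy a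
  · rw [hsym]; exact step2 y hy a

end Isotropy

/-! ### The parallel complex structure of an isotropic map -/

section Parallel

variable {E : Type*} [NormedAddCommGroup E] [NormedSpace ℝ E] [FiniteDimensional ℝ E]
  {G : Type*} [NormedAddCommGroup G] [InnerProductSpace ℝ G] [CompleteSpace G]

/-- The orthogonal complex structure defined by an isotropic map `f + i g` is parallel. -/
theorem exists_parallel_complex_structure {O : Set E} (hO : IsOpen O) {f g : E → G}
    (hf : ContDiffOn ℝ ∞ f O) (hg : ContDiffOn ℝ ∞ g O)
    (h1 : ∀ y ∈ O, ∀ a b, inner ℝ (fderiv ℝ f y a) (fderiv ℝ f y b)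
      = inner ℝ (fderiv ℝ g y a) (fderiv ℝ g y b))
    (h2 : ∀ y ∈ O, ∀ a b, inner ℝ (fderiv ℝ f y a) (fderiv ℝ g y b)
      = -inner ℝ (fderiv ℝ g y a) (fderiv ℝ f y b))
    {y₀ : E} (hy₀ : y₀ ∈ O) (b₀ : E)
    (hb : Function.Bijective fun p : E × ℝ => fderiv ℝ f y₀ p.1 + p.2 • fderiv ℝ g y₀ b₀) :
    ∃ K : G →L[ℝ] G, (∀ p q, inner ℝ (K p) (K q) = inner ℝ p q) ∧
      (∀ p q, inner ℝ (K p) q = -inner ℝ p (K q)) ∧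
      ∀ᶠ y in 𝓝 y₀, ∀ a, fderiv ℝ g y a = K (fderiv ℝ f y a) := by
  have : CompleteSpace E := FiniteDimensional.complete ℝ E
  have cf : ∀ y ∈ O, ContDiffAt ℝ ∞ f y := fun y hy => hf.contDiffAt (hO.mem_nhds hy)
  have cg : ∀ y ∈ O, ContDiffAt ℝ ∞ g y := fun y hy => hg.contDiffAt (hO.mem_nhds hy)
  have h2s : ∀ y ∈ O, ∀ a, inner ℝ (fderiv ℝ f y a) (fderiv ℝ g y a) = 0 := by
    intro y hy a
    have := h2 y hy a a
    rw [real_inner_comm (fderiv ℝ f y a) (fderiv ℝ g y a)] at this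
    linarith
  let S : G →L[ℝ] (ℝ →L[ℝ] G) := ContinuousLinearMap.toSpanSingletonCLE.toContinuousLinearMap
  -- `K` has to send `df a` to `dg a`, and `K² = -1` then forces `dg b₀` to go to `-df b₀`. So `K =
  -- B ∘ A⁻¹`, defined where `A` is invertible.
  let A : E → (E × ℝ →L[ℝ] G) := fun y =>
    (fderiv ℝ f y).comp (ContinuousLinearMap.fst ℝ E ℝ)
      + (S (fderiv ℝ g y b₀)).comp (ContinuousLinearMap.snd ℝ E ℝ)
  let B : E → (E × ℝ →L[ℝ] G) := fun y =>
    (fderiv ℝ g y).comp (ContinuousLinearMap.fst ℝ E ℝ)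
      - (S (fderiv ℝ f y b₀)).comp (ContinuousLinearMap.snd ℝ E ℝ)
  have hA : ∀ y p, A y p = fderiv ℝ f y p.1 + p.2 • fderiv ℝ g y b₀ := fun y p => by
    simp [A, S]
  have hB : ∀ y p, B y p = fderiv ℝ g y p.1 - p.2 • fderiv ℝ f y b₀ := fun y p => by
    simp [B, S]
  have dA : ∀ y ∈ O, DifferentiableAt ℝ A y := by
    intro y hy
    have e1 : DifferentiableAt ℝ (fderiv ℝ f) y :=
      ((cf y hy).fderiv_right (m := 1) (by norm_cast)).differentiableAt (by norm_num)
    have e2 : DifferentiableAt ℝ (fderiv ℝ g) y :=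
      ((cg y hy).fderiv_right (m := 1) (by norm_cast)).differentiableAt (by norm_num)
    exact (e1.clm_comp (differentiableAt_const _)).add
      ((S.differentiableAt.comp y (e2.clm_apply (differentiableAt_const b₀))).clm_comp
        (differentiableAt_const _))
  have dB : ∀ y ∈ O, DifferentiableAt ℝ B y := by
    intro y hy
    have e1 : DifferentiableAt ℝ (fderiv ℝ f) y :=
      ((cf y hy).fderiv_right (m := 1) (by norm_cast)).differentiableAt (by norm_num)
    have e2 : DifferentiableAt ℝ (fderiv ℝ g) y :=
      ((cg y hy).fderiv_right (m := 1) (by norm_cast)).differentiableAt (by norm_num)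
    exact (e2.clm_comp (differentiableAt_const _)).sub
      ((S.differentiableAt.comp y (e1.clm_apply (differentiableAt_const b₀))).clm_comp
        (differentiableAt_const _))
  let e₀ : (E × ℝ) ≃L[ℝ] G := ContinuousLinearEquiv.ofBijective (A y₀)
    (LinearMap.ker_eq_bot.2 fun p q hpq => hb.1 (by
      change A y₀ p = A y₀ q at hpq
      rwa [hA, hA] at hpq))
    (LinearMap.range_eq_top.2 fun z => by
      obtain ⟨p, hp⟩ := hb.2 z
      exact ⟨p, by rw [← hp]; exact hA y₀ p⟩)
  have he₀ : (e₀ : E × ℝ →L[ℝ] G) = A y₀ := by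
    ext p <;> simp [e₀]
  have hev : ∀ᶠ y in 𝓝 y₀, A y ∈ Set.range ((↑) : ((E × ℝ) ≃L[ℝ] G) → (E × ℝ →L[ℝ] G)) := by
    have := ContinuousLinearEquiv.nhds e₀
    rw [he₀] at this
    exact (dA y₀ hy₀).continuousAt this
  obtain ⟨r, hr, hball⟩ := Metric.eventually_nhds_iff_ball.1 (hev.and (hO.mem_nhds hy₀))
  let K : E → (G →L[ℝ] G) := fun y => (B y).comp (ContinuousLinearMap.inverse (A y))
  have hKA : ∀ y ∈ Metric.ball y₀ r, ∀ p, K y (A y p) = B y p := by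
    intro y hy p
    obtain ⟨e, he⟩ := (hball y hy).1
    simp only [K, ContinuousLinearMap.comp_apply]
    rw [← he, ContinuousLinearMap.inverse_equiv]
    simp
  have hsurj : ∀ y ∈ Metric.ball y₀ r, ∀ z, ∃ p, A y p = z := by
    intro y hy z
    obtain ⟨e, he⟩ := (hball y hy).1
    exact ⟨e.symm z, by rw [← he]; simp⟩
  have dK : DifferentiableOn ℝ K (Metric.ball y₀ r) := by
    intro y hy
    obtain ⟨e, he⟩ := (hball y hy).1
    have := (contDiffAt_map_inverse (n := 1) e).differentiableAt (by norm_num)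
    rw [he] at this
    exact ((dB y (hball y hy).2).clm_comp
      (this.comp y (dA y (hball y hy).2))).differentiableWithinAt
  have hKf : ∀ y ∈ Metric.ball y₀ r, ∀ a, K y (fderiv ℝ f y a) = fderiv ℝ g y a := by
    intro y hy a
    have := hKA y hy (a, 0)
    rw [hA, hB] at this
    simpa using this
  have hKg : ∀ y ∈ Metric.ball y₀ r, K y (fderiv ℝ g y b₀) = -fderiv ℝ f y b₀ := by
    intro y hy
    have := hKA y hy (0, 1)
    rw [hA, hB] at this
    simpa using this
  have hskew : ∀ y ∈ Metric.ball y₀ r, ∀ p q, inner ℝ (K y p) q = -inner ℝ p (K y q) := by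
    intro y hy p q
    obtain ⟨⟨a, s⟩, rfl⟩ := hsurj y hy p
    obtain ⟨⟨b, t⟩, rfl⟩ := hsurj y hy q
    have hyO := (hball y hy).2
    rw [hKA y hy, hKA y hy, hA, hB, hA, hB]
    simp only [inner_add_left, inner_add_right, inner_sub_left, inner_sub_right,
      real_inner_smul_left, real_inner_smul_right]
    rw [h1 y hyO a b₀, h1 y hyO b₀ b, h2 y hyO a b, h2s y hyO b₀,
      real_inner_comm (fderiv ℝ f y b₀) (fderiv ℝ g y b₀), h2s y hyO b₀]
    ring
  have hisom : ∀ y ∈ Metric.ball y₀ r, ∀ p q, inner ℝ (K y p) (K y q) = inner ℝ p q := by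
    intro y hy p q
    obtain ⟨⟨a, s⟩, rfl⟩ := hsurj y hy p
    obtain ⟨⟨b, t⟩, rfl⟩ := hsurj y hy q
    have hyO := (hball y hy).2
    rw [hKA y hy, hKA y hy, hA, hB, hA, hB]
    simp only [inner_add_left, inner_add_right, inner_sub_left, inner_sub_right,
      real_inner_smul_left, real_inner_smul_right]
    rw [h1 y hyO a b, h1 y hyO b₀ b₀, h2 y hyO a b₀, h2 y hyO b₀ b]
    ring
  have hKK : ∀ y ∈ Metric.ball y₀ r, ∀ p, K y (K y p) = -p := by
    intro y hy p
    refine ext_inner_right ℝ fun q => ?_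
    rw [hskew y hy, hisom y hy, inner_neg_left]
  have hDK : ∀ y ∈ Metric.ball y₀ r, fderiv ℝ K y = 0 := by
    intro y hy
    have hyO := (hball y hy).2
    have hnb := Metric.isOpen_ball.mem_nhds hy
    have dKy := dK.differentiableAt hnb
    have dgf : ∀ {k : E → G}, ContDiffAt ℝ ∞ k y → ∀ a : E,
        DifferentiableAt ℝ (fun z => fderiv ℝ k z a) y := fun hk a =>
      (contDiffAt_fderiv_apply hk a).differentiableAt (by simp)
    have hk2 : ∀ {k : E → G}, ContDiffAt ℝ ∞ k y → ∀ w a : E,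
        fderiv ℝ (fun z => fderiv ℝ k z a) y w = fderiv ℝ (fderiv ℝ k) y w a := by
      intro k hk w a
      have := fderiv_fderiv_apply_field hk (differentiableAt_const (x := y) a) w
      simpa using this
    have braid : ∀ (k l : E → G), ContDiffAt ℝ ∞ k y → ContDiffAt ℝ ∞ l y → ∀ w a b,
        fderiv ℝ (fun z => inner ℝ (fderiv ℝ k z a) (fderiv ℝ l z b)) y w
          = inner ℝ (fderiv ℝ k y a) (fderiv ℝ (fderiv ℝ l) y w b)
            + inner ℝ (fderiv ℝ (fderiv ℝ k) y w a) (fderiv ℝ l y b) := by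
      intro k l hk hl w a b
      rw [fderiv_inner_apply ℝ (dgf hk a) (dgf hl b), hk2 hk, hk2 hl]
    -- `P` and `Q` are the real and imaginary parts of the bilinear product of `D²F(w, a)` with `dF
    -- c`, for `F = f + i g`.
    set P : E → E → E → ℝ := fun w a c =>
      inner ℝ (fderiv ℝ (fderiv ℝ f) y w a) (fderiv ℝ f y c)
        - inner ℝ (fderiv ℝ (fderiv ℝ g) y w a) (fderiv ℝ g y c) with hP
    set Q : E → E → E → ℝ := fun w a c =>
      inner ℝ (fderiv ℝ (fderiv ℝ f) y w a) (fderiv ℝ g y c)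
        + inner ℝ (fderiv ℝ (fderiv ℝ g) y w a) (fderiv ℝ f y c) with hQ
    have Psym : ∀ w a c, P w a c = P a w c := fun w a c => by
      simp only [hP]
      rw [snd_fderiv_symm (cf y hyO) w a, snd_fderiv_symm (cg y hyO) w a]
    have Qsym : ∀ w a c, Q w a c = Q a w c := fun w a c => by
      simp only [hQ]
      rw [snd_fderiv_symm (cf y hyO) w a, snd_fderiv_symm (cg y hyO) w a]
    have Panti : ∀ w a c, P w a c = -P w c a := by
      intro w a c
      have e : (fun z => inner ℝ (fderiv ℝ f z a) (fderiv ℝ f z c)) =ᶠ[𝓝 y]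
          fun z => inner ℝ (fderiv ℝ g z a) (fderiv ℝ g z c) := by
        filter_upwards [hO.mem_nhds hyO] with z hz using h1 z hz a c
      have := congrArg (fun L : E →L[ℝ] ℝ => L w) e.fderiv_eq
      rw [braid f f (cf y hyO) (cf y hyO), braid g g (cg y hyO) (cg y hyO)] at this
      simp only [hP]
      rw [real_inner_comm (fderiv ℝ f y a), real_inner_comm (fderiv ℝ g y a)]
      linarith
    have Qanti : ∀ w a c, Q w a c = -Q w c a := by
      intro w a c
      have e : (fun z => inner ℝ (fderiv ℝ f z a) (fderiv ℝ g z c)) =ᶠ[𝓝 y]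
          fun z => -inner ℝ (fderiv ℝ g z a) (fderiv ℝ f z c) := by
        filter_upwards [hO.mem_nhds hyO] with z hz using h2 z hz a c
      have := congrArg (fun L : E →L[ℝ] ℝ => L w) e.fderiv_eq
      simp only [fderiv_fun_neg, neg_apply] at this
      rw [braid f g (cf y hyO) (cg y hyO), braid g f (cg y hyO) (cf y hyO)] at this
      simp only [hQ]
      rw [real_inner_comm (fderiv ℝ f y a), real_inner_comm (fderiv ℝ g y a)]
      linarith
    -- A trilinear form that is symmetric in its first two arguments and skew in its last two is
    -- zero, as in the uniqueness of the Levi-Civita connection.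
    have Pz : ∀ w a c, P w a c = 0 := fun w a c => by
      have := Panti w a c
      rw [Psym w c a, Panti c w a, Psym c a w, Panti a c w, Psym a w c] at this
      linarith
    have Qz : ∀ w a c, Q w a c = 0 := fun w a c => by
      have := Qanti w a c
      rw [Qsym w c a, Qanti c w a, Qsym c a w, Qanti a c w, Qsym a w c] at this
      linarith
    have hX : ∀ w a, fderiv ℝ K y w (fderiv ℝ f y a) = 0 := by
      intro w a
      have e : (fun z => K z (fderiv ℝ f z a)) =ᶠ[𝓝 y] fun z => fderiv ℝ g z a := by
        filter_upwards [hnb] with z hz using hKf z hz a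
      have h3 := congrArg (fun L : E →L[ℝ] G => L w) e.fderiv_eq
      rw [fderiv_clm_apply dKy (dgf (cf y hyO) a)] at h3
      simp only [add_apply, ContinuousLinearMap.comp_apply,
        ContinuousLinearMap.flip_apply] at h3
      rw [hk2 (cf y hyO), hk2 (cg y hyO)] at h3
      have h4 : fderiv ℝ K y w (fderiv ℝ f y a) = fderiv ℝ (fderiv ℝ g) y w a
          - K y (fderiv ℝ (fderiv ℝ f) y w a) := by
        rw [← h3]; abel
      refine ext_inner_right ℝ fun q => ?_
      obtain ⟨⟨c, t⟩, rfl⟩ := hsurj y hy q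
      have p0 := Pz w a b₀
      have q0 := Qz w a c
      simp only [hP] at p0
      simp only [hQ] at q0
      rw [h4, hA, inner_zero_left]
      simp only [inner_add_right, inner_sub_left, real_inner_smul_right]
      rw [hskew y hy, hskew y hy, hKf y hy, hKg y hy, inner_neg_right]
      linear_combination q0 - t * p0
    have hsk : ∀ w p q, inner ℝ (fderiv ℝ K y w p) q = -inner ℝ p (fderiv ℝ K y w q) := by
      intro w p q
      have e : (fun z => inner ℝ (K z p) q) =ᶠ[𝓝 y] fun z => -inner ℝ p (K z q) := by
        filter_upwards [hnb] with z hz using hskew z hz p q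
      have h3 := congrArg (fun L : E →L[ℝ] ℝ => L w) e.fderiv_eq
      have dKp : ∀ p, DifferentiableAt ℝ (fun z => K z p) y := fun p =>
        dKy.clm_apply (differentiableAt_const p)
      have ap : ∀ p, fderiv ℝ (fun z => K z p) y w = fderiv ℝ K y w p := fun p => by
        rw [fderiv_clm_apply dKy (differentiableAt_const p)]
        simp
      simp only [fderiv_fun_neg, neg_apply] at h3
      rw [fderiv_inner_apply ℝ (dKp p) (differentiableAt_const q),
        fderiv_inner_apply ℝ (differentiableAt_const p) (dKp q), ap, ap] at h3
      simpa using h3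
    ext w p
    obtain ⟨⟨a, s⟩, rfl⟩ := hsurj y hy p
    rw [hA, map_add, map_smul, hX]
    -- The derivative of `K` is skew and kills the hyperplane `df(E)`. Its value on the remaining
    -- direction is thus orthogonal to that hyperplane and to the direction itself.
    have : fderiv ℝ K y w (fderiv ℝ g y b₀) = 0 := by
      refine ext_inner_right ℝ fun q => ?_
      obtain ⟨⟨c, t⟩, rfl⟩ := hsurj y hy q
      have hself := hsk w (fderiv ℝ g y b₀) (fderiv ℝ g y b₀)
      rw [real_inner_comm] at hself
      rw [hA, inner_add_right, real_inner_smul_right, hsk w (fderiv ℝ g y b₀) (fderiv ℝ f y c), hX]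
      simp only [inner_zero_right, inner_zero_left, neg_zero, zero_add]
      have h0 : inner ℝ (fderiv ℝ K y w (fderiv ℝ g y b₀)) (fderiv ℝ g y b₀) = (0 : ℝ) := by
        rw [real_inner_comm]; linarith
      rw [h0]
      simp
    rw [this]; simp
  have hc := eventually_eq_of_fderiv_eq_zero Metric.isOpen_ball dK hDK (Metric.mem_ball_self hr)
  refine ⟨K y₀, hisom y₀ (Metric.mem_ball_self hr), hskew y₀ (Metric.mem_ball_self hr), ?_⟩
  filter_upwards [hc, Metric.ball_mem_nhds y₀ hr] with y hy hyb a
  rw [← hy, hKf y hyb]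

end Parallel

/-! ### Real and imaginary parts in the complexification -/

section ComplexificationLemmas

variable {V : Type*} [AddCommGroup V] [Module ℝ V]

theorem ext_mkC {w w' : ℂ ⊗[ℝ] V} (h1 : reC w = reC w') (h2 : imC w = imC w') : w = w' := by
  rw [← mkC_reC_imC w, ← mkC_reC_imC w', h1, h2]

theorem reC_tmul (z : ℂ) (v : V) : reC (z ⊗ₜ[ℝ] v) = z.re • v := by simp [reC]

theorem imC_tmul (z : ℂ) (v : V) : imC (z ⊗ₜ[ℝ] v) = z.im • v := by simp [imC]

theorem reC_smul (c : ℂ) (w : ℂ ⊗[ℝ] V) : reC (c • w) = c.re • reC w - c.im • imC w := by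
  induction w using TensorProduct.induction_on with
  | zero => simp
  | tmul z v =>
    rw [TensorProduct.smul_tmul', reC_tmul, reC_tmul, imC_tmul, smul_eq_mul, Complex.mul_re]
    module
  | add x y hx hy => rw [smul_add, map_add, map_add, map_add, hx, hy]; module

theorem imC_smul (c : ℂ) (w : ℂ ⊗[ℝ] V) : imC (c • w) = c.re • imC w + c.im • reC w := by
  induction w using TensorProduct.induction_on with
  | zero => simp
  | tmul z v =>
    rw [TensorProduct.smul_tmul', imC_tmul, reC_tmul, imC_tmul, smul_eq_mul, Complex.mul_im]
    module
  | add x y hx hy => rw [smul_add, map_add, map_add, map_add, hx, hy]; module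

@[simp] theorem reC_conjC (w : ℂ ⊗[ℝ] V) : reC (conjC w) = reC w := by
  conv_lhs => rw [← mkC_reC_imC w, conjC_mkC, reC_mkC]

@[simp] theorem imC_conjC (w : ℂ ⊗[ℝ] V) : imC (conjC w) = -imC w := by
  conv_lhs => rw [← mkC_reC_imC w, conjC_mkC, imC_mkC]

end ComplexificationLemmas

/-! ### Pointwise algebra of a strongly pseudoconvex pseudohermitian structure -/

section Pointwise

variable {M : Type*} [TopologicalSpace M] [ChartedSpace (EuclideanSpace ℝ (Fin 3)) M]

section dForm

variable (θ : ∀ x : M, TangentSpace (𝓡 3) x →L[ℝ] ℝ) (x : M)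

theorem dForm_swap (a c : TangentSpace (𝓡 3) x) : dForm θ x a c = -dForm θ x c a := by
  simp only [dForm]; ring

theorem dForm_self (a : TangentSpace (𝓡 3) x) : dForm θ x a a = 0 := by
  simp only [dForm]; ring

theorem alternation_add_left {V W : Type*} [NormedAddCommGroup W] [NormedSpace ℝ W]
    [AddCommGroup V] [Module ℝ V] [TopologicalSpace V] (D : W →L[ℝ] W →L[ℝ] ℝ) (L : V →L[ℝ] W)
    (a b c : V) : D (L (a + b)) (L c) - D (L c) (L (a + b))
      = (D (L a) (L c) - D (L c) (L a)) + (D (L b) (L c) - D (L c) (L b)) := by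
  simp only [map_add, add_apply]; ring

theorem alternation_smul_left {V W : Type*} [NormedAddCommGroup W] [NormedSpace ℝ W]
    [AddCommGroup V] [Module ℝ V] [TopologicalSpace V] (D : W →L[ℝ] W →L[ℝ] ℝ) (L : V →L[ℝ] W)
    (t : ℝ) (a c : V) : D (L (t • a)) (L c) - D (L c) (L (t • a))
      = t * (D (L a) (L c) - D (L c) (L a)) := by
  simp only [map_smul, smul_apply, smul_eq_mul]; ring

theorem dForm_add_left (a b c : TangentSpace (𝓡 3) x) :
    dForm θ x (a + b) c = dForm θ x a c + dForm θ x b c :=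
  alternation_add_left (V := TangentSpace (𝓡 3) x) (W := EuclideanSpace ℝ (Fin 3))
    (fderiv ℝ (formInChart θ x) (extChartAt (𝓡 3) x x))
    (mfderiv (𝓡 3) 𝓘(ℝ, EuclideanSpace ℝ (Fin 3)) (extChartAt (𝓡 3) x) x) a b c

theorem dForm_smul_left (t : ℝ) (a c : TangentSpace (𝓡 3) x) :
    dForm θ x (t • a) c = t * dForm θ x a c :=
  alternation_smul_left (V := TangentSpace (𝓡 3) x) (W := EuclideanSpace ℝ (Fin 3))
    (fderiv ℝ (formInChart θ x) (extChartAt (𝓡 3) x x))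
    (mfderiv (𝓡 3) 𝓘(ℝ, EuclideanSpace ℝ (Fin 3)) (extChartAt (𝓡 3) x) x) t a c

theorem dForm_add_right (a b c : TangentSpace (𝓡 3) x) :
    dForm θ x a (b + c) = dForm θ x a b + dForm θ x a c := by
  rw [dForm_swap, dForm_add_left, dForm_swap θ x b, dForm_swap θ x c]; ring

theorem dForm_smul_right (t : ℝ) (a c : TangentSpace (𝓡 3) x) :
    dForm θ x a (t • c) = t * dForm θ x a c := by
  rw [dForm_swap, dForm_smul_left, dForm_swap θ x c]; ring

theorem dForm_neg_right (a c : TangentSpace (𝓡 3) x) :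
    dForm θ x a (-c) = -dForm θ x a c := by
  rw [← neg_one_smul ℝ c, dForm_smul_right]; ring

theorem dForm_sub_right (a b c : TangentSpace (𝓡 3) x) :
    dForm θ x a (b - c) = dForm θ x a b - dForm θ x a c := by
  rw [sub_eq_add_neg, dForm_add_right, dForm_neg_right]; ring

theorem dForm_sub_left (a b c : TangentSpace (𝓡 3) x) :
    dForm θ x (a - b) c = dForm θ x a c - dForm θ x b c := by
  rw [dForm_swap, dForm_sub_right, dForm_swap θ x c a, dForm_swap θ x c b]; ring

end dForm

variable [IsManifold (𝓡 3) ∞ M] {S : CRStructure M} (P : Pseudohermitian S)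

theorem levi_re (x : M) (z w : CTangent x) :
    (levi P x z w).re = dForm P.θ x (reC z) (imC w) - dForm P.θ x (imC z) (reC w) := by
  simp [levi, dFormC, dForm_neg_right]
  ring

/-- `u + i v` spans `T^{1,0}` at `x`, with the resulting consequences for `θ` and `dθ`. -/
structure IsFrameAt (x : M) (u v : TangentSpace (𝓡 3) x) : Prop where
  span_eq : S.T10 x = Submodule.span ℂ {mkC u v}
  theta_u : P.θ x u = 0
  theta_v : P.θ x v = 0
  pos : 0 < dForm P.θ x u v
  ker : ∀ a, P.θ x a = 0 → ∃ α β : ℝ, a = α • u + β • v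

variable {P}

/-- For `Z = u + i v` one has `Re L(Z, Z) = 2 dθ(u, v)`, which gives the sign. A real vector of `ker
θ` is a sum of a multiple of `Z` and a multiple of `Z̄`, and its real part is a combination of `u`
and `v`. -/
theorem IsFrameAt.of_span (hpos : LeviPositive P) {x : M} {Z : CTangent x} (hZ : Z ≠ 0)
    (h : S.T10 x = Submodule.span ℂ {Z}) : IsFrameAt P x (reC Z) (imC Z) := by
  have hmem : Z ∈ S.T10 x := by rw [h]; exact Submodule.mem_span_singleton_self Z
  have hθ := (P.ker_eq x Z).2 ⟨Z, hmem, 0, Submodule.zero_mem _, by simp⟩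
  refine ⟨by rw [mkC_reC_imC]; exact h, hθ.1, hθ.2, ?_, fun a ha => ?_⟩
  · have := hpos x Z hmem hZ
    rw [levi_re, dForm_swap P.θ x (imC Z)] at this
    linarith
  · obtain ⟨z, hz, w, hw, hzw⟩ := (P.ker_eq x (mkC a 0)).1 (by simp [ha])
    rw [h] at hz hw
    obtain ⟨c, rfl⟩ := Submodule.mem_span_singleton.1 hz
    obtain ⟨d, rfl⟩ := Submodule.mem_span_singleton.1 hw
    have h1 := congrArg reC hzw
    rw [reC_mkC, map_add, reC_conjC, reC_smul, reC_smul] at h1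
    refine ⟨c.re + d.re, -(c.im + d.im), ?_⟩
    rw [h1]
    module

theorem exists_isFrameAt (hpos : LeviPositive P) (x : M) : ∃ u v, IsFrameAt P x u v := by
  obtain ⟨O, Z, -, hx, -, h⟩ := S.exists_frame x
  exact ⟨_, _, IsFrameAt.of_span hpos (h x hx).1 (h x hx).2⟩

namespace IsFrameAt

variable {x : M} {u v : TangentSpace (𝓡 3) x}

theorem decomp (h : IsFrameAt P x u v) {R : TangentSpace (𝓡 3) x} (hR : P.θ x R = 1)
    (a : TangentSpace (𝓡 3) x) : ∃ α β : ℝ, a = α • u + β • v + P.θ x a • R := by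
  obtain ⟨α, β, hab⟩ := h.ker (a - P.θ x a • R) (by simp [hR])
  exact ⟨α, β, by rw [← hab]; abel⟩

theorem exists_reeb (h : IsFrameAt P x u v) :
    ∃ R, P.θ x R = 1 ∧ ∀ w, dForm P.θ x R w = 0 := by
  obtain ⟨R₀, hR₀⟩ : ∃ R, P.θ x R = 1 := by
    have := P.ne_zero x
    obtain ⟨a, ha⟩ : ∃ a, P.θ x a ≠ 0 := by
      by_contra! hc
      exact this (by ext a; simpa using hc a)
    exact ⟨(P.θ x a)⁻¹ • a, by simp [ha]⟩
  have hd := h.pos.ne'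
  set d := dForm P.θ x u v with hd_def
  -- Any vector with `θ = 1`, corrected inside the contact plane. The coefficients solve `dθ(R, u) =
  -- dθ(R, v) = 0`, with `dθ(u, v)` as pivot.
  let R := R₀ - (dForm P.θ x R₀ v / d) • u + (dForm P.θ x R₀ u / d) • v
  have hR : P.θ x R = 1 := by simp [R, hR₀, h.theta_u, h.theta_v]
  have hRu : dForm P.θ x R u = 0 := by
    simp only [R, dForm_add_left, dForm_sub_left, dForm_smul_left, dForm_self,
      dForm_swap P.θ x v u, ← hd_def]
    field_simp
    ring
  have hRv : dForm P.θ x R v = 0 := by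
    simp only [R, dForm_add_left, dForm_sub_left, dForm_smul_left, dForm_self, ← hd_def]
    field_simp
    ring
  refine ⟨R, hR, fun w => ?_⟩
  obtain ⟨α, β, hw⟩ := h.decomp hR w
  rw [hw]
  simp only [dForm_add_right, dForm_smul_right, hRu, hRv, dForm_self]
  ring

theorem reeb_spec (h : IsFrameAt P x u v) :
    P.θ x (reeb P x) = 1 ∧ ∀ w, dForm P.θ x (reeb P x) w = 0 :=
  Classical.epsilon_spec h.exists_reeb

theorem coeff_eq (h : IsFrameAt P x u v) {α β α' β' : ℝ}
    (he : α • u + β • v = α' • u + β' • v) : α = α' ∧ β = β' := by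
  have hd := h.pos.ne'
  have h1 := congrArg (fun w => dForm P.θ x w v) he
  have h2 := congrArg (fun w => dForm P.θ x u w) he
  simp only [dForm_add_left, dForm_smul_left, dForm_add_right, dForm_smul_right, dForm_self,
    mul_zero, zero_add, add_zero] at h1 h2
  exact ⟨mul_right_cancel₀ hd h1, mul_right_cancel₀ hd h2⟩

/-- The coefficient `c` solves `2 Re(c (u + i v)) = √2 (α u + β v)`. Since `coeff_eq` makes it the
only solution, it identifies the vector selected by `epsilon`. -/
theorem lift10_spec (h : IsFrameAt P x u v) (α β γ : ℝ) :
    lift10 P x (α • u + β • v + γ • reeb P x)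
      = ((Real.sqrt 2 / 2 * α : ℝ) - (Real.sqrt 2 / 2 * β : ℝ) * Complex.I : ℂ) • mkC u v := by
  set a := α • u + β • v + γ • reeb P x with ha
  set c : ℂ := (Real.sqrt 2 / 2 * α : ℝ) - (Real.sqrt 2 / 2 * β : ℝ) * Complex.I with hc
  have hcr : c.re = Real.sqrt 2 / 2 * α := by simp [hc]
  have hci : c.im = -(Real.sqrt 2 / 2 * β) := by simp [hc]
  have hθ : P.θ x a = γ := by
    rw [ha]; simp [h.theta_u, h.theta_v, h.reeb_spec.1]
  have hsub : a - P.θ x a • reeb P x = α • u + β • v := by rw [hθ, ha]; abel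
  have hex : ∃ Z : CTangent x, Z ∈ S.T10 x ∧
      Z + conjC Z = mkC (Real.sqrt 2 • (a - P.θ x a • reeb P x)) 0 := by
    refine ⟨c • mkC u v, ?_, ?_⟩
    · rw [h.span_eq]; exact Submodule.smul_mem _ _ (Submodule.mem_span_singleton_self _)
    · rw [hsub]
      apply ext_mkC
      · rw [map_add, reC_conjC, reC_smul, reC_mkC, reC_mkC, imC_mkC, hcr, hci]
        module
      · rw [map_add, imC_conjC, imC_mkC]
        abel
  obtain ⟨h1, h2⟩ := Classical.epsilon_spec hex
  change lift10 P x a ∈ S.T10 x at h1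
  change lift10 P x a + conjC (lift10 P x a) = _ at h2
  rw [h.span_eq] at h1
  obtain ⟨d, hd⟩ := Submodule.mem_span_singleton.1 h1
  rw [← hd] at h2 ⊢
  have h3 := congrArg reC h2
  rw [hsub, map_add, reC_conjC, reC_smul, reC_mkC, reC_mkC, imC_mkC] at h3
  have h4 : (2 * d.re) • u + (-2 * d.im) • v
      = (Real.sqrt 2 * α) • u + (Real.sqrt 2 * β) • v := by
    have e1 : (2 * d.re) • u + (-2 * d.im) • v
      = d.re • u - d.im • v + (d.re • u - d.im • v) := by module
    rw [e1, h3]; module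
  obtain ⟨e1, e2⟩ := h.coeff_eq h4
  congr 1
  apply Complex.ext
  · rw [hcr]; linarith
  · rw [hci]; linarith

/-- The factor 2 in `Re L(Z, Z) = 2 dθ(u, v)` cancels the square of `√2 / 2` in the lift. -/
theorem webster_eq (h : IsFrameAt P x u v) (α β γ α' β' γ' : ℝ) :
    webster P x (α • u + β • v + γ • reeb P x) (α' • u + β' • v + γ' • reeb P x)
      = dForm P.θ x u v * (α * α' + β * β') + γ * γ' := by
  have hθ : ∀ α β γ : ℝ, P.θ x (α • u + β • v + γ • reeb P x) = γ := fun α β γ => by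
    simp [h.theta_u, h.theta_v, h.reeb_spec.1]
  have h2 : Real.sqrt 2 * Real.sqrt 2 = 2 := Real.mul_self_sqrt (by norm_num)
  rw [webster, hθ, hθ, h.lift10_spec, h.lift10_spec, levi_re]
  simp only [reC_smul, imC_smul, reC_mkC, imC_mkC, dForm_add_left, dForm_sub_left,
    dForm_add_right, dForm_sub_right, dForm_smul_left, dForm_smul_right, dForm_self,
    dForm_swap P.θ x v u]
  simp
  linear_combination (dForm P.θ x u v * (α * α' + β * β') / 2) * h2

end IsFrameAt

end Pointwise

/-! ### Functions, fields and forms in a chart -/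

theorem inverse_apply_apply {V W : Type*} [TopologicalSpace V] [AddCommGroup V] [Module ℝ V]
    [TopologicalSpace W] [AddCommGroup W] [Module ℝ W] {L : V →L[ℝ] W} (h : L.IsInvertible)
    (w : V) : L.inverse (L w) = w := by
  obtain ⟨e, rfl⟩ := h
  simp

section Chart

variable {M : Type*} [TopologicalSpace M] [ChartedSpace (EuclideanSpace ℝ (Fin 3)) M]
  {F : Type*} [NormedAddCommGroup F] [NormedSpace ℝ F]

/-- The derivative of the inverse of the chart at `x₀`. -/
abbrev chartSymmD (x₀ : M) (y : EuclideanSpace ℝ (Fin 3)) :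
    EuclideanSpace ℝ (Fin 3) →L[ℝ] TangentSpace (𝓡 3) ((extChartAt (𝓡 3) x₀).symm y) :=
  mfderiv 𝓘(ℝ, EuclideanSpace ℝ (Fin 3)) (𝓡 3) (extChartAt (𝓡 3) x₀).symm y

/-- The derivative of the chart at `x₀`. -/
abbrev chartD (x₀ x : M) : TangentSpace (𝓡 3) x →L[ℝ] EuclideanSpace ℝ (Fin 3) :=
  mfderiv (𝓡 3) 𝓘(ℝ, EuclideanSpace ℝ (Fin 3)) (extChartAt (𝓡 3) x₀) x

variable {x₀ : M}

theorem isOpen_chart_preimage {O : Set M} (hO : IsOpen O) (x₀ : M) :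
    IsOpen ((extChartAt (𝓡 3) x₀).target ∩ (extChartAt (𝓡 3) x₀).symm ⁻¹' O) :=
  (continuousOn_extChartAt_symm x₀).isOpen_inter_preimage (isOpen_extChartAt_target x₀) hO

variable [IsManifold (𝓡 3) ∞ M]

theorem chartD_chartSymmD {y : EuclideanSpace ℝ (Fin 3)} (hy : y ∈ (extChartAt (𝓡 3) x₀).target)
    (a : EuclideanSpace ℝ (Fin 3)) :
    chartD x₀ ((extChartAt (𝓡 3) x₀).symm y) (chartSymmD x₀ y a) = a := by
  have := IsManifold.of_le (I := 𝓡 3) (M := M) (m := 1) (n := ∞) (by norm_cast)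
  have h := mfderiv_extChartAt_comp_mfderivWithin_extChartAt_symm (I := 𝓡 3) hy
  rw [ModelWithCorners.range_eq_univ, mfderivWithin_univ] at h
  exact congrArg (fun L : EuclideanSpace ℝ (Fin 3) →L[ℝ] EuclideanSpace ℝ (Fin 3) => L a) h

theorem chartSymmD_chartD {y : EuclideanSpace ℝ (Fin 3)} (hy : y ∈ (extChartAt (𝓡 3) x₀).target)
    (u : TangentSpace (𝓡 3) ((extChartAt (𝓡 3) x₀).symm y)) :
    chartSymmD x₀ y (chartD x₀ ((extChartAt (𝓡 3) x₀).symm y) u) = u := by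
  have := IsManifold.of_le (I := 𝓡 3) (M := M) (m := 1) (n := ∞) (by norm_cast)
  have h := mfderivWithin_extChartAt_symm_comp_mfderiv_extChartAt (I := 𝓡 3) hy
  rw [ModelWithCorners.range_eq_univ, mfderivWithin_univ] at h
  exact congrArg (fun L : TangentSpace (𝓡 3) ((extChartAt (𝓡 3) x₀).symm y) →L[ℝ]
    TangentSpace (𝓡 3) ((extChartAt (𝓡 3) x₀).symm y) => L u) h

theorem contMDiffAt_chart_symm {y : EuclideanSpace ℝ (Fin 3)}
    (hy : y ∈ (extChartAt (𝓡 3) x₀).target) :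
    ContMDiffAt 𝓘(ℝ, EuclideanSpace ℝ (Fin 3)) (𝓡 3) ∞ (extChartAt (𝓡 3) x₀).symm y :=
  (contMDiffOn_extChartAt_symm x₀).contMDiffAt ((isOpen_extChartAt_target x₀).mem_nhds hy)

theorem contDiffOn_comp_chart_symm {O : Set M} {h : M → F}
    (hh : ContMDiffOn (𝓡 3) 𝓘(ℝ, F) ∞ h O) :
    ContDiffOn ℝ ∞ (h ∘ (extChartAt (𝓡 3) x₀).symm)
      ((extChartAt (𝓡 3) x₀).target ∩ (extChartAt (𝓡 3) x₀).symm ⁻¹' O) := by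
  rw [← contMDiffOn_iff_contDiffOn]
  exact hh.comp ((contMDiffOn_extChartAt_symm x₀).mono Set.inter_subset_left) fun y hy => hy.2

theorem fderiv_comp_chart_symm {h : M → F} {y : EuclideanSpace ℝ (Fin 3)}
    (hy : y ∈ (extChartAt (𝓡 3) x₀).target)
    (hh : MDifferentiableAt (𝓡 3) 𝓘(ℝ, F) h ((extChartAt (𝓡 3) x₀).symm y))
    (a : EuclideanSpace ℝ (Fin 3)) :
    fderiv ℝ (h ∘ (extChartAt (𝓡 3) x₀).symm) y a
      = mfderiv (𝓡 3) 𝓘(ℝ, F) h ((extChartAt (𝓡 3) x₀).symm y) (chartSymmD x₀ y a) := by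
  rw [← mfderiv_eq_fderiv, mfderiv_comp y hh
    ((contMDiffAt_chart_symm hy).mdifferentiableAt (by simp))]
  rfl

theorem fderiv_comp_chart_symm_chartD {h : M → F} {y : EuclideanSpace ℝ (Fin 3)}
    (hy : y ∈ (extChartAt (𝓡 3) x₀).target)
    (hh : MDifferentiableAt (𝓡 3) 𝓘(ℝ, F) h ((extChartAt (𝓡 3) x₀).symm y))
    (u : TangentSpace (𝓡 3) ((extChartAt (𝓡 3) x₀).symm y)) :
    fderiv ℝ (h ∘ (extChartAt (𝓡 3) x₀).symm) y
        (chartD x₀ ((extChartAt (𝓡 3) x₀).symm y) u)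
      = mfderiv (𝓡 3) 𝓘(ℝ, F) h ((extChartAt (𝓡 3) x₀).symm y) u := by
  rw [fderiv_comp_chart_symm hy hh, chartSymmD_chartD hy]

/-- The coordinate expression of a vector field. -/
def fieldInChart (X : ∀ x : M, TangentSpace (𝓡 3) x) (x₀ : M) (y : EuclideanSpace ℝ (Fin 3)) :
    EuclideanSpace ℝ (Fin 3) :=
  chartD x₀ ((extChartAt (𝓡 3) x₀).symm y) (X ((extChartAt (𝓡 3) x₀).symm y))

theorem chartSymmD_isInvertible {y : EuclideanSpace ℝ (Fin 3)}
    (hy : y ∈ (extChartAt (𝓡 3) x₀).target) : (chartSymmD x₀ y).IsInvertible := by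
  have := IsManifold.of_le (I := 𝓡 3) (M := M) (m := 1) (n := ∞) (by norm_cast)
  have h := isInvertible_mfderivWithin_extChartAt_symm (I := 𝓡 3) hy
  rwa [ModelWithCorners.range_eq_univ, mfderivWithin_univ] at h

/-- In coordinates the field is its pullback by the inverse chart, so smoothness of pullbacks
applies. -/
theorem contDiffOn_fieldInChart {O : Set M} (hO : IsOpen O) {X : ∀ x : M, TangentSpace (𝓡 3) x}
    (hX : SmoothFieldOn O X) :
    ContDiffOn ℝ ∞ (fieldInChart X x₀)
      ((extChartAt (𝓡 3) x₀).target ∩ (extChartAt (𝓡 3) x₀).symm ⁻¹' O) := by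
  intro y hy
  have h1 : ContMDiffAt (𝓡 3) (𝓡 3).tangent ∞
      (fun x => (⟨x, X x⟩ : TangentBundle (𝓡 3) M)) ((extChartAt (𝓡 3) x₀).symm y) :=
    hX.contMDiffAt (hO.mem_nhds hy.2)
  have h2 := ContMDiffAt.mpullback_vectorField_preimage h1 (contMDiffAt_chart_symm hy.1)
    (chartSymmD_isInvertible hy.1) (by norm_cast)
  have h3 := contMDiffAt_vectorSpace_iff_contDiffAt.1 h2
  refine (h3.congr_of_eventuallyEq ?_).contDiffWithinAt
  filter_upwards [(isOpen_extChartAt_target (I := 𝓡 3) x₀).mem_nhds hy.1] with z hz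
  change fieldInChart X x₀ z = (chartSymmD x₀ z).inverse (X ((extChartAt (𝓡 3) x₀).symm z))
  have h4 := chartSymmD_chartD hz (X ((extChartAt (𝓡 3) x₀).symm z))
  conv_rhs => rw [← h4]
  exact (inverse_apply_apply (chartSymmD_isInvertible hz) _).symm

/-- The coordinate vector field with constant coefficients `a` in the chart at `x₀`. -/
def coordField (x₀ : M) (a : EuclideanSpace ℝ (Fin 3)) (x : M) : TangentSpace (𝓡 3) x :=
  (chartD x₀ x).inverse a

theorem smoothFieldOn_coordField (a : EuclideanSpace ℝ (Fin 3)) :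
    SmoothFieldOn (extChartAt (𝓡 3) x₀).source (coordField x₀ a) := by
  have := IsManifold.of_le (I := 𝓡 3) (M := M) (m := 1) (n := ∞) (by norm_cast)
  intro x hx
  have h1 : ContMDiffAt 𝓘(ℝ, EuclideanSpace ℝ (Fin 3)) 𝓘(ℝ, EuclideanSpace ℝ (Fin 3)).tangent ∞
      (fun z => (⟨z, a⟩ : TangentBundle 𝓘(ℝ, EuclideanSpace ℝ (Fin 3))
        (EuclideanSpace ℝ (Fin 3)))) (extChartAt (𝓡 3) x₀ x) :=
    contMDiffAt_vectorSpace_iff_contDiffAt.2 contDiffAt_const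
  exact (ContMDiffAt.mpullback_vectorField_preimage h1
    (contMDiffAt_extChartAt' (by simpa using hx))
    (isInvertible_mfderiv_extChartAt hx) (by norm_cast)).contMDiffWithinAt

theorem coordField_symm {y : EuclideanSpace ℝ (Fin 3)} (hy : y ∈ (extChartAt (𝓡 3) x₀).target)
    (a : EuclideanSpace ℝ (Fin 3)) :
    coordField x₀ a ((extChartAt (𝓡 3) x₀).symm y) = chartSymmD x₀ y a := by
  have := IsManifold.of_le (I := 𝓡 3) (M := M) (m := 1) (n := ∞) (by norm_cast)
  have h := chartD_chartSymmD hy a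
  unfold coordField
  conv_lhs => rw [← h]
  exact inverse_apply_apply (isInvertible_mfderiv_extChartAt (I := 𝓡 3)
    ((extChartAt (𝓡 3) x₀).map_target hy)) _

/-- Smoothness of `θ` is only tested on smooth fields. The coordinate fields suffice, since they
recover the coefficients. -/
theorem contDiffOn_formInChart {θ : ∀ x : M, TangentSpace (𝓡 3) x →L[ℝ] ℝ}
    (hθ : SmoothOneForm θ) (x₀ : M) :
    ContDiffOn ℝ ∞ (formInChart θ x₀) (extChartAt (𝓡 3) x₀).target := by
  rw [contDiffOn_clm_apply]
  intro a
  have h := contDiffOn_comp_chart_symm (x₀ := x₀)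
    (hθ _ _ (isOpen_extChartAt_source x₀) (smoothFieldOn_coordField (x₀ := x₀) a))
  refine (h.mono fun y hy => ⟨hy, (extChartAt (𝓡 3) x₀).map_target hy⟩).congr fun y hy => ?_
  simp only [Function.comp_apply]
  rw [coordField_symm hy]
  rfl

/-- A function with vanishing differential on a connected manifold is constant. -/
theorem eq_of_mfderiv_eq_zero [PreconnectedSpace M] {h : M → F}
    (hh : ContMDiff (𝓡 3) 𝓘(ℝ, F) ∞ h) (h0 : ∀ x, ∀ u, mfderiv (𝓡 3) 𝓘(ℝ, F) h x u = 0)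
    (x y : M) : h x = h y := by
  have hl : IsLocallyConstant h := by
    rw [IsLocallyConstant.iff_eventually_eq]
    intro x
    have hx := mem_extChartAt_target (I := 𝓡 3) x
    have hd := contDiffOn_comp_chart_symm (x₀ := x) (hh.contMDiffOn (s := Set.univ))
    rw [Set.preimage_univ, Set.inter_univ] at hd
    have := eventually_eq_of_fderiv_eq_zero (isOpen_extChartAt_target (I := 𝓡 3) x)
      (hd.differentiableOn (by simp)) (fun y hy => by
        ext1 a
        rw [fderiv_comp_chart_symm hy (hh.mdifferentiableAt (by simp)), h0]
        rfl) hx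
    filter_upwards [(continuousAt_extChartAt (I := 𝓡 3) x).eventually this,
      extChartAt_source_mem_nhds (I := 𝓡 3) x] with z hz hzs
    simp only [Function.comp_apply] at hz
    rwa [(extChartAt (𝓡 3) x).left_inv hzs, extChartAt_to_inv] at hz
  exact hl.apply_eq_of_preconnectedSpace x y

end Chart

/-! ### Isotropy of a conjugate pair -/

section Conjugate

variable {E : Type*} [NormedAddCommGroup E] [NormedSpace ℝ E] {n : ℕ}

/-- The inclusion `ℝⁿ → ℂⁿ`. -/
def complexify (n : ℕ) : EuclideanSpace ℝ (Fin n) →L[ℝ] (Fin n → ℂ) :=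
  ContinuousLinearMap.pi fun i => Complex.ofRealCLM.comp (EuclideanSpace.proj i)

theorem complexify_apply (a : EuclideanSpace ℝ (Fin n)) (i : Fin n) :
    complexify n a i = (a i : ℂ) := rfl

/-- The complex bilinear extension of the inner product. -/
def complexDot (n : ℕ) : (Fin n → ℂ) →L[ℝ] (Fin n → ℂ) →L[ℝ] ℂ :=
  ∑ i, (ContinuousLinearMap.mul ℝ ℂ).bilinearComp (ContinuousLinearMap.proj i)
    (ContinuousLinearMap.proj i)

theorem complexDot_apply (a b : Fin n → ℂ) : complexDot n a b = ∑ i, a i * b i := by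
  simp [complexDot]

theorem complexDot_complexify (a b c d : EuclideanSpace ℝ (Fin n)) :
    complexDot n (complexify n a + Complex.I • complexify n b)
        (complexify n c + Complex.I • complexify n d)
      = ((inner ℝ a c - inner ℝ b d : ℝ) : ℂ) + ((inner ℝ a d + inner ℝ b c : ℝ) : ℂ) * Complex.I
      := by
  simp only [complexDot_apply, PiLp.inner_apply, RCLike.inner_apply, conj_trivial, Pi.add_apply,
    Pi.smul_apply, complexify_apply, smul_eq_mul]
  push_cast
  rw [← Finset.sum_sub_distrib, ← Finset.sum_add_distrib, Finset.sum_mul,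
    ← Finset.sum_add_distrib]
  refine Finset.sum_congr rfl fun i _ => ?_
  linear_combination (b i * d i : ℂ) * Complex.I_mul_I

theorem complexDot_complexify_eq_zero {a b c d : EuclideanSpace ℝ (Fin n)} :
    complexDot n (complexify n a + Complex.I • complexify n b)
        (complexify n c + Complex.I • complexify n d) = 0
      ↔ inner ℝ a c = inner ℝ b d ∧ inner ℝ a d = -inner ℝ b c := by
  rw [complexDot_complexify, Complex.ext_iff]
  simp only [Complex.add_re, Complex.ofReal_re, Complex.mul_re, Complex.I_re, Complex.I_im,
    Complex.ofReal_im, Complex.add_im, Complex.mul_im, Complex.zero_re, Complex.zero_im]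
  constructor
  · rintro ⟨h1, h2⟩; constructor <;> linarith
  · rintro ⟨h1, h2⟩; constructor <;> linarith

/-- `isotropic_of_frame` is applied to `F = f + i g`; the two identities are the real and imaginary
parts of `dF a · dF b = 0`. -/
theorem inner_fderiv_conjugate {O : Set E} (hO : IsOpen O) {f g : E → EuclideanSpace ℝ (Fin n)}
    (hf : ContDiffOn ℝ ∞ f O) (hg : ContDiffOn ℝ ∞ g O) {u v : E → E}
    (hu : DifferentiableOn ℝ u O) (hv : DifferentiableOn ℝ v O)
    (hfu : ∀ y ∈ O, fderiv ℝ f y (u y) = -fderiv ℝ g y (v y))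
    (hgu : ∀ y ∈ O, fderiv ℝ g y (u y) = fderiv ℝ f y (v y))
    (h1 : ∀ y ∈ O, inner ℝ (fderiv ℝ f y (u y)) (fderiv ℝ f y (u y))
      = inner ℝ (fderiv ℝ f y (v y)) (fderiv ℝ f y (v y)))
    (h2 : ∀ y ∈ O, inner ℝ (fderiv ℝ f y (u y)) (fderiv ℝ f y (v y)) = 0)
    (hspan : ∀ y ∈ O, ∀ c, c ∈ Submodule.span ℝ
      {u y, v y, fderiv ℝ v y (u y) - fderiv ℝ u y (v y)}) :
    ∀ y ∈ O, ∀ a b, inner ℝ (fderiv ℝ f y a) (fderiv ℝ f y b)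
        = inner ℝ (fderiv ℝ g y a) (fderiv ℝ g y b) ∧
      inner ℝ (fderiv ℝ f y a) (fderiv ℝ g y b)
        = -inner ℝ (fderiv ℝ g y a) (fderiv ℝ f y b) := by
  set F : E → Fin n → ℂ := fun y => complexify n (f y) + Complex.I • complexify n (g y) with hF
  have hd : ∀ y ∈ O, ∀ a, fderiv ℝ F y a
      = complexify n (fderiv ℝ f y a) + Complex.I • complexify n (fderiv ℝ g y a) := by
    intro y hy a
    have df := ((hf.contDiffAt (hO.mem_nhds hy)).differentiableAt (by simp)).hasFDerivAt
    have dg := ((hg.contDiffAt (hO.mem_nhds hy)).differentiableAt (by simp)).hasFDerivAt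
    have := ((complexify n).hasFDerivAt.comp y df).add
      (((complexify n).hasFDerivAt.comp y dg).const_smul Complex.I)
    exact congrArg (fun L : E →L[ℝ] (Fin n → ℂ) => L a) this.fderiv
  have hFs : ContDiffOn ℝ ∞ F O :=
    ((complexify n).contDiff.comp_contDiffOn hf).add
      (((complexify n).contDiff.comp_contDiffOn hg).const_smul Complex.I)
  have key := isotropic_of_frame (complexDot n)
    (fun a b => by simp only [complexDot_apply, mul_comm])
    (fun a b => by
      simp only [complexDot_apply, Pi.smul_apply, smul_eq_mul, Finset.mul_sum, mul_assoc])
    hO hFs hu hv (fun y hy => by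
      rw [hd y hy, hd y hy, hfu y hy, hgu y hy, map_neg, smul_add, smul_smul, Complex.I_mul_I,
        neg_one_smul]
      abel)
    (fun y hy => by
      rw [hd y hy, complexDot_complexify_eq_zero, hgu y hy]
      exact ⟨h1 y hy, by rw [h2 y hy, real_inner_comm, h2 y hy, neg_zero]⟩) hspan
  intro y hy a b
  have := key y hy a b
  rwa [hd y hy, hd y hy, complexDot_complexify_eq_zero] at this

end Conjugate

/-! ### Contact frames -/

section ContactFrame

variable {M : Type*} [TopologicalSpace M] [ChartedSpace (EuclideanSpace ℝ (Fin 3)) M]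
  [IsManifold (𝓡 3) ∞ M] {S : CRStructure M} {P : Pseudohermitian S}

theorem formInChart_fieldInChart (θ : ∀ x : M, TangentSpace (𝓡 3) x →L[ℝ] ℝ)
    (X : ∀ x : M, TangentSpace (𝓡 3) x) (x₀ : M) {y : EuclideanSpace ℝ (Fin 3)}
    (hy : y ∈ (extChartAt (𝓡 3) x₀).target) :
    formInChart θ x₀ y (fieldInChart X x₀ y)
      = θ ((extChartAt (𝓡 3) x₀).symm y) (X ((extChartAt (𝓡 3) x₀).symm y)) :=
  congrArg (θ ((extChartAt (𝓡 3) x₀).symm y)) (chartSymmD_chartD hy _)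

theorem fderiv_comp_chart_symm_fieldInChart {F : Type*} [NormedAddCommGroup F] [NormedSpace ℝ F]
    {h : M → F} {x₀ : M} {y : EuclideanSpace ℝ (Fin 3)} (hy : y ∈ (extChartAt (𝓡 3) x₀).target)
    (hh : MDifferentiableAt (𝓡 3) 𝓘(ℝ, F) h ((extChartAt (𝓡 3) x₀).symm y))
    (X : ∀ x : M, TangentSpace (𝓡 3) x) :
    fderiv ℝ (h ∘ (extChartAt (𝓡 3) x₀).symm) y (fieldInChart X x₀ y)
      = mfderiv (𝓡 3) 𝓘(ℝ, F) h ((extChartAt (𝓡 3) x₀).symm y)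
        (X ((extChartAt (𝓡 3) x₀).symm y)) :=
  fderiv_comp_chart_symm_chartD hy hh _

/-- Cartan's formula for fields in `ker θ`, by differentiating `θ(X) = θ(Y) = 0`. It is stated at
the centre of the chart because `dForm` at `x` uses the chart at `x`. -/
theorem dForm_eq_bracket {θ : ∀ x : M, TangentSpace (𝓡 3) x →L[ℝ] ℝ} (hθ : SmoothOneForm θ)
    {X Y : ∀ x : M, TangentSpace (𝓡 3) x} {O : Set M} (hO : IsOpen O)
    (hX : SmoothFieldOn O X) (hY : SmoothFieldOn O Y)
    (hX0 : ∀ x ∈ O, θ x (X x) = 0) (hY0 : ∀ x ∈ O, θ x (Y x) = 0) {x : M} (hx : x ∈ O) :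
    formInChart θ x (extChartAt (𝓡 3) x x)
      (fderiv ℝ (fieldInChart Y x) (extChartAt (𝓡 3) x x)
          (fieldInChart X x (extChartAt (𝓡 3) x x))
        - fderiv ℝ (fieldInChart X x) (extChartAt (𝓡 3) x x)
          (fieldInChart Y x (extChartAt (𝓡 3) x x)))
      = -dForm θ x (X x) (Y x) := by
  set y₀ := extChartAt (𝓡 3) x x with hy₀
  have hopen := isOpen_chart_preimage hO x
  have hmem : y₀ ∈ (extChartAt (𝓡 3) x).target ∩ (extChartAt (𝓡 3) x).symm ⁻¹' O :=
    ⟨mem_extChartAt_target x, by simpa [hy₀] using hx⟩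
  have dθ : DifferentiableAt ℝ (formInChart θ x) y₀ :=
    ((contDiffOn_formInChart hθ x).contDiffAt
      ((isOpen_extChartAt_target x).mem_nhds hmem.1)).differentiableAt (by simp)
  have key : ∀ Z : ∀ x : M, TangentSpace (𝓡 3) x, SmoothFieldOn O Z →
      (∀ x ∈ O, θ x (Z x) = 0) → ∀ a, formInChart θ x y₀ (fderiv ℝ (fieldInChart Z x) y₀ a)
        = -fderiv ℝ (formInChart θ x) y₀ a (fieldInChart Z x y₀) := by
    intro Z hZ hZ0 a
    have dZ : DifferentiableAt ℝ (fieldInChart Z x) y₀ :=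
      ((contDiffOn_fieldInChart hO hZ).contDiffAt (hopen.mem_nhds hmem)).differentiableAt (by simp)
    have e : (fun y => formInChart θ x y (fieldInChart Z x y)) =ᶠ[𝓝 y₀] fun _ => (0 : ℝ) := by
      filter_upwards [hopen.mem_nhds hmem] with y hy
      rw [formInChart_fieldInChart θ Z x hy.1, hZ0 _ hy.2]
    have h := e.fderiv_eq (𝕜 := ℝ)
    rw [fderiv_clm_apply dθ dZ] at h
    have := congrArg (fun L : EuclideanSpace ℝ (Fin 3) →L[ℝ] ℝ => L a) h
    simp at this
    linarith
  have hf : ∀ Z : ∀ x : M, TangentSpace (𝓡 3) x,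
      fieldInChart Z x y₀ = chartD x x (Z x) := by
    intro Z
    rw [fieldInChart, hy₀, extChartAt_to_inv]
  rw [map_sub, key Y hY hY0, key X hX hX0, hf, hf]
  exact (by intro a b; ring : ∀ a b : ℝ, -a - -b = -(a - b)) _ _

/-- Near every point there is a frame of `T^{1,0}`, whose real and imaginary parts span the tangent
space together with their bracket. -/
theorem exists_contact_frame (hpos : LeviPositive P) (x₀ : M) {W : Set M} (hW : IsOpen W)
    (hxW : x₀ ∈ W) :
    ∃ (O : Set (EuclideanSpace ℝ (Fin 3))) (X Y : ∀ x : M, TangentSpace (𝓡 3) x),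
      IsOpen O ∧ extChartAt (𝓡 3) x₀ x₀ ∈ O ∧ O ⊆ (extChartAt (𝓡 3) x₀).target ∧
      (∀ y ∈ O, (extChartAt (𝓡 3) x₀).symm y ∈ W ∧
        IsFrameAt P ((extChartAt (𝓡 3) x₀).symm y) (X ((extChartAt (𝓡 3) x₀).symm y))
          (Y ((extChartAt (𝓡 3) x₀).symm y))) ∧
      ContDiffOn ℝ ∞ (fieldInChart X x₀) O ∧ ContDiffOn ℝ ∞ (fieldInChart Y x₀) O ∧
      ∀ y ∈ O, ∀ c, c ∈ Submodule.span ℝ {fieldInChart X x₀ y, fieldInChart Y x₀ y,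
        fderiv ℝ (fieldInChart Y x₀) y (fieldInChart X x₀ y)
          - fderiv ℝ (fieldInChart X x₀) y (fieldInChart Y x₀ y)} := by
  obtain ⟨O, Z, hO, hx, hZ, hfr⟩ := S.exists_frame x₀
  have hframe : ∀ x ∈ O, IsFrameAt P x (reC (Z x)) (imC (Z x)) := fun x hx =>
    IsFrameAt.of_span hpos (hfr x hx).1 (hfr x hx).2
  set X : ∀ x : M, TangentSpace (𝓡 3) x := fun x => reC (Z x) with hX
  set Y : ∀ x : M, TangentSpace (𝓡 3) x := fun x => imC (Z x) with hY
  set y₀ := extChartAt (𝓡 3) x₀ x₀ with hy₀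
  set O₁ := (extChartAt (𝓡 3) x₀).target ∩ (extChartAt (𝓡 3) x₀).symm ⁻¹' (O ∩ W) with hO₁
  have hopen : IsOpen O₁ := isOpen_chart_preimage (hO.inter hW) x₀
  have hmem : y₀ ∈ O₁ := ⟨mem_extChartAt_target x₀, by simpa [hy₀] using ⟨hx, hxW⟩⟩
  have hsub : O₁ ⊆ (extChartAt (𝓡 3) x₀).target ∩ (extChartAt (𝓡 3) x₀).symm ⁻¹' O :=
    fun y hy => ⟨hy.1, hy.2.1⟩
  have cX : ContDiffOn ℝ ∞ (fieldInChart X x₀) O₁ := (contDiffOn_fieldInChart hO hZ.1).mono hsub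
  have cY : ContDiffOn ℝ ∞ (fieldInChart Y x₀) O₁ := (contDiffOn_fieldInChart hO hZ.2).mono hsub
  set w : EuclideanSpace ℝ (Fin 3) → Fin 3 → EuclideanSpace ℝ (Fin 3) := fun y =>
    ![fieldInChart X x₀ y, fieldInChart Y x₀ y,
      fderiv ℝ (fieldInChart Y x₀) y (fieldInChart X x₀ y)
        - fderiv ℝ (fieldInChart X x₀) y (fieldInChart Y x₀ y)] with hw
  have cw : ContinuousOn w O₁ := by
    have fX := cX.continuousOn_fderiv_of_isOpen hopen (by simp)
    have fY := cY.continuousOn_fderiv_of_isOpen hopen (by simp)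
    refine continuousOn_pi.2 fun i => ?_
    fin_cases i
    · exact cX.continuousOn
    · exact cY.continuousOn
    · exact (fY.clm_apply cX.continuousOn).sub (fX.clm_apply cY.continuousOn)
  -- Applying `θ` isolates the bracket, whose coefficient vanishes because `dθ(X, Y) ≠ 0`; then `X`
  -- and `Y` are independent.
  have hli : LinearIndependent ℝ (w y₀) := by
    rw [Fintype.linearIndependent_iff]
    intro c hc
    simp only [hw, Fin.sum_univ_three, Matrix.cons_val_zero, Matrix.cons_val_one,
      Matrix.cons_val_two] at hc
    have hfr₀ := hframe x₀ hx
    have e1 := formInChart_fieldInChart P.θ X x₀ hmem.1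
    have e2 := formInChart_fieldInChart P.θ Y x₀ hmem.1
    have e3 := dForm_eq_bracket P.smooth hO hZ.1 hZ.2 (fun x hx => (hframe x hx).theta_u)
      (fun x hx => (hframe x hx).theta_v) hx
    rw [hy₀, extChartAt_to_inv] at e1 e2
    have hc' := congrArg (formInChart P.θ x₀ y₀) hc
    rw [map_add, map_add, map_smul, map_smul, map_smul, map_zero, hy₀, e1, e2] at hc'
    erw [e3] at hc'
    rw [hfr₀.theta_u, hfr₀.theta_v] at hc'
    simp only [smul_eq_mul, mul_zero, zero_add] at hc'
    have h2 : c 2 = 0 := by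
      rcases mul_eq_zero.1 hc' with h | h
      · exact h
      · exact absurd (neg_eq_zero.1 h) hfr₀.pos.ne'
    rw [h2, zero_smul, add_zero] at hc
    have hc2 := congrArg (chartSymmD x₀ y₀) hc
    rw [map_add, map_smul, map_smul, map_zero, fieldInChart, fieldInChart,
      chartSymmD_chartD hmem.1, chartSymmD_chartD hmem.1, hy₀, extChartAt_to_inv] at hc2
    have := hfr₀.coeff_eq (α := c 0) (β := c 1) (α' := 0) (β' := 0) (by simpa using hc2)
    intro i
    fin_cases i
    · exact this.1
    · exact this.2
    · exact h2
  -- Independence is known at the centre of the chart only; it persists nearby since it is an open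
  -- condition.
  have hopen2 : IsOpen (O₁ ∩ w ⁻¹' {b | LinearIndependent ℝ b}) :=
    cw.isOpen_inter_preimage hopen isOpen_setOfPred_linearIndependent
  refine ⟨_, X, Y, hopen2, ⟨hmem, hli⟩, fun y hy => hy.1.1,
    fun y hy => ⟨hy.1.2.2, hframe _ hy.1.2.1⟩, cX.mono Set.inter_subset_left,
    cY.mono Set.inter_subset_left, fun y hy c => ?_⟩
  have hy2 : LinearIndependent ℝ (w y) := hy.2
  have := hy2.span_eq_top_of_card_eq_finrank (by simp)
  have hr : Set.range (w y) = {fieldInChart X x₀ y, fieldInChart Y x₀ y,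
        fderiv ℝ (fieldInChart Y x₀) y (fieldInChart X x₀ y)
          - fderiv ℝ (fieldInChart X x₀) y (fieldInChart Y x₀ y)} := by
    simp only [hw, Matrix.range_cons, Matrix.range_empty, Set.union_empty, Set.singleton_union]
  rw [← hr, this]
  trivial

end ContactFrame

/-! ### The complex structure of ℝ⁴ attached to `f` -/

section SkewIsometry

variable {G : Type*} [NormedAddCommGroup G] [InnerProductSpace ℝ G]

/-- An orthogonal complex structure. -/
structure IsSkewIsometry (K : G →L[ℝ] G) : Prop where
  inner_map_map : ∀ p q, inner ℝ (K p) (K q) = inner ℝ p q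
  inner_map_left : ∀ p q, inner ℝ (K p) q = -inner ℝ p (K q)

theorem IsSkewIsometry.map_map {K : G →L[ℝ] G} (h : IsSkewIsometry K) (p : G) :
    K (K p) = -p := by
  refine ext_inner_right ℝ fun q => ?_
  rw [h.inner_map_left, h.inner_map_map, inner_neg_left]

end SkewIsometry

section Conjugation

variable {M : Type*} [TopologicalSpace M] [ChartedSpace (EuclideanSpace ℝ (Fin 3)) M]
  {F F' : Type*} [NormedAddCommGroup F] [NormedSpace ℝ F] [NormedAddCommGroup F']
  [NormedSpace ℝ F']

/-- The differential of a map into a vector space. -/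
abbrev dif (h : M → F) (x : M) : TangentSpace (𝓡 3) x →L[ℝ] F := mfderiv (𝓡 3) 𝓘(ℝ, F) h x

theorem mfderiv_clm_comp (L : F →L[ℝ] F') {h : M → F} {x : M}
    (hh : MDifferentiableAt (𝓡 3) 𝓘(ℝ, F) h x) (w : TangentSpace (𝓡 3) x) :
    mfderiv (𝓡 3) 𝓘(ℝ, F') (fun y => L (h y)) x w = L (dif h x w) := by
  have := mfderiv_comp x (g := L) (L.hasMFDerivAt (x := h x)).mdifferentiableAt hh
  rw [L.hasMFDerivAt.mfderiv] at this
  exact congrArg (fun T : TangentSpace (𝓡 3) x →L[ℝ] F' => T w) this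

theorem eventually_of_chart {x₀ : M} {p : M → Prop}
    (h : ∀ᶠ y in 𝓝 (extChartAt (𝓡 3) x₀ x₀), p ((extChartAt (𝓡 3) x₀).symm y)) :
    ∀ᶠ x in 𝓝 x₀, p x := by
  filter_upwards [(continuousAt_extChartAt (I := 𝓡 3) x₀).eventually h,
    extChartAt_source_mem_nhds (I := 𝓡 3) x₀] with x hx hxs
  rwa [(extChartAt (𝓡 3) x₀).left_inv hxs] at hx

variable [IsManifold (𝓡 3) ∞ M] {S : CRStructure M} {P : Pseudohermitian S}
  {f : M → EuclideanSpace ℝ (Fin 4)}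

/-- `g` is the imaginary part of the local CR map; the two equations are the real and imaginary
parts of `dF(Z̄) = 0`. -/
theorem IsCRPluriharmonic.exists_conjugate (h : IsCRPluriharmonic S f) (x : M) :
    ∃ (O : Set M) (g : M → EuclideanSpace ℝ (Fin 4)), IsOpen O ∧ x ∈ O ∧
      ContMDiffOn (𝓡 3) 𝓘(ℝ, EuclideanSpace ℝ (Fin 4)) ∞ g O ∧
      (ContMDiffOn (𝓡 3) 𝓘(ℝ, EuclideanSpace ℝ (Fin 4)) ∞ f O → ∀ y ∈ O, ∀ z ∈ S.T10 y,
        dif f y (reC z)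
          = -dif g y (imC z) ∧
        dif g y (reC z)
          = dif f y (imC z)) := by
  obtain ⟨O, H, hO, hx, hH⟩ := h x
  set g : M → EuclideanSpace ℝ (Fin 4) := fun y => WithLp.toLp 2 fun i => (H i y).im with hg
  have sg : ContMDiffOn (𝓡 3) 𝓘(ℝ, EuclideanSpace ℝ (Fin 4)) ∞ g O := by
    have h1 : ContMDiffOn (𝓡 3) 𝓘(ℝ, Fin 4 → ℝ) ∞ (fun y i => (H i y).im) O :=
      contMDiffOn_pi_space.2 fun i =>
        Complex.imCLM.contDiff.contMDiff.comp_contMDiffOn (hH i).1.1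
    exact (EuclideanSpace.equiv (Fin 4) ℝ).symm.contDiff.contMDiff.comp_contMDiffOn h1
  refine ⟨O, g, hO, hx, sg, fun sf y hy z hz => ?_⟩
  have dH : ∀ i, MDifferentiableAt (𝓡 3) 𝓘(ℝ, ℂ) (H i) y := fun i =>
    ((hH i).1.1.contMDiffAt (hO.mem_nhds hy)).mdifferentiableAt (by simp)
  have ef : ∀ i w, dif f y w i = (dif (H i) y w).re := by
    intro i w
    have e1 := mfderiv_clm_comp (EuclideanSpace.proj i : EuclideanSpace ℝ (Fin 4) →L[ℝ] ℝ)
      ((sf.contMDiffAt (hO.mem_nhds hy)).mdifferentiableAt (by simp)) w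
    have e2 := mfderiv_clm_comp Complex.reCLM (dH i) w
    have e : (fun y => (EuclideanSpace.proj i : EuclideanSpace ℝ (Fin 4) →L[ℝ] ℝ) (f y))
        =ᶠ[𝓝 y] fun y => Complex.reCLM (H i y) := by
      filter_upwards [hO.mem_nhds hy] with y' hy' using (hH i).2 y' hy'
    rw [e.mfderiv_eq] at e1
    exact e1.symm.trans e2
  have eg : ∀ i w, dif g y w i = (dif (H i) y w).im := by
    intro i w
    have e1 := mfderiv_clm_comp (EuclideanSpace.proj i : EuclideanSpace ℝ (Fin 4) →L[ℝ] ℝ)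
      ((sg.contMDiffAt (hO.mem_nhds hy)).mdifferentiableAt (by simp)) w
    exact e1.symm.trans (mfderiv_clm_comp Complex.imCLM (dH i) w)
  have hcr : ∀ i, dif (H i) y (reC z) + Complex.I * -dif (H i) y (imC z) = 0 := by
    intro i
    have := (hH i).1.2 y hy z hz
    simp only [extC, reC_conjC, imC_conjC] at this
    erw [map_neg] at this
    exact this
  constructor
  · refine PiLp.ext fun i => ?_
    have := congrArg Complex.re (hcr i)
    rw [Complex.add_re, Complex.mul_re, Complex.I_re, Complex.I_im, Complex.neg_im] at this
    refine (ef i _).trans (Eq.trans ?_ (congrArg Neg.neg (eg i _)).symm)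
    simp only [Complex.zero_re] at this
    linarith
  · refine PiLp.ext fun i => ?_
    have := congrArg Complex.im (hcr i)
    rw [Complex.add_im, Complex.mul_im, Complex.I_re, Complex.I_im, Complex.neg_re] at this
    refine (eg i _).trans (Eq.trans ?_ (ef i _).symm)
    simp only [Complex.zero_im] at this
    linarith

theorem IsFrameAt.mem_T10 {x : M} {u v : TangentSpace (𝓡 3) x} (h : IsFrameAt P x u v) :
    mkC u v ∈ S.T10 x := by
  rw [h.span_eq]; exact Submodule.mem_span_singleton_self _

/-- The Webster metric in an adapted basis. -/
theorem IsFrameAt.webster_basis {x : M} {u v : TangentSpace (𝓡 3) x} (h : IsFrameAt P x u v) :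
    webster P x u u = dForm P.θ x u v ∧ webster P x v v = dForm P.θ x u v ∧
      webster P x u v = 0 ∧ webster P x u (reeb P x) = 0 ∧ webster P x v (reeb P x) = 0 ∧
      webster P x (reeb P x) (reeb P x) = 1 := by
  have e1 := h.webster_eq 1 0 0 1 0 0
  have e2 := h.webster_eq 0 1 0 0 1 0
  have e3 := h.webster_eq 1 0 0 0 1 0
  have e4 := h.webster_eq 1 0 0 0 0 1
  have e5 := h.webster_eq 0 1 0 0 0 1
  have e6 := h.webster_eq 0 0 1 0 0 1
  simp at e1 e2 e3 e4 e5 e6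
  exact ⟨e1, e2, e3, e4, e5, e6⟩

/-- The differential of `f` is `J`-linear on `T^{1,0}`, for the complex structure `J = -K`. -/
def IsConjugatedBy (S : CRStructure M) (f : M → EuclideanSpace ℝ (Fin 4))
    (K : EuclideanSpace ℝ (Fin 4) →L[ℝ] EuclideanSpace ℝ (Fin 4)) (x : M) : Prop :=
  ∀ z ∈ S.T10 x, dif f x (imC z)
    = K (dif f x (reC z))

/-- The parallel structure requires one direction besides the image of `df`, and `dg(T)` supplies
it. On T^{1,0} the CR equations turn `dg = K ∘ df` into a condition on `f` alone, free of the local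
choice of `g`. -/
theorem eventually_isConjugatedBy (hpos : LeviPositive P) (hiso : IsIsometricImmersion P f)
    (hplu : IsCRPluriharmonic S f) (x₀ : M) :
    ∃ K, IsSkewIsometry K ∧ ∀ᶠ x in 𝓝 x₀, IsConjugatedBy S f K x := by
  obtain ⟨W, g, hW, hxW, sg, hcr⟩ := hplu.exists_conjugate x₀
  replace hcr := hcr hiso.1.contMDiffOn
  obtain ⟨O, X, Y, hO, hy₀, hOt, hfr, cX, cY, hspan⟩ := exists_contact_frame hpos x₀ hW hxW
  have mf : ∀ x, MDifferentiableAt (𝓡 3) 𝓘(ℝ, EuclideanSpace ℝ (Fin 4)) f x := fun x =>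
    hiso.1.mdifferentiableAt (by simp)
  have mg : ∀ x ∈ W, MDifferentiableAt (𝓡 3) 𝓘(ℝ, EuclideanSpace ℝ (Fin 4)) g x := fun x hx =>
    (sg.contMDiffAt (hW.mem_nhds hx)).mdifferentiableAt (by simp)
  set fc := f ∘ (extChartAt (𝓡 3) x₀).symm with hfc
  set gc := g ∘ (extChartAt (𝓡 3) x₀).symm with hgc
  have cf : ContDiffOn ℝ ∞ fc O :=
    (contDiffOn_comp_chart_symm (hiso.1.contMDiffOn (s := Set.univ))).mono
      fun y hy => ⟨hOt hy, trivial⟩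
  have cg : ContDiffOn ℝ ∞ gc O :=
    (contDiffOn_comp_chart_symm sg).mono fun y hy => ⟨hOt hy, (hfr y hy).1⟩
  have efX := fun y (hy : y ∈ O) => fderiv_comp_chart_symm_fieldInChart (hOt hy) (mf _) X
  have efY := fun y (hy : y ∈ O) => fderiv_comp_chart_symm_fieldInChart (hOt hy) (mf _) Y
  have egX := fun y (hy : y ∈ O) =>
    fderiv_comp_chart_symm_fieldInChart (hOt hy) (mg _ (hfr y hy).1) X
  have egY := fun y (hy : y ∈ O) =>
    fderiv_comp_chart_symm_fieldInChart (hOt hy) (mg _ (hfr y hy).1) Y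
  have hcr' := fun y (hy : y ∈ O) => hcr _ (hfr y hy).1 _ (hfr y hy).2.mem_T10
  simp only [reC_mkC, imC_mkC] at hcr'
  have hin := fun y => (hiso.2 ((extChartAt (𝓡 3) x₀).symm y)).2
  have key := inner_fderiv_conjugate hO cf cg (cX.differentiableOn (by simp))
    (cY.differentiableOn (by simp))
    (fun y hy => (efX y hy).trans ((hcr' y hy).1.trans (congrArg Neg.neg (egY y hy)).symm))
    (fun y hy => (egX y hy).trans ((hcr' y hy).2.trans (efY y hy).symm))
    (fun y hy => by
      have := (hfr y hy).2.webster_basis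
      rw [efX y hy, efY y hy]
      exact ((hin y _ _).trans (this.1.trans this.2.1.symm)).trans (hin y _ _).symm)
    (fun y hy => by
      rw [efX y hy, efY y hy]
      exact (hin y _ _).trans (hfr y hy).2.webster_basis.2.2.1) hspan
  set y₀ := extChartAt (𝓡 3) x₀ x₀ with hy₀def
  set x₁ := (extChartAt (𝓡 3) x₀).symm y₀ with hx₁
  have hfr₁ := (hfr y₀ hy₀).2
  set b₀ := fieldInChart (reeb P) x₀ y₀ with hb₀
  have efT := fderiv_comp_chart_symm_fieldInChart (hOt hy₀) (mf _) (reeb P)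
  have hw := hfr₁.webster_basis
  have hXT : inner ℝ (fderiv ℝ fc y₀ (fieldInChart X x₀ y₀)) (fderiv ℝ fc y₀ b₀) = 0 := by
    rw [efX y₀ hy₀, efT]; exact (hin y₀ _ _).trans hw.2.2.2.1
  have hYT : inner ℝ (fderiv ℝ fc y₀ (fieldInChart Y x₀ y₀)) (fderiv ℝ fc y₀ b₀) = 0 := by
    rw [efY y₀ hy₀, efT]; exact (hin y₀ _ _).trans hw.2.2.2.2.1
  have hTT : inner ℝ (fderiv ℝ fc y₀ b₀) (fderiv ℝ fc y₀ b₀) = 1 := by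
    rw [efT]; exact (hin y₀ _ _).trans hw.2.2.2.2.2
  have hdec : ∀ a, ∃ α β γ : ℝ, a = α • fieldInChart X x₀ y₀ + β • fieldInChart Y x₀ y₀
      + γ • b₀ := by
    intro a
    obtain ⟨α, β, hab⟩ := hfr₁.decomp hfr₁.reeb_spec.1 (chartSymmD x₀ y₀ a)
    refine ⟨α, β, P.θ x₁ (chartSymmD x₀ y₀ a), ?_⟩
    have := congrArg (chartD x₀ x₁) hab
    rw [chartD_chartSymmD (hOt hy₀), map_add, map_add, map_smul, map_smul, map_smul] at this
    exact this
  -- Isotropy moves `dg` to the other factor. The CR equations turn `dg X`, `dg Y` into `±df Y`,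
  -- `±df X`, which are orthogonal to `df T`; on `T` itself the pairing is skew.
  have hperp : ∀ a, inner ℝ (fderiv ℝ fc y₀ a) (fderiv ℝ gc y₀ b₀) = 0 := by
    intro a
    obtain ⟨α, β, γ, rfl⟩ := hdec a
    have e1 := (key y₀ hy₀ (fieldInChart X x₀ y₀) b₀).2
    have e2 := (key y₀ hy₀ (fieldInChart Y x₀ y₀) b₀).2
    have e3 := (key y₀ hy₀ b₀ b₀).2
    have e1' : fderiv ℝ gc y₀ (fieldInChart X x₀ y₀) = fderiv ℝ fc y₀ (fieldInChart Y x₀ y₀) :=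
      (egX y₀ hy₀).trans ((hcr' y₀ hy₀).2.trans (efY y₀ hy₀).symm)
    have e2' : fderiv ℝ fc y₀ (fieldInChart X x₀ y₀) = -fderiv ℝ gc y₀ (fieldInChart Y x₀ y₀) :=
      (efX y₀ hy₀).trans ((hcr' y₀ hy₀).1.trans (congrArg Neg.neg (egY y₀ hy₀)).symm)
    rw [e1', hYT, neg_zero] at e1
    rw [e2', inner_neg_left] at hXT
    rw [hXT] at e2
    have e4 := real_inner_comm (fderiv ℝ gc y₀ b₀) (fderiv ℝ fc y₀ b₀)
    simp only [map_add, map_smul, inner_add_left, inner_smul_left, e1, e2]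
    simp only [mul_zero, zero_add]
    rw [show inner ℝ (fderiv ℝ fc y₀ b₀) (fderiv ℝ gc y₀ b₀) = 0 by linarith, mul_zero]
  have hgT : inner ℝ (fderiv ℝ gc y₀ b₀) (fderiv ℝ gc y₀ b₀) = 1 := by
    rw [← (key y₀ hy₀ b₀ b₀).1, hTT]
  have hb : Function.Bijective fun p : EuclideanSpace ℝ (Fin 3) × ℝ =>
      fderiv ℝ fc y₀ p.1 + p.2 • fderiv ℝ gc y₀ b₀ := by
    let L : EuclideanSpace ℝ (Fin 3) × ℝ →ₗ[ℝ] EuclideanSpace ℝ (Fin 4) :=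
      (fderiv ℝ fc y₀).toLinearMap.coprod (LinearMap.toSpanSingleton ℝ _ (fderiv ℝ gc y₀ b₀))
    have hinj : Function.Injective L := by
      rw [← LinearMap.ker_eq_bot, LinearMap.ker_eq_bot']
      rintro ⟨a, s⟩ h
      have h' : fderiv ℝ fc y₀ a + s • fderiv ℝ gc y₀ b₀ = 0 := h
      have hs := congrArg (fun p => inner ℝ p (fderiv ℝ gc y₀ b₀)) h'
      simp only [inner_add_left, hperp, inner_smul_left, hgT, inner_zero_left] at hs
      have hs0 : s = 0 := by simpa using hs
      subst hs0
      rw [zero_smul, add_zero, fderiv_comp_chart_symm (hOt hy₀) (mf _)] at h'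
      have h2 := (hiso.2 x₁).1 (h'.trans (map_zero (dif f x₁)).symm)
      have h3 := congrArg (chartD x₀ x₁) h2
      rw [chartD_chartSymmD (hOt hy₀), map_zero] at h3
      simp [h3]
    exact ⟨hinj, (LinearMap.injective_iff_surjective_of_finrank_eq_finrank (by simp)).1 hinj⟩
  obtain ⟨K, hK1, hK2, hK⟩ := exists_parallel_complex_structure hO cf cg
    (fun y hy a b => (key y hy a b).1) (fun y hy a b => (key y hy a b).2) hy₀ b₀ hb
  refine ⟨K, ⟨hK1, hK2⟩, eventually_of_chart ?_⟩
  filter_upwards [hK, hO.mem_nhds hy₀] with y hy hyO z hz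
  have := hy (chartD x₀ _ (reC z))
  rw [fderiv_comp_chart_symm_chartD (hOt hyO) (mf _),
    fderiv_comp_chart_symm_chartD (hOt hyO) (mg _ (hfr y hyO).1)] at this
  exact (hcr _ (hfr y hyO).1 z hz).2.symm.trans this

end Conjugation

/-! ### Skew operators and orthogonal complex structures -/

section LinearAlgebra

variable {G : Type*} [NormedAddCommGroup G] [InnerProductSpace ℝ G] [FiniteDimensional ℝ G]

/-- A skew operator that vanishes on a hyperplane is zero. -/
theorem eq_zero_of_skew {E : Type*} [AddCommGroup E] [Module ℝ E]
    (hE : Module.finrank ℝ G = Module.finrank ℝ E + 1) {L : G →L[ℝ] G}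
    (hL : ∀ p q, inner ℝ (L p) q = -inner ℝ p (L q)) {T : E →ₗ[ℝ] G}
    (hT : Function.Injective T) (h0 : ∀ a, L (T a) = 0) : L = 0 := by
  set R := LinearMap.range T with hR
  have hfin : Module.finrank ℝ R = Module.finrank ℝ E := LinearMap.finrank_range_of_inj hT
  have h1 : Module.finrank ℝ Rᗮ = 1 := by
    have := R.finrank_add_finrank_orthogonal
    omega
  obtain ⟨⟨n, hn⟩, hn0, hspan⟩ := finrank_eq_one_iff'.1 h1
  -- Skewness and `L = 0` on the hyperplane `R` put `L n` on the normal line, while `⟨L n, n⟩ = 0`;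
  -- hence `L n = 0`.
  have hLn : L n ∈ Rᗮ := by
    rw [Submodule.mem_orthogonal]
    rintro _ ⟨a, rfl⟩
    rw [← neg_eq_iff_eq_neg.2 (hL (T a) n), h0, inner_zero_left, neg_zero]
  obtain ⟨c, hc⟩ := hspan ⟨L n, hLn⟩
  have hc' : c • n = L n := congrArg Subtype.val hc
  have h2 := hL n n
  rw [real_inner_comm] at h2
  have h3 : inner ℝ n (L n) = 0 := by linarith
  rw [← hc', inner_smul_right] at h3
  have hLn0 : L n = 0 := by
    rcases mul_eq_zero.1 h3 with h | h
    · rw [← hc', h, zero_smul]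
    · rw [inner_self_eq_zero.1 h, map_zero]
  ext1 p
  obtain ⟨a, ha, b, hb, rfl⟩ := R.exists_add_mem_mem_orthogonal p
  obtain ⟨a', rfl⟩ := ha
  obtain ⟨d, hd⟩ := hspan ⟨b, hb⟩
  have hd' : d • n = b := congrArg Subtype.val hd
  rw [map_add, h0, ← hd', map_smul, hLn0]
  simp

theorem exists_unit_orthogonal {V : Type*} [AddCommGroup V] [Module ℝ V] [FiniteDimensional ℝ V]
    (L : G →ₗ[ℝ] V) (h : Module.finrank ℝ V < Module.finrank ℝ G) :
    ∃ b, inner ℝ b b = (1 : ℝ) ∧ L b = 0 := by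
  obtain ⟨v, hv, hv0⟩ := Submodule.exists_mem_ne_zero_of_ne_bot
    (LinearMap.ker_ne_bot_of_finrank_lt h)
  refine ⟨‖v‖⁻¹ • v, ?_, by rw [map_smul, LinearMap.mem_ker.1 hv, smul_zero]⟩
  rw [inner_smul_left, inner_smul_right, real_inner_self_eq_norm_sq]
  have := norm_ne_zero_iff.2 hv0
  simp
  field_simp

theorem re_inner_C2 (p q : C2) : (inner ℂ p q).re = inner ℝ p q := by
  simp [PiLp.inner_apply, Complex.inner]

theorem finrank_real_C2 : Module.finrank ℝ C2 = 4 := by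
  have h := finrank_real_of_complex C2
  rw [finrank_euclideanSpace_fin] at h
  exact h

/-- Every orthogonal complex structure on `ℝ⁴` is conjugate to the one of `ℂ²`. -/
theorem IsSkewIsometry.exists_linearIsometryEquiv
    {K : EuclideanSpace ℝ (Fin 4) →L[ℝ] EuclideanSpace ℝ (Fin 4)} (hK : IsSkewIsometry K) :
    ∃ φ : C2 ≃ₗᵢ[ℝ] EuclideanSpace ℝ (Fin 4), ∀ p, φ (Complex.I • p) = -K (φ p) := by
  -- The zero map imposes no condition, so this is merely a unit vector. The next choice makes `c`
  -- orthogonal to `b` and `K b`.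
  obtain ⟨b, hb, -⟩ := exists_unit_orthogonal (G := EuclideanSpace ℝ (Fin 4))
    (0 : EuclideanSpace ℝ (Fin 4) →ₗ[ℝ] (Fin 1 → ℝ)) (by simp)
  obtain ⟨c, hc, hbc⟩ := exists_unit_orthogonal (G := EuclideanSpace ℝ (Fin 4))
    ((innerSL ℝ b).toLinearMap.prod (innerSL ℝ (K b)).toLinearMap) (by simp)
  have hbc1 : inner ℝ b c = (0 : ℝ) := congrArg Prod.fst hbc
  have hbc2 : inner ℝ (K b) c = (0 : ℝ) := congrArg Prod.snd hbc
  have hbc3 : inner ℝ b (K c) = (0 : ℝ) := by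
    have := hK.inner_map_left b c; linarith
  have hself : ∀ p, inner ℝ p (K p) = (0 : ℝ) := fun p => by
    have := hK.inner_map_left p p
    rw [real_inner_comm] at this
    linarith
  -- `b, K b, c, K c` is orthonormal; the minus signs make multiplication by `i` correspond to `-K`.
  let φ : C2 →ₗ[ℝ] EuclideanSpace ℝ (Fin 4) :=
    { toFun := fun p => (p 0).re • b - (p 0).im • K b + (p 1).re • c - (p 1).im • K c
      map_add' := fun p q => by
        simp only [PiLp.add_apply, Complex.add_re, Complex.add_im]; module
      map_smul' := fun t p => by
        simp only [PiLp.smul_apply, Complex.real_smul, Complex.re_ofReal_mul,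
          Complex.im_ofReal_mul, RingHom.id_apply]; module }
  have hφ : ∀ p, φ p = (p 0).re • b - (p 0).im • K b + (p 1).re • c - (p 1).im • K c :=
    fun p => rfl
  have hnorm : ∀ p, ‖φ p‖ = ‖p‖ := by
    intro p
    rw [← sq_eq_sq₀ (norm_nonneg _) (norm_nonneg _), ← real_inner_self_eq_norm_sq,
      EuclideanSpace.norm_sq_eq, Fin.sum_univ_two, ← Complex.normSq_eq_norm_sq,
      ← Complex.normSq_eq_norm_sq, hφ]
    have s1 := real_inner_comm b (K b)
    have s2 := real_inner_comm b c
    have s3 := real_inner_comm b (K c)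
    have s4 := real_inner_comm (K b) c
    have s6 := real_inner_comm c (K c)
    simp only [inner_add_left, inner_add_right, inner_sub_left, inner_sub_right, inner_smul_left,
      inner_smul_right, hK.inner_map_map, hb, hc, hbc1, hbc2, hbc3, hself, s1, s2, s3, s4, s6,
      Complex.normSq_apply, conj_trivial]
    ring
  refine ⟨LinearIsometry.toLinearIsometryEquiv ⟨φ, hnorm⟩ (by
    rw [finrank_real_C2, finrank_euclideanSpace_fin]), fun p => ?_⟩
  change φ _ = -K (φ p)
  rw [hφ, hφ]
  simp only [map_add, map_sub, map_smul, hK.map_map, PiLp.smul_apply, smul_eq_mul, Complex.mul_re,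
    Complex.mul_im, Complex.I_re, Complex.I_im]
  module

end LinearAlgebra

/-! ### From ℝ⁴ to a CR isometric immersion into ℂ² -/

section Global

variable {M : Type*} [TopologicalSpace M] [ChartedSpace (EuclideanSpace ℝ (Fin 3)) M]
  [IsManifold (𝓡 3) ∞ M] {S : CRStructure M} {P : Pseudohermitian S}
  {f : M → EuclideanSpace ℝ (Fin 4)}

/-- `K - K'` annihilates `df` on the contact plane near `x₀`. The derivative of `(K - K') ∘ f` then
vanishes on brackets too, so `K - K'` is a skew operator that kills the hyperplane `df(T_{x₀}M)`. -/
theorem IsConjugatedBy.unique (hpos : LeviPositive P) (hiso : IsIsometricImmersion P f) {x₀ : M}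
    {K K' : EuclideanSpace ℝ (Fin 4) →L[ℝ] EuclideanSpace ℝ (Fin 4)} (hK : IsSkewIsometry K)
    (hK' : IsSkewIsometry K') (h : ∀ᶠ x in 𝓝 x₀, IsConjugatedBy S f K x)
    (h' : ∀ᶠ x in 𝓝 x₀, IsConjugatedBy S f K' x) : K = K' := by
  obtain ⟨W, hWs, hW, hxW⟩ := eventually_nhds_iff.1 (h.and h')
  obtain ⟨O, X, Y, hO, hy₀, hOt, hfr, cX, cY, hspan⟩ := exists_contact_frame hpos x₀ hW hxW
  have mf : ∀ x, MDifferentiableAt (𝓡 3) 𝓘(ℝ, EuclideanSpace ℝ (Fin 4)) f x := fun x =>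
    hiso.1.mdifferentiableAt (by simp)
  set L := K - K' with hL
  set y₀ := extChartAt (𝓡 3) x₀ x₀ with hy₀def
  set fc := f ∘ (extChartAt (𝓡 3) x₀).symm with hfc
  have cf : ContDiffOn ℝ ∞ fc O :=
    (contDiffOn_comp_chart_symm (hiso.1.contMDiffOn (s := Set.univ))).mono
      fun y hy => ⟨hOt hy, trivial⟩
  have cL : ContDiffOn ℝ ∞ (L ∘ fc) O := L.contDiff.comp_contDiffOn cf
  have dL : ∀ y ∈ O, ∀ a, fderiv ℝ (L ∘ fc) y a = L (fderiv ℝ fc y a) := by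
    intro y hy a
    rw [fderiv_comp y L.differentiableAt ((cf.contDiffAt (hO.mem_nhds hy)).differentiableAt
      (by simp)), L.fderiv]
    rfl
  have hX : ∀ y ∈ O, fderiv ℝ (L ∘ fc) y (fieldInChart X x₀ y) = 0 := by
    intro y hy
    rw [dL y hy, fderiv_comp_chart_symm_fieldInChart (hOt hy) (mf _)]
    have hm := (hfr y hy).2.mem_T10
    have e1 := (hWs _ (hfr y hy).1).1 _ hm
    have e2 := (hWs _ (hfr y hy).1).2 _ hm
    rw [reC_mkC, imC_mkC] at e1 e2
    exact (sub_eq_zero (G := EuclideanSpace ℝ (Fin 4))).2 (e1.symm.trans e2)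
  -- Use `i Z` in place of `Z`: its real part is `-Y`.
  have hY : ∀ y ∈ O, fderiv ℝ (L ∘ fc) y (fieldInChart Y x₀ y) = 0 := by
    intro y hy
    rw [dL y hy, fderiv_comp_chart_symm_fieldInChart (hOt hy) (mf _)]
    have hm := Submodule.smul_mem _ Complex.I (hfr y hy).2.mem_T10
    have e1 := (hWs _ (hfr y hy).1).1 _ hm
    have e2 := (hWs _ (hfr y hy).1).2 _ hm
    have e3 := e1.symm.trans e2
    simp only [reC_smul, reC_mkC, imC_mkC, Complex.I_re, Complex.I_im, zero_smul, one_smul,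
      zero_sub, map_neg] at e3
    exact (sub_eq_zero (G := EuclideanSpace ℝ (Fin 4))).2 (neg_injective e3)
  have hmem := hO.mem_nhds hy₀
  have hB := fderiv_bracket_eq_zero (cL.contDiffAt hmem)
    ((cX.contDiffAt hmem).differentiableAt (by simp))
    ((cY.contDiffAt hmem).differentiableAt (by simp))
    (by filter_upwards [hmem] with y hy using hX y hy)
    (by filter_upwards [hmem] with y hy using hY y hy)
  have hall : ∀ c, fderiv ℝ (L ∘ fc) y₀ c = 0 := by
    intro c
    have hle : Submodule.span ℝ {fieldInChart X x₀ y₀, fieldInChart Y x₀ y₀,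
        fderiv ℝ (fieldInChart Y x₀) y₀ (fieldInChart X x₀ y₀)
          - fderiv ℝ (fieldInChart X x₀) y₀ (fieldInChart Y x₀ y₀)}
        ≤ LinearMap.ker (fderiv ℝ (L ∘ fc) y₀).toLinearMap := by
      rw [Submodule.span_le]
      rintro _ (rfl | rfl | rfl)
      · exact hX y₀ hy₀
      · exact hY y₀ hy₀
      · exact hB
    exact hle (hspan y₀ hy₀ c)
  have hinj : Function.Injective (fderiv ℝ fc y₀).toLinearMap := by
    rw [← LinearMap.ker_eq_bot, LinearMap.ker_eq_bot']
    intro a h'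
    have h1 : fderiv ℝ fc y₀ a = 0 := h'
    rw [fderiv_comp_chart_symm (hOt hy₀) (mf _)] at h1
    have h2 := (hiso.2 _).1 (h1.trans (map_zero (dif f _)).symm)
    have h3 := congrArg (chartD x₀ _) h2
    rwa [chartD_chartSymmD (hOt hy₀), map_zero] at h3
  have := eq_zero_of_skew (L := L) (by simp) (fun p q => by
    rw [hL, sub_apply, sub_apply, inner_sub_left, inner_sub_right, hK.inner_map_left,
      hK'.inner_map_left]; ring) hinj (fun a => (dL y₀ hy₀ a).symm.trans (hall a))
  rwa [hL, sub_eq_zero] at this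

/-- The set where a given `K` works nearby is open; it is closed by local existence and uniqueness.
-/
theorem exists_isConjugatedBy [ConnectedSpace M] (hpos : LeviPositive P)
    (hiso : IsIsometricImmersion P f) (hplu : IsCRPluriharmonic S f) :
    ∃ K, IsSkewIsometry K ∧ ∀ x, IsConjugatedBy S f K x := by
  obtain ⟨x₀⟩ := (inferInstance : Nonempty M)
  obtain ⟨K, hK, hx₀⟩ := eventually_isConjugatedBy hpos hiso hplu x₀
  have hopen : ∀ K, IsOpen {x | ∀ᶠ y in 𝓝 x, IsConjugatedBy S f K y} := fun K =>
    isOpen_iff_mem_nhds.2 fun x hx => eventually_eventually_nhds.2 hx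
  have hclopen : IsClopen {x | ∀ᶠ y in 𝓝 x, IsConjugatedBy S f K y} := by
    refine ⟨⟨isOpen_iff_mem_nhds.2 fun x hx => ?_⟩, hopen K⟩
    obtain ⟨K', hK', hx'⟩ := eventually_isConjugatedBy hpos hiso hplu x
    filter_upwards [(hopen K').mem_nhds hx'] with y hy hyK
    have := IsConjugatedBy.unique hpos hiso hK hK' hyK hy
    subst this
    exact hx hx'
  have := hclopen.eq_univ ⟨x₀, hx₀⟩
  refine ⟨K, hK, fun x => ?_⟩
  have hx : x ∈ {x | ∀ᶠ y in 𝓝 x, IsConjugatedBy S f K y} := by rw [this]; trivial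
  exact hx.self_of_nhds

/-- An isometric immersion into `ℂ²` that is a CR map. -/
structure IsCRIsometricImmersion (P : Pseudohermitian S) (ψ : M → C2) : Prop where
  smooth : ContMDiff (𝓡 3) 𝓘(ℝ, C2) ∞ ψ
  injective : ∀ x, Function.Injective (dif ψ x)
  re_inner : ∀ x a b, (inner ℂ (dif ψ x a) (dif ψ x b)).re = webster P x a b
  map_imC : ∀ x, ∀ z ∈ S.T10 x, dif ψ x (imC z) = -(Complex.I • dif ψ x (reC z))

/-- `ψ` is `f` read through an isometry of ℂ² with ℝ⁴ carrying `i` to `-K`, so that `df(im Z) = K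
df(re Z)` becomes the CR equation. -/
theorem exists_isCRIsometricImmersion [ConnectedSpace M] (hpos : LeviPositive P)
    (hiso : IsIsometricImmersion P f) (hplu : IsCRPluriharmonic S f) :
    ∃ (ψ : M → C2) (φ : C2 ≃ₗᵢ[ℝ] EuclideanSpace ℝ (Fin 4)),
      IsCRIsometricImmersion P ψ ∧ ∀ x, f x = φ (ψ x) := by
  obtain ⟨K, hK, hc⟩ := exists_isConjugatedBy hpos hiso hplu
  obtain ⟨φ, hφ⟩ := hK.exists_linearIsometryEquiv
  let L : EuclideanSpace ℝ (Fin 4) →L[ℝ] C2 := φ.symm.toContinuousLinearEquiv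
  have hd : ∀ x a, dif (fun x => φ.symm (f x)) x a = φ.symm (dif f x a) := fun x a =>
    mfderiv_clm_comp L (hiso.1.mdifferentiableAt (by simp)) a
  refine ⟨fun x => φ.symm (f x), φ, ⟨?_, fun x a b hab => ?_, fun x a b => ?_, fun x z hz => ?_⟩,
    fun x => by simp⟩
  · exact L.contDiff.contMDiff.comp hiso.1
  · rw [hd, hd] at hab
    exact (hiso.2 x).1 (φ.symm.injective hab)
  · rw [re_inner_C2, hd, hd, LinearIsometryEquiv.inner_map_map]
    exact (hiso.2 x).2 a b
  · rw [hd, hd, hc x z hz]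
    apply φ.injective
    rw [map_neg, hφ, φ.apply_symm_apply, φ.apply_symm_apply, neg_neg]

end Global

/-! ### The image of the Reeb field and the coframe `η, θ` -/

section Reeb

variable {M : Type*} [TopologicalSpace M] [ChartedSpace (EuclideanSpace ℝ (Fin 3)) M]
  [IsManifold (𝓡 3) ∞ M] {S : CRStructure M} {P : Pseudohermitian S} {ψ : M → C2}

/-- The image of the Reeb field. -/
def reebMap (P : Pseudohermitian S) (ψ : M → C2) (x : M) : C2 := dif ψ x (reeb P x)

/-- The component of `dψ a` along `quatJ N`, where `N` is the image of the Reeb field. -/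
def etaOf (P : Pseudohermitian S) (ψ : M → C2) (x : M) (a : TangentSpace (𝓡 3) x) : ℂ :=
  inner ℂ (quatJ (reebMap P ψ x)) (dif ψ x a)

namespace IsCRIsometricImmersion

theorem mdifferentiableAt (h : IsCRIsometricImmersion P ψ) (x : M) :
    MDifferentiableAt (𝓡 3) 𝓘(ℝ, C2) ψ x :=
  h.smooth.mdifferentiableAt (by simp)

theorem dif_frame (h : IsCRIsometricImmersion P ψ) {x : M} {u v : TangentSpace (𝓡 3) x}
    (hf : IsFrameAt P x u v) : dif ψ x v = -(Complex.I • dif ψ x u) := by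
  simpa using h.map_imC x _ hf.mem_T10

/-- `N = dψ(T)` is Hermitian-orthogonal to `dψ(u)`: the real part is `g(u, T) = 0`, and the
imaginary part is `g(v, T) = 0` because `dψ(v) = -i dψ(u)`. -/
theorem inner_reebMap (h : IsCRIsometricImmersion P ψ) (hpos : LeviPositive P) (x : M)
    (a : TangentSpace (𝓡 3) x) : inner ℂ (reebMap P ψ x) (dif ψ x a) = (P.θ x a : ℂ) := by
  obtain ⟨u, v, hf⟩ := exists_isFrameAt hpos x
  have hw := hf.webster_basis
  have hu : inner ℂ (dif ψ x u) (reebMap P ψ x) = 0 := by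
    have e1 := (h.re_inner x u (reeb P x)).trans hw.2.2.2.1
    have e2 := (h.re_inner x v (reeb P x)).trans hw.2.2.2.2.1
    rw [h.dif_frame hf, inner_neg_left, inner_smul_left] at e2
    simp only [Complex.conj_I, neg_mul, neg_neg, Complex.mul_re, Complex.I_re, Complex.I_im] at e2
    refine Complex.ext e1 ?_
    simp only [Complex.zero_im]
    change (inner ℂ (dif ψ x u) (dif ψ x (reeb P x))).im = 0
    linarith
  have hu' : inner ℂ (reebMap P ψ x) (dif ψ x u) = 0 := by
    rw [← inner_conj_symm, hu, map_zero]
  have hv' : inner ℂ (reebMap P ψ x) (dif ψ x v) = 0 := by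
    rw [h.dif_frame hf, inner_neg_right, inner_smul_right, hu']; simp
  have hT : inner ℂ (reebMap P ψ x) (dif ψ x (reeb P x)) = 1 := by
    refine Complex.ext ((h.re_inner x _ _).trans hw.2.2.2.2.2) ?_
    have : (inner ℂ (dif ψ x (reeb P x)) (dif ψ x (reeb P x)) : ℂ).im = 0 :=
      inner_self_im (𝕜 := ℂ) (E := C2) (reebMap P ψ x)
    exact this
  obtain ⟨α, β, hab⟩ := hf.decomp hf.reeb_spec.1 a
  conv_lhs => rw [hab]
  rw [map_add, map_add, map_smul, map_smul, map_smul]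
  rw [inner_add_right, inner_add_right, inner_smul_right_eq_smul, inner_smul_right_eq_smul,
    inner_smul_right_eq_smul]
  rw [hu', hv', hT]
  simp

theorem norm_reebMap (h : IsCRIsometricImmersion P ψ) (hpos : LeviPositive P) (x : M) :
    ‖reebMap P ψ x‖ = 1 := by
  obtain ⟨u, v, hf⟩ := exists_isFrameAt hpos x
  have h1 := h.inner_reebMap hpos x (reeb P x)
  rw [hf.reeb_spec.1] at h1
  have h2 : ‖reebMap P ψ x‖ ^ 2 = 1 :=
    (inner_self_eq_norm_sq (𝕜 := ℂ) (reebMap P ψ x)).symm.trans (congrArg Complex.re h1)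
  exact (pow_eq_one_iff_of_nonneg (norm_nonneg _) two_ne_zero).1 h2

theorem dif_eq (h : IsCRIsometricImmersion P ψ) (hpos : LeviPositive P) (x : M)
    (a : TangentSpace (𝓡 3) x) :
    dif ψ x a = etaOf P ψ x a • quatJ (reebMap P ψ x) + (P.θ x a : ℂ) • reebMap P ψ x := by
  rw [← h.inner_reebMap hpos]
  exact quatJ_decomp (h.norm_reebMap hpos x) _

theorem inner_dif (h : IsCRIsometricImmersion P ψ) (hpos : LeviPositive P) (x : M)
    (a b : TangentSpace (𝓡 3) x) :
    inner ℂ (dif ψ x a) (dif ψ x b)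
      = (starRingEnd ℂ) (etaOf P ψ x a) * etaOf P ψ x b + (P.θ x a * P.θ x b : ℝ) := by
  rw [inner_eq_of_norm_one (h.norm_reebMap hpos x), h.inner_reebMap hpos, h.inner_reebMap hpos,
    Complex.conj_ofReal, Complex.ofReal_mul]
  rfl

theorem etaOf_add (a b : TangentSpace (𝓡 3) (x : M)) :
    etaOf P ψ x (a + b) = etaOf P ψ x a + etaOf P ψ x b := by
  rw [etaOf, map_add]; exact inner_add_right _ _ _

theorem etaOf_smul (t : ℝ) (a : TangentSpace (𝓡 3) (x : M)) :
    etaOf P ψ x (t • a) = t * etaOf P ψ x a := by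
  rw [etaOf, map_smul]
  exact (inner_smul_right_eq_smul _ _ _).trans (Complex.real_smul)

theorem etaOf_reeb (x : M) : etaOf P ψ x (reeb P x) = 0 := inner_quatJ_self _

theorem etaOf_frame (h : IsCRIsometricImmersion P ψ) {x : M} {u v : TangentSpace (𝓡 3) x}
    (hf : IsFrameAt P x u v) : etaOf P ψ x v = -(Complex.I * etaOf P ψ x u) := by
  rw [etaOf, h.dif_frame hf, inner_neg_right, inner_smul_right]
  rfl

/-- Both sides are alternating and kill `T`. On `(u, v)` both equal `g(u, u) = |η(u)|²`, because
`η(v) = -i η(u)`. -/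
theorem dForm_eq_etaOf (h : IsCRIsometricImmersion P ψ) (hpos : LeviPositive P) (x : M)
    (a b : TangentSpace (𝓡 3) x) :
    dForm P.θ x a b = (etaOf P ψ x a * (starRingEnd ℂ) (etaOf P ψ x b)).im := by
  obtain ⟨u, v, hf⟩ := exists_isFrameAt hpos x
  have hd : dForm P.θ x u v = Complex.normSq (etaOf P ψ x u) := by
    have e := (h.re_inner x u u).trans hf.webster_basis.1
    rw [h.inner_dif hpos, hf.theta_u] at e
    rw [← e, Complex.normSq_apply]
    simp
  obtain ⟨α, β, hab⟩ := hf.decomp hf.reeb_spec.1 a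
  obtain ⟨α', β', hab'⟩ := hf.decomp hf.reeb_spec.1 b
  have hT : ∀ c, dForm P.θ x c (reeb P x) = 0 := fun c => by
    rw [dForm_swap, hf.reeb_spec.2, neg_zero]
  rw [hab, hab']
  simp only [etaOf_add, etaOf_smul, etaOf_reeb, h.etaOf_frame hf, dForm_add_left, dForm_smul_left,
    dForm_add_right, dForm_smul_right, dForm_self, hf.reeb_spec.2, hT, dForm_swap P.θ x v u, hd,
    Complex.normSq_apply]
  simp
  ring

theorem etaOf_theta_bijective (h : IsCRIsometricImmersion P ψ) (hpos : LeviPositive P) (x : M) :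
    Function.Bijective fun a : TangentSpace (𝓡 3) x => (etaOf P ψ x a, P.θ x a) := by
  let L : TangentSpace (𝓡 3) x →ₗ[ℝ] ℂ × ℝ :=
    { toFun := fun a => (etaOf P ψ x a, P.θ x a)
      map_add' := fun a b => by simp [etaOf_add]
      map_smul' := fun t a => by simp [etaOf_smul] }
  have hinj : Function.Injective L := by
    rw [← LinearMap.ker_eq_bot, LinearMap.ker_eq_bot']
    intro a ha
    have h1 : etaOf P ψ x a = 0 := congrArg Prod.fst ha
    have h2 : P.θ x a = 0 := congrArg Prod.snd ha
    have h3 := h.dif_eq hpos x a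
    rw [h1, h2] at h3
    simp only [zero_smul, Complex.ofReal_zero, add_zero] at h3
    exact h.injective x (h3.trans (map_zero (dif ψ x)).symm)
  have hfin : Module.finrank ℝ (TangentSpace (𝓡 3) x) = Module.finrank ℝ (ℂ × ℝ) := by
    rw [Module.finrank_prod, Complex.finrank_real_complex, Module.finrank_self]
    exact finrank_euclideanSpace_fin
  have : FiniteDimensional ℝ (TangentSpace (𝓡 3) x) :=
    inferInstanceAs (FiniteDimensional ℝ (EuclideanSpace ℝ (Fin 3)))
  exact ⟨hinj, (LinearMap.injective_iff_surjective_of_finrank_eq_finrank hfin).1 hinj⟩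

end IsCRIsometricImmersion

end Reeb

/-! ### Smoothness of the Reeb field -/

section SmoothReeb

variable {E : Type*} [NormedAddCommGroup E] [NormedSpace ℝ E] [FiniteDimensional ℝ E]

/-- A vector field that is dual to a smooth form with respect to the metric induced by a smooth
immersion is smooth. -/
theorem contDiffOn_of_gram {O : Set E} (hO : IsOpen O) {f : E → C2} (hf : ContDiffOn ℝ ∞ f O)
    (hinj : ∀ y ∈ O, Function.Injective (fderiv ℝ f y)) {θ : E → E →L[ℝ] ℝ}
    (hθ : ContDiffOn ℝ ∞ θ O) {R : E → E}
    (hR : ∀ y ∈ O, ∀ a, (inner ℂ (fderiv ℝ f y (R y)) (fderiv ℝ f y a)).re = θ y a) :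
    ContDiffOn ℝ ∞ R O := by
  have : CompleteSpace E := FiniteDimensional.complete ℝ E
  let B : C2 →L[ℝ] C2 →L[ℝ] ℝ := innerSL ℝ
  let Γ : E → E →L[ℝ] E →L[ℝ] ℝ := fun y => B.bilinearComp (fderiv ℝ f y) (fderiv ℝ f y)
  have hΓ : ∀ y a b, Γ y a b = (inner ℂ (fderiv ℝ f y a) (fderiv ℝ f y b)).re := fun y a b =>
    (re_inner_C2 _ _).symm
  have cf : ∀ a, ContDiffOn ℝ ∞ (fun y => fderiv ℝ f y a) O := fun a y hy =>
    (contDiffAt_fderiv_apply (hf.contDiffAt (hO.mem_nhds hy)) a).contDiffWithinAt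
  have cΓ : ContDiffOn ℝ ∞ Γ O := by
    rw [contDiffOn_clm_apply]
    intro a
    rw [contDiffOn_clm_apply]
    intro b
    exact (cf a).inner ℝ (cf b)
  intro y hy
  have hinjΓ : Function.Injective (Γ y).toLinearMap := by
    rw [← LinearMap.ker_eq_bot, LinearMap.ker_eq_bot']
    intro a ha
    have h1 : Γ y a = 0 := ha
    have h2 : Γ y a a = 0 := by rw [h1]; rfl
    have h3 : inner ℝ (fderiv ℝ f y a) (fderiv ℝ f y a) = (0 : ℝ) := h2
    exact hinj y hy ((inner_self_eq_zero.1 h3).trans (map_zero _).symm)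
  have hfin : Module.finrank ℝ E = Module.finrank ℝ (E →L[ℝ] ℝ) := by
    rw [← (LinearMap.toContinuousLinearMap (𝕜 := ℝ) (E := E) (F' := ℝ)).finrank_eq]
    exact (Subspace.dual_finrank_eq (K := ℝ) (V := E)).symm
  let e : E ≃L[ℝ] (E →L[ℝ] ℝ) :=
    (LinearEquiv.ofInjectiveOfFinrankEq (Γ y).toLinearMap hinjΓ hfin).toContinuousLinearEquiv
  have he : (e : E →L[ℝ] (E →L[ℝ] ℝ)) = Γ y := by
    ext a b; rfl
  have hopen : ∀ᶠ z in 𝓝 y, ∃ e' : E ≃L[ℝ] (E →L[ℝ] ℝ), (e' : E →L[ℝ] (E →L[ℝ] ℝ)) = Γ z := by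
    have := (cΓ.contDiffAt (hO.mem_nhds hy)).continuousAt.eventually
      (he ▸ ContinuousLinearEquiv.nhds e)
    exact this
  -- The dual field is the inverse Gram operator applied to `θ`, and inversion is smooth at
  -- invertible operators.
  have c1 : ContDiffAt ℝ ∞ (fun z => (Γ z).inverse (θ z)) y := by
    refine ContDiffAt.clm_apply ?_ (hθ.contDiffAt (hO.mem_nhds hy))
    have := contDiffAt_map_inverse (𝕜 := ℝ) (n := ∞) e
    rw [he] at this
    exact this.comp y (cΓ.contDiffAt (hO.mem_nhds hy))
  refine (c1.congr_of_eventuallyEq ?_).contDiffWithinAt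
  filter_upwards [hopen, hO.mem_nhds hy] with z hz hzO
  have : θ z = Γ z (R z) := by
    ext a
    rw [hΓ, hR z hzO]
  rw [this, inverse_apply_apply hz]

end SmoothReeb

section ChartCenter

variable {M : Type*} [TopologicalSpace M] [ChartedSpace (EuclideanSpace ℝ (Fin 3)) M]

theorem fderiv_comp_chart_symm_self {F : Type*} [NormedAddCommGroup F] [NormedSpace ℝ F]
    {h : M → F} {x : M}
    (hh : DifferentiableAt ℝ (h ∘ (extChartAt (𝓡 3) x).symm) (extChartAt (𝓡 3) x x))
    (c : TangentSpace (𝓡 3) x) :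
    fderiv ℝ (h ∘ (extChartAt (𝓡 3) x).symm) (extChartAt (𝓡 3) x x) (chartD x x c)
      = dif h x c := by
  have e : h =ᶠ[𝓝 x] (h ∘ (extChartAt (𝓡 3) x).symm) ∘ extChartAt (𝓡 3) x := by
    filter_upwards [extChartAt_source_mem_nhds (I := 𝓡 3) x] with z hz
    simp only [Function.comp_apply]
    rw [(extChartAt (𝓡 3) x).left_inv hz]
  rw [dif, e.mfderiv_eq, mfderiv_comp x hh.mdifferentiableAt
    ((contMDiffAt_extChartAt (n := ∞)).mdifferentiableAt (by simp)), mfderiv_eq_fderiv]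
  rfl

end ChartCenter

/-! ### The invariant `q` of a CR isometric immersion -/

section Adapted

variable {M : Type*} [TopologicalSpace M] [ChartedSpace (EuclideanSpace ℝ (Fin 3)) M]
  [IsManifold (𝓡 3) ∞ M] {S : CRStructure M} {P : Pseudohermitian S} {ψ : M → C2}

/-- The derivative of the Reeb direction is `((-i/2) η + q η̄) e + i (2|q|² - 1/2) θ N`. -/
def HasInvariant (P : Pseudohermitian S) (ψ : M → C2) (q : ℂ) (x : M) : Prop :=
  ∀ a : TangentSpace (𝓡 3) x, dif (reebMap P ψ) x a
    = (-(Complex.I / 2) * etaOf P ψ x a + q * (starRingEnd ℂ) (etaOf P ψ x a))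
        • quatJ (reebMap P ψ x)
      + (Complex.I * ((2 * Complex.normSq q - 1 / 2) * P.θ x a : ℝ)) • reebMap P ψ x

namespace IsCRIsometricImmersion

theorem fderiv_chart (h : IsCRIsometricImmersion P ψ) {x₀ : M} {y : EuclideanSpace ℝ (Fin 3)}
    (hy : y ∈ (extChartAt (𝓡 3) x₀).target) (a : EuclideanSpace ℝ (Fin 3)) :
    fderiv ℝ (ψ ∘ (extChartAt (𝓡 3) x₀).symm) y a
      = dif ψ ((extChartAt (𝓡 3) x₀).symm y) (chartSymmD x₀ y a) :=
  fderiv_comp_chart_symm hy (h.mdifferentiableAt _) a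

theorem contDiffOn_chart (h : IsCRIsometricImmersion P ψ) (x₀ : M) :
    ContDiffOn ℝ ∞ (ψ ∘ (extChartAt (𝓡 3) x₀).symm) (extChartAt (𝓡 3) x₀).target :=
  (contDiffOn_comp_chart_symm (h.smooth.contMDiffOn (s := Set.univ))).mono
    fun _ hy => ⟨hy, trivial⟩

/-- `reeb` is selected by `epsilon`, so its smoothness needs a proof: it is the dual of `θ` for the
metric induced by `ψ`, to which `contDiffOn_of_gram` applies. -/
theorem contDiffOn_reebMap_chart (h : IsCRIsometricImmersion P ψ) (hpos : LeviPositive P)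
    (x₀ : M) :
    ContDiffOn ℝ ∞ (reebMap P ψ ∘ (extChartAt (𝓡 3) x₀).symm) (extChartAt (𝓡 3) x₀).target := by
  have hO := isOpen_extChartAt_target (I := 𝓡 3) x₀
  have hfR : ∀ y ∈ (extChartAt (𝓡 3) x₀).target,
      fderiv ℝ (ψ ∘ (extChartAt (𝓡 3) x₀).symm) y (fieldInChart (reeb P) x₀ y)
        = reebMap P ψ ((extChartAt (𝓡 3) x₀).symm y) := fun y hy =>
    fderiv_comp_chart_symm_fieldInChart hy (h.mdifferentiableAt _) _
  have cR : ContDiffOn ℝ ∞ (fieldInChart (reeb P) x₀) (extChartAt (𝓡 3) x₀).target := by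
    refine contDiffOn_of_gram hO (h.contDiffOn_chart x₀) (fun y hy a b hab => ?_)
      (contDiffOn_formInChart P.smooth x₀) (fun y hy a => ?_)
    · rw [h.fderiv_chart hy, h.fderiv_chart hy] at hab
      have := congrArg (chartD x₀ _) (h.injective _ hab)
      rwa [chartD_chartSymmD hy, chartD_chartSymmD hy] at this
    · rw [hfR y hy, h.fderiv_chart hy, h.inner_reebMap hpos]
      rfl
  have cF := (h.contDiffOn_chart x₀).fderiv_of_isOpen (m := ∞) hO (by norm_cast)
  refine (cF.clm_apply cR).congr fun y hy => ?_
  exact (hfR y hy).symm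

theorem contMDiff_reebMap (h : IsCRIsometricImmersion P ψ) (hpos : LeviPositive P) :
    ContMDiff (𝓡 3) 𝓘(ℝ, C2) ∞ (reebMap P ψ) := by
  intro x₀
  have h1 : ContMDiffAt 𝓘(ℝ, EuclideanSpace ℝ (Fin 3)) 𝓘(ℝ, C2) ∞
      (reebMap P ψ ∘ (extChartAt (𝓡 3) x₀).symm) (extChartAt (𝓡 3) x₀ x₀) :=
    ((h.contDiffOn_reebMap_chart hpos x₀).contDiffAt
      ((isOpen_extChartAt_target x₀).mem_nhds (mem_extChartAt_target x₀))).contMDiffAt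
  refine (h1.comp x₀ contMDiffAt_extChartAt).congr_of_eventuallyEq ?_
  filter_upwards [extChartAt_source_mem_nhds (I := 𝓡 3) x₀] with x hx
  simp only [Function.comp_apply]
  rw [(extChartAt (𝓡 3) x₀).left_inv hx]

theorem fderiv_reebMap_chart (h : IsCRIsometricImmersion P ψ) (hpos : LeviPositive P) {x₀ : M}
    {y : EuclideanSpace ℝ (Fin 3)} (hy : y ∈ (extChartAt (𝓡 3) x₀).target)
    (a : EuclideanSpace ℝ (Fin 3)) :
    fderiv ℝ (reebMap P ψ ∘ (extChartAt (𝓡 3) x₀).symm) y a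
      = dif (reebMap P ψ) ((extChartAt (𝓡 3) x₀).symm y) (chartSymmD x₀ y a) :=
  fderiv_comp_chart_symm hy ((h.contMDiff_reebMap hpos).mdifferentiableAt (by simp)) a

/-- `θ = Re⟨N, dψ⟩`; differentiate in the chart centred at `x` and antisymmetrize, so that the
second derivatives of `ψ` cancel. -/
theorem dForm_eq_dif (h : IsCRIsometricImmersion P ψ) (hpos : LeviPositive P) (x : M)
    (a b : TangentSpace (𝓡 3) x) :
    dForm P.θ x a b = (inner ℂ (dif (reebMap P ψ) x a) (dif ψ x b)).re
      - (inner ℂ (dif (reebMap P ψ) x b) (dif ψ x a)).re := by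
  set y₀ := extChartAt (𝓡 3) x x with hy₀
  have hmem : y₀ ∈ (extChartAt (𝓡 3) x).target := mem_extChartAt_target x
  have hn := (isOpen_extChartAt_target (I := 𝓡 3) x).mem_nhds hmem
  set ψc := ψ ∘ (extChartAt (𝓡 3) x).symm with hψc
  set Nc := reebMap P ψ ∘ (extChartAt (𝓡 3) x).symm with hNc
  have cψ : ContDiffAt ℝ ∞ ψc y₀ := (h.contDiffOn_chart x).contDiffAt hn
  have cN : ContDiffAt ℝ ∞ Nc y₀ := (h.contDiffOn_reebMap_chart hpos x).contDiffAt hn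
  have cθ : ContDiffAt ℝ ∞ (formInChart P.θ x) y₀ :=
    (contDiffOn_formInChart P.smooth x).contDiffAt hn
  have key : ∀ w a, fderiv ℝ (formInChart P.θ x) y₀ w a
      = (inner ℂ (fderiv ℝ Nc y₀ w) (fderiv ℝ ψc y₀ a)).re
        + (inner ℂ (Nc y₀) (fderiv ℝ (fun z => fderiv ℝ ψc z a) y₀ w)).re := by
    intro w a
    have e : (fun y => formInChart P.θ x y a)
        =ᶠ[𝓝 y₀] fun y => (inner ℂ (Nc y) (fderiv ℝ ψc y a)).re := by
      filter_upwards [hn] with y hy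
      rw [hψc, h.fderiv_chart hy, hNc, Function.comp_apply, h.inner_reebMap hpos]
      rfl
    have da := (contDiffAt_fderiv_apply cψ a).differentiableAt (by simp : (∞ : ℕ∞ω) ≠ 0)
    have dN := cN.differentiableAt (by simp : (∞ : ℕ∞ω) ≠ 0)
    have e1 := e.fderiv_eq (𝕜 := ℝ)
    rw [fderiv_clm_apply (cθ.differentiableAt (by simp)) (differentiableAt_const a)] at e1
    have e2 := congrArg (fun L : EuclideanSpace ℝ (Fin 3) →L[ℝ] ℝ => L w) e1
    rw [fderiv_re_apply (dN.inner ℂ da), fderiv_innerC_apply dN da, Complex.add_re] at e2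
    rw [← e2]
    simp
  have hA : ∀ c : TangentSpace (𝓡 3) x, fderiv ℝ ψc y₀ (chartD x x c) = dif ψ x c :=
    fderiv_comp_chart_symm_self (cψ.differentiableAt (by simp))
  have hB : ∀ c : TangentSpace (𝓡 3) x, fderiv ℝ Nc y₀ (chartD x x c) = dif (reebMap P ψ) x c :=
    fderiv_comp_chart_symm_self (cN.differentiableAt (by simp))
  have hsym := fderiv_fderiv_comm cψ (chartD x x a) (chartD x x b)
  have k1 := key (chartD x x a) (chartD x x b)
  have k2 := key (chartD x x b) (chartD x x a)
  rw [hsym, hA, hB] at k1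
  rw [hA, hB] at k2
  change fderiv ℝ (formInChart P.θ x) y₀ (chartD x x a) (chartD x x b)
    - fderiv ℝ (formInChart P.θ x) y₀ (chartD x x b) (chartD x x a) = _
  rw [k1, k2]
  ring

/-- The contact condition equates the two expressions of `dθ` given by `dForm_eq_dif` and
`dForm_eq_etaOf`. -/
theorem isAdapted (h : IsCRIsometricImmersion P ψ) (hpos : LeviPositive P) (x₀ : M) :
    IsAdapted (extChartAt (𝓡 3) x₀).target (ψ ∘ (extChartAt (𝓡 3) x₀).symm)
      (reebMap P ψ ∘ (extChartAt (𝓡 3) x₀).symm) := by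
  have hη : ∀ y ∈ (extChartAt (𝓡 3) x₀).target, ∀ a,
      etaForm (ψ ∘ (extChartAt (𝓡 3) x₀).symm) (reebMap P ψ ∘ (extChartAt (𝓡 3) x₀).symm) a y
        = etaOf P ψ _ (chartSymmD x₀ y a) := fun y hy a => by
    rw [etaForm, h.fderiv_chart hy]; rfl
  have hθ : ∀ y ∈ (extChartAt (𝓡 3) x₀).target, ∀ a,
      inner ℂ ((reebMap P ψ ∘ (extChartAt (𝓡 3) x₀).symm) y)
        (fderiv ℝ (ψ ∘ (extChartAt (𝓡 3) x₀).symm) y a)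
        = (P.θ _ (chartSymmD x₀ y a) : ℂ) := fun y hy a => by
    rw [h.fderiv_chart hy]; exact h.inner_reebMap hpos _ _
  refine ⟨isOpen_extChartAt_target x₀, h.contDiffOn_chart x₀, h.contDiffOn_reebMap_chart hpos x₀,
    fun y _ => h.norm_reebMap hpos _, fun y hy a => ?_, fun y hy a b => ?_, fun y hy => ?_⟩
  · rw [hθ y hy, Complex.ofReal_im]
  · rw [hη y hy, hη y hy, ← h.dForm_eq_etaOf hpos, h.dForm_eq_dif hpos, h.fderiv_chart hy,
      h.fderiv_chart hy, h.fderiv_reebMap_chart hpos hy, h.fderiv_reebMap_chart hpos hy]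
  · have e : (fun a => (etaForm (ψ ∘ (extChartAt (𝓡 3) x₀).symm)
        (reebMap P ψ ∘ (extChartAt (𝓡 3) x₀).symm) a y,
        thetaForm (ψ ∘ (extChartAt (𝓡 3) x₀).symm)
        (reebMap P ψ ∘ (extChartAt (𝓡 3) x₀).symm) a y))
        = (fun a => (etaOf P ψ ((extChartAt (𝓡 3) x₀).symm y) a, P.θ _ a)) ∘ chartSymmD x₀ y := by
      funext a
      simp only [Function.comp_apply]
      rw [hη y hy, thetaForm, hθ y hy, Complex.ofReal_re]
    rw [e]
    refine (h.etaOf_theta_bijective hpos _).comp ⟨fun a b hab => ?_, fun w => ?_⟩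
    · have := congrArg (chartD x₀ _) hab
      rwa [chartD_chartSymmD hy, chartD_chartSymmD hy] at this
    · exact ⟨_, chartSymmD_chartD hy w⟩

theorem eventually_hasInvariant (h : IsCRIsometricImmersion P ψ) (hpos : LeviPositive P) (x₀ : M) :
    ∃ q : ℂ, (q = 0 ∨ Complex.normSq q = 1 / 4) ∧ ∀ᶠ x in 𝓝 x₀, HasInvariant P ψ q x := by
  have hA := h.isAdapted hpos x₀
  obtain ⟨q, hq, he⟩ := hA.eventually_const (mem_extChartAt_target x₀)
  refine ⟨q, hq, eventually_of_chart ?_⟩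
  filter_upwards [he, (isOpen_extChartAt_target (I := 𝓡 3) x₀).mem_nhds
    (mem_extChartAt_target x₀)] with y hy hyt a
  obtain ⟨h1, h2⟩ := hy (chartD x₀ _ a)
  have hNN := hA.inner_N_N hyt (chartD x₀ _ a)
  have hd := quatJ_decomp (h.norm_reebMap hpos ((extChartAt (𝓡 3) x₀).symm y))
    (dif (reebMap P ψ) _ a)
  have e1 := h.fderiv_reebMap_chart hpos hyt (chartD x₀ _ a)
  have e2 := h.fderiv_chart hyt (chartD x₀ _ a)
  rw [chartSymmD_chartD hyt] at e1 e2
  rw [h2] at hNN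
  rw [kappaForm, etaForm] at h1
  rw [thetaForm] at hNN
  rw [e1, e2] at h1
  rw [e1, e2] at hNN
  simp only [Function.comp_apply] at h1 hNN
  rw [h.inner_reebMap hpos, Complex.ofReal_re] at hNN
  rw [hd, h1, hNN]
  rfl

theorem exists_hasInvariant [ConnectedSpace M] (h : IsCRIsometricImmersion P ψ)
    (hpos : LeviPositive P) :
    ∃ q : ℂ, (q = 0 ∨ Complex.normSq q = 1 / 4) ∧ ∀ x, HasInvariant P ψ q x := by
  -- `q` is read off on a vector with `η = 1` and `θ = 0`; uniqueness makes the set where a given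
  -- `q` works nearby closed as well as open.
  have huniq : ∀ q q' x, HasInvariant P ψ q x → HasInvariant P ψ q' x → q = q' := by
    intro q q' x hq hq'
    obtain ⟨a, ha⟩ := (h.etaOf_theta_bijective hpos x).2 (1, 0)
    have ha1 : etaOf P ψ x a = 1 := congrArg Prod.fst ha
    have ha2 : P.θ x a = 0 := congrArg Prod.snd ha
    have e := congrArg (inner ℂ (quatJ (reebMap P ψ x))) ((hq a).symm.trans (hq' a))
    have hn : inner ℂ (quatJ (reebMap P ψ x)) (quatJ (reebMap P ψ x)) = 1 := by
      rw [inner_quatJ_quatJ, inner_self_of_norm_one (h.norm_reebMap hpos x), map_one]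
    simp only [ha1, ha2, inner_add_right, inner_smul_right, hn] at e
    simpa using e
  obtain ⟨x₀⟩ := (inferInstance : Nonempty M)
  obtain ⟨q, hq, hx₀⟩ := h.eventually_hasInvariant hpos x₀
  have hclopen : IsClopen {x | ∀ᶠ y in 𝓝 x, HasInvariant P ψ q y} := by
    have hopen : ∀ q, IsOpen {x | ∀ᶠ y in 𝓝 x, HasInvariant P ψ q y} := fun q =>
      isOpen_iff_mem_nhds.2 fun x hx => eventually_eventually_nhds.2 hx
    refine ⟨⟨isOpen_iff_mem_nhds.2 fun x hx => ?_⟩, hopen q⟩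
    obtain ⟨q', -, hx'⟩ := h.eventually_hasInvariant hpos x
    filter_upwards [(hopen q').mem_nhds hx'] with y hy hyq
    have := huniq q q' y hyq.self_of_nhds hy.self_of_nhds
    subst this
    exact hx hx'
  have := hclopen.eq_univ ⟨x₀, hx₀⟩
  refine ⟨q, hq, fun x => ?_⟩
  have hx : x ∈ {x | ∀ᶠ y in 𝓝 x, HasInvariant P ψ q y} := by rw [this]; trivial
  exact hx.self_of_nhds

end IsCRIsometricImmersion

end Adapted

/-! ### The sphere and the cylinder from the invariant -/

section Models

variable {M : Type*} [TopologicalSpace M] [ChartedSpace (EuclideanSpace ℝ (Fin 3)) M]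

theorem dif_add {F : Type*} [NormedAddCommGroup F] [NormedSpace ℝ F] {g h : M → F} {x : M}
    (hg : MDifferentiableAt (𝓡 3) 𝓘(ℝ, F) g x) (hh : MDifferentiableAt (𝓡 3) 𝓘(ℝ, F) h x)
    (w : TangentSpace (𝓡 3) x) :
    dif (fun y => g y + h y) x w = dif g x w + dif h x w :=
  congrArg (fun T : TangentSpace (𝓡 3) x →L[ℝ] F => T w) (mfderiv_add hg hh)

theorem dif_sub_const {F : Type*} [NormedAddCommGroup F] [NormedSpace ℝ F] {g : M → F} {x : M}
    (hg : MDifferentiableAt (𝓡 3) 𝓘(ℝ, F) g x) (c : F) (w : TangentSpace (𝓡 3) x) :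
    dif (fun y => g y - c) x w = dif g x w := by
  have := (mfderiv_sub hg (mdifferentiableAt_const (c := c)))
  have h2 := congrArg (fun T : TangentSpace (𝓡 3) x →L[ℝ] F => T w) this
  refine h2.trans ?_
  rw [mfderiv_const]
  exact sub_zero _

variable [IsManifold (𝓡 3) ∞ M] {S : CRStructure M} {P : Pseudohermitian S} {ψ : M → C2}

/-- A real function with derivative `ρ B`, where `B` has derivative `-ρ A`, and both vanish at some
point, is zero. -/
theorem eq_zero_of_rotation [ConnectedSpace M] {A B : M → ℝ}
    (hA : ContMDiff (𝓡 3) 𝓘(ℝ, ℝ) ∞ A) (hB : ContMDiff (𝓡 3) 𝓘(ℝ, ℝ) ∞ B)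
    {ρ : ∀ x : M, TangentSpace (𝓡 3) x → ℝ} (dA : ∀ x a, dif A x a = ρ x a * B x)
    (dB : ∀ x a, dif B x a = -(ρ x a * A x)) {x₀ : M} (hA0 : A x₀ = 0) (hB0 : B x₀ = 0) (x : M) :
    A x = 0 := by
  -- The sum `A² + B²` is invariant under rotation, hence constant.
  have hc : ContMDiff (𝓡 3) 𝓘(ℝ, ℝ) ∞ fun x => A x * A x + B x * B x := (hA.mul hA).add (hB.mul hB)
  have h0 := eq_of_mfderiv_eq_zero hc (fun x a => by
    have mA := hA.mdifferentiableAt (x := x) (by simp)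
    have mB := hB.mdifferentiableAt (x := x) (by simp)
    have := dif_add (mA.mul mA) (mB.mul mB) a
    have e1 := congrArg (fun T : TangentSpace (𝓡 3) x →L[ℝ] ℝ => T a)
      (mA.hasMFDerivAt.mul mA.hasMFDerivAt).mfderiv
    have e2 := congrArg (fun T : TangentSpace (𝓡 3) x →L[ℝ] ℝ => T a)
      (mB.hasMFDerivAt.mul mB.hasMFDerivAt).mfderiv
    refine this.trans ?_
    refine (congrArg₂ (· + ·) e1 e2).trans ?_
    change (A x * dif A x a + A x * dif A x a) + (B x * dif B x a + B x * dif B x a) = 0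
    rw [dA, dB]
    ring) x x₀
  simp only [hA0, hB0, mul_zero, add_zero] at h0
  nlinarith [mul_self_nonneg (A x), mul_self_nonneg (B x)]

namespace IsCRIsometricImmersion

/-- Composition with a holomorphic motion of `ℂ²`. -/
theorem comp_motion (h : IsCRIsometricImmersion P ψ) (U : C2 ≃ₗᵢ[ℂ] C2) (p : C2) :
    IsCRIsometricImmersion P fun x => U (ψ x - p) := by
  let L : C2 →L[ℝ] C2 := (U.toContinuousLinearEquiv : C2 →L[ℂ] C2).restrictScalars ℝ
  have hs : ContMDiff (𝓡 3) 𝓘(ℝ, C2) ∞ fun x => ψ x - p := h.smooth.sub contMDiff_const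
  have hd : ∀ x a, dif (fun x => U (ψ x - p)) x a = U (dif ψ x a) := fun x a =>
    (mfderiv_clm_comp L (hs.mdifferentiableAt (by simp)) a).trans
      (congrArg U (dif_sub_const (h.mdifferentiableAt x) p a))
  refine ⟨L.contDiff.contMDiff.comp hs, fun x a b hab => ?_, fun x a b => ?_, fun x z hz => ?_⟩
  · rw [hd, hd] at hab
    exact h.injective x (U.injective hab)
  · rw [hd, hd]
    exact (congrArg Complex.re (U.inner_map_map _ _)).trans (h.re_inner x a b)
  · rw [hd, hd, h.map_imC x z hz, map_neg, map_smul]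

/-- For `q = 0` the invariant says `dN = -(i/2) dψ`, so `N + (i/2) ψ` is a constant `c`. Then `ψ +
2ic = 2iN` has norm 2. -/
theorem exists_center [ConnectedSpace M] (h : IsCRIsometricImmersion P ψ) (hpos : LeviPositive P)
    (hq : ∀ x, HasInvariant P ψ 0 x) : ∃ p, ∀ x, ‖ψ x - p‖ = 2 := by
  let L : C2 →L[ℝ] C2 := (((Complex.I / 2) • ContinuousLinearMap.id ℂ C2 : C2 →L[ℂ] C2)).restrictScalars ℝ
  have hL : ∀ p, L p = (Complex.I / 2) • p := fun p => rfl
  have hN := h.contMDiff_reebMap hpos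
  have hs : ContMDiff (𝓡 3) 𝓘(ℝ, C2) ∞ fun x => reebMap P ψ x + L (ψ x) :=
    hN.add (L.contDiff.contMDiff.comp h.smooth)
  obtain ⟨x₀⟩ := (inferInstance : Nonempty M)
  have hc := fun x => eq_of_mfderiv_eq_zero hs (fun x a => by
    refine (dif_add (hN.mdifferentiableAt (by simp))
      ((L.contDiff.contMDiff.comp h.smooth).mdifferentiableAt (by simp)) a).trans ?_
    refine (congrArg₂ (fun p q : C2 => p + q) (hq x a)
      (mfderiv_clm_comp L (h.mdifferentiableAt x) a)).trans ?_
    rw [hL, h.dif_eq hpos x a]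
    simp only [map_zero, mul_zero, zero_mul, add_zero, zero_sub, smul_add, smul_smul]
    rw [add_add_add_comm, ← add_smul, ← add_smul]
    push_cast
    ring_nf
    simp
    rfl) x x₀
  set c := reebMap P ψ x₀ + L (ψ x₀) with hcdef
  refine ⟨-(2 * Complex.I) • c, fun x => ?_⟩
  have e : ψ x - -(2 * Complex.I) • c = (2 * Complex.I) • reebMap P ψ x := by
    rw [← hc x, hL, smul_add, smul_smul]
    rw [show -(2 * Complex.I) * (Complex.I / 2) = 1 by
      linear_combination (-1 : ℂ) * Complex.I_mul_I]
    module
  rw [e, norm_smul, h.norm_reebMap hpos]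
  simp

end IsCRIsometricImmersion

/-- The unitary map with rows `⟨v, ·⟩`, `⟨w, ·⟩`. -/
theorem exists_unitary {v w : C2} (hv : ‖v‖ = 1) (hw : ‖w‖ = 1) (hvw : inner ℂ v w = 0) :
    ∃ U : C2 ≃ₗᵢ[ℂ] C2, ∀ p, U p 0 = inner ℂ v p ∧ U p 1 = inner ℂ w p := by
  have hli : Orthonormal ℂ ![v, w] := by
    have hwv : inner ℂ w v = 0 := by rw [← inner_conj_symm, hvw, map_zero]
    constructor
    · intro i; fin_cases i
      · exact hv
      · exact hw
    · intro i j hij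
      fin_cases i <;> fin_cases j
      · exact absurd rfl hij
      · exact hvw
      · exact hwv
      · exact absurd rfl hij
  let b : OrthonormalBasis (Fin 2) ℂ C2 := OrthonormalBasis.mk hli (by
    rw [hli.linearIndependent.span_eq_top_of_card_eq_finrank (by simp)])
  have hb : ⇑b = ![v, w] := OrthonormalBasis.coe_mk _ _
  refine ⟨b.repr, fun p => ⟨?_, ?_⟩⟩
  · rw [b.repr_apply_apply, hb]; rfl
  · rw [b.repr_apply_apply, hb]; rfl

/-- For `|q| = 1/2` the term `iμθN` disappears. Put `ν = iN` and `e = ζ JN` with `ζ² = 2iq`: then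
`dν = ρ e` and `de = -ρ ν`, where `ρ = Re(ζ̄ η)`. So `ν` turns in the fixed real plane spanned by
its initial frame, and `ψ - ν` has constant component along that plane. -/
theorem IsCRIsometricImmersion.exists_cylinder [ConnectedSpace M] (h : IsCRIsometricImmersion P ψ)
    (hpos : LeviPositive P) {q : ℂ} (hqn : Complex.normSq q = 1 / 4)
    (hq : ∀ x, HasInvariant P ψ q x) :
    ∃ (U : C2 ≃ₗᵢ[ℂ] C2) (p : C2), ∀ x, rhoCylinder (U (ψ x - p)) = 0 := by
  obtain ⟨ζ, hζ⟩ := IsAlgClosed.exists_pow_nat_eq (2 * Complex.I * q) (n := 2) (by norm_num)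
  have hζn : (starRingEnd ℂ) ζ * ζ = 1 := by
    have h1 : Complex.normSq ζ ^ 2 = 1 := by
      rw [← map_pow, hζ, map_mul, map_mul, hqn, Complex.normSq_I, Complex.normSq_ofNat]; norm_num
    rw [mul_comm, Complex.mul_conj,
      (pow_eq_one_iff_of_nonneg (Complex.normSq_nonneg _) two_ne_zero).1 h1]
    simp
  have hζ1 : ‖ζ‖ = 1 := by
    have := congrArg norm hζn
    rw [norm_mul, RCLike.norm_conj, norm_one] at this
    nlinarith [norm_nonneg ζ]
  set N := reebMap P ψ with hNdef
  have hN1 := h.norm_reebMap hpos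
  have hN := h.contMDiff_reebMap hpos
  have mN : ∀ x, MDifferentiableAt (𝓡 3) 𝓘(ℝ, C2) N x := fun x => hN.mdifferentiableAt (by simp)
  let mulL : ℂ → C2 →L[ℝ] C2 := fun c =>
    ((c • ContinuousLinearMap.id ℂ C2 : C2 →L[ℂ] C2)).restrictScalars ℝ
  let Lν : C2 →L[ℝ] C2 := mulL Complex.I
  let Le : C2 →L[ℝ] C2 := (mulL ζ).comp quatJ
  have hLν : ∀ p, Lν p = Complex.I • p := fun p => rfl
  have hLe : ∀ p, Le p = ζ • quatJ p := fun p => rfl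
  set ρ : ∀ x : M, TangentSpace (𝓡 3) x → ℝ := fun x a =>
    ((starRingEnd ℂ) ζ * etaOf P ψ x a).re with hρ
  have dN : ∀ x a, dif N x a = (-(Complex.I / 2) * etaOf P ψ x a
      + q * (starRingEnd ℂ) (etaOf P ψ x a)) • quatJ (N x) := fun x a => by
    rw [hq x a, hqn]; norm_num; rfl
  -- With `2iq = ζ²` and `|ζ| = 1`, the left side is `(η + ζ² η̄)/2 = ζ Re(ζ̄ η)`. This is where the
  -- square root is needed.
  have hκ : ∀ x a, Complex.I * (-(Complex.I / 2) * etaOf P ψ x a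
      + q * (starRingEnd ℂ) (etaOf P ψ x a)) = (ρ x a : ℂ) * ζ := by
    intro x a
    rw [hρ, Complex.re_eq_add_conj, map_mul, Complex.conj_conj]
    linear_combination (-(1 / 2) * etaOf P ψ x a) * Complex.I_mul_I
      - (1 / 2 * etaOf P ψ x a) * hζn - (1 / 2 * (starRingEnd ℂ) (etaOf P ψ x a)) * hζ
  have dν : ∀ x a, Lν (dif N x a) = ρ x a • Le (N x) := by
    intro x a
    rw [dN, hLν, hLe, smul_smul, hκ, mul_smul]
    rfl
  have de : ∀ x a, Le (dif N x a) = -(ρ x a • Lν (N x)) := by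
    intro x a
    have hc := congrArg (starRingEnd ℂ) (hκ x a)
    rw [map_mul, map_mul, Complex.conj_I, Complex.conj_ofReal] at hc
    rw [dN, hLe, hLν, quatJ_smul, quatJ_quatJ, smul_smul, smul_neg, neg_inj]
    have : ζ * (starRingEnd ℂ) (-(Complex.I / 2) * etaOf P ψ x a
      + q * (starRingEnd ℂ) (etaOf P ψ x a)) = (ρ x a : ℂ) * Complex.I := by
      generalize (starRingEnd ℂ) (-(Complex.I / 2) * etaOf P ψ x a
        + q * (starRingEnd ℂ) (etaOf P ψ x a)) = k at hc
      linear_combination (Complex.I * ζ) * hc + (ζ * k) * Complex.I_mul_I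
        + (ρ x a : ℂ) * Complex.I * hζn
    rw [this, mul_smul]
    rfl
  obtain ⟨x₀⟩ := (inferInstance : Nonempty M)
  let imT : C2 → C2 →L[ℝ] ℝ := fun w =>
    Complex.imCLM.comp ((innerSL ℂ w).restrictScalars ℝ)
  let reT : C2 → C2 →L[ℝ] ℝ := fun w =>
    Complex.reCLM.comp ((innerSL ℂ w).restrictScalars ℝ)
  have himT : ∀ w p, imT w p = (inner ℂ w p).im := fun w p => rfl
  have hreT : ∀ w p, reT w p = (inner ℂ w p).re := fun w p => rfl
  have hself : ∀ p : C2, (inner ℂ p p : ℂ).im = 0 := fun p => inner_self_im (𝕜 := ℂ) p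
  have hNN := inner_self_of_norm_one (hN1 x₀)
  have hνe : inner ℂ (Lν (N x₀)) (Le (N x₀)) = 0 := by
    rw [hLν, hLe, inner_smul_left, inner_smul_right, inner_self_quatJ]; simp
  have heν : inner ℂ (Le (N x₀)) (Lν (N x₀)) = 0 := by
    rw [← inner_conj_symm, hνe, map_zero]
  -- `Im⟨w, ν⟩` and `Im⟨w, e⟩` rotate into each other, so they vanish identically once they vanish
  -- at `x₀`.
  have key : ∀ w, (inner ℂ w (Lν (N x₀))).im = 0 → (inner ℂ w (Le (N x₀))).im = 0 → ∀ x,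
      (inner ℂ w (Lν (N x))).im = 0 ∧ (inner ℂ w (Le (N x))).im = 0 := by
    intro w h1 h2 x
    have sA := ((imT w).comp Lν).contDiff.contMDiff.comp hN
    have sB := ((imT w).comp Le).contDiff.contMDiff.comp hN
    have dA : ∀ x a, dif (((imT w).comp Lν) ∘ N) x a = ρ x a * (((imT w).comp Le) ∘ N) x := by
      intro x a
      refine (mfderiv_clm_comp ((imT w).comp Lν) (mN x) a).trans ?_
      change imT w (Lν (dif N x a)) = _
      rw [dν, map_smul]; rfl
    have dB : ∀ x a, dif (((imT w).comp Le) ∘ N) x a = -(ρ x a * (((imT w).comp Lν) ∘ N) x) := by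
      intro x a
      refine (mfderiv_clm_comp ((imT w).comp Le) (mN x) a).trans ?_
      change imT w (Le (dif N x a)) = _
      rw [de, map_neg, map_smul]; rfl
    refine ⟨eq_zero_of_rotation sA sB dA dB (x₀ := x₀) h1 h2 x, ?_⟩
    exact eq_zero_of_rotation sB sA (ρ := fun x a => -ρ x a)
      (fun x a => by rw [dB]; ring) (fun x a => by rw [dA]; ring) (x₀ := x₀) h2 h1 x
  set p₀ := ψ x₀ - Lν (N x₀) with hp₀
  -- Here `dψ = (η ζ̄) e - iθ ν`. When `⟨w, ν⟩` and `⟨w, e⟩` are real, the real part of `⟨w, dψ⟩` is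
  -- `ρ⟨w, e⟩`, which is that of `⟨w, dν⟩`.
  have hre : ∀ w, (inner ℂ w (Lν (N x₀))).im = 0 → (inner ℂ w (Le (N x₀))).im = 0 → ∀ x,
      (inner ℂ w (ψ x - p₀)).re = (inner ℂ w (Lν (N x))).re := by
    intro w h1 h2 x
    have s1 := (reT w).contDiff.contMDiff.comp h.smooth
    have s2 := (-((reT w).comp Lν)).contDiff.contMDiff.comp hN
    have hc := eq_of_mfderiv_eq_zero (s1.add s2) (fun x a => by
      refine (dif_add (s1.mdifferentiableAt (by simp)) (s2.mdifferentiableAt (by simp)) a).trans ?_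
      refine (congrArg₂ (fun p q : ℝ => p + q) (mfderiv_clm_comp (reT w) (h.mdifferentiableAt x) a)
        (mfderiv_clm_comp (-((reT w).comp Lν)) (mN x) a)).trans ?_
      change reT w (dif ψ x a) + -(reT w (Lν (dif N x a))) = 0
      obtain ⟨k1, k2⟩ := key w h1 h2 x
      have e1 : dif ψ x a = (etaOf P ψ x a * (starRingEnd ℂ) ζ) • Le (N x)
          + (-(Complex.I * P.θ x a)) • Lν (N x) := by
        rw [h.dif_eq hpos, hLe, hLν, smul_smul, smul_smul, mul_assoc, hζn, mul_one]
        congr 2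
        linear_combination (P.θ x a : ℂ) * Complex.I_mul_I
      rw [dν, e1, hreT, hreT, inner_add_right, inner_smul_right, inner_smul_right,
        inner_smul_right_eq_smul]
      simp only [hρ, Complex.add_re, Complex.mul_re, Complex.neg_re, Complex.neg_im, k1, k2,
        Complex.I_re, Complex.I_im, Complex.mul_im, Complex.ofReal_re, Complex.ofReal_im,
        Complex.smul_re, smul_eq_mul, Complex.conj_re, Complex.conj_im]
      ring) x x₀
    change reT w (ψ x) + -(reT w (Lν (N x))) = reT w (ψ x₀) + -(reT w (Lν (N x₀))) at hc
    change reT w (ψ x - p₀) = reT w (Lν (N x))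
    rw [hp₀, map_sub, map_sub]
    linarith
  have hnν : ∀ x, ‖Lν (N x)‖ = 1 := fun x => by
    rw [hLν, norm_smul, Complex.norm_I, hN1, one_mul]
  have hne : ‖Le (N x₀)‖ = 1 := by
    have : ‖quatJ (N x₀)‖ = 1 := by
      have h1 : inner ℂ (quatJ (N x₀)) (quatJ (N x₀)) = 1 := by
        rw [inner_quatJ_quatJ, hNN, map_one]
      have h2 : ‖quatJ (N x₀)‖ ^ 2 = 1 :=
        (inner_self_eq_norm_sq (𝕜 := ℂ) _).symm.trans (congrArg Complex.re h1)
      exact (pow_eq_one_iff_of_nonneg (norm_nonneg _) two_ne_zero).1 h2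
    rw [hLe, norm_smul, hζ1, this, one_mul]
  obtain ⟨U, hU⟩ := exists_unitary (hnν x₀) hne hνe
  refine ⟨U, p₀, fun x => ?_⟩
  have i1 := hself (Lν (N x₀))
  have i2 : (inner ℂ (Lν (N x₀)) (Le (N x₀))).im = 0 := by rw [hνe]; rfl
  have i3 : (inner ℂ (Le (N x₀)) (Lν (N x₀))).im = 0 := by rw [heν]; rfl
  have i4 := hself (Le (N x₀))
  -- In the coordinates `⟨ν₀, ·⟩, ⟨e₀, ·⟩` the real parts of `ψ - p₀` are the coordinates of `ν`,
  -- which are real by `key` and have square sum 1.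
  rw [rhoCylinder, (hU _).1, (hU _).2, hre _ i1 i2, hre _ i3 i4]
  have hn := (U.norm_map (Lν (N x))).trans (hnν x)
  have hn2 : ‖U (Lν (N x))‖ ^ 2 = 1 := by rw [hn]; norm_num
  rw [EuclideanSpace.norm_sq_eq, Fin.sum_univ_two, (hU _).1, (hU _).2, ← Complex.normSq_eq_norm_sq,
    ← Complex.normSq_eq_norm_sq, Complex.normSq_apply, Complex.normSq_apply,
    (key _ i1 i2 x).1, (key _ i3 i4 x).1] at hn2
  linarith

/-- Up to a holomorphic motion, a CR isometric immersion maps into the sphere of radius `2` or into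
the cylinder. -/
theorem IsCRIsometricImmersion.exists_model [ConnectedSpace M] (h : IsCRIsometricImmersion P ψ)
    (hpos : LeviPositive P) :
    ∃ (U : C2 ≃ₗᵢ[ℂ] C2) (p : C2),
      (∀ x, rhoSphere (U (ψ x - p)) = 0) ∨ ∀ x, rhoCylinder (U (ψ x - p)) = 0 := by
  obtain ⟨q, rfl | hqn, hq⟩ := h.exists_hasInvariant hpos
  · obtain ⟨p, hp⟩ := h.exists_center hpos hq
    refine ⟨LinearIsometryEquiv.refl ℂ C2, p, Or.inl fun x => ?_⟩
    have : ‖ψ x - p‖ ^ 2 = 4 := by rw [hp]; norm_num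
    rw [EuclideanSpace.norm_sq_eq, Fin.sum_univ_two] at this
    simp only [LinearIsometryEquiv.coe_refl, id_eq, rhoSphere]
    linarith
  · obtain ⟨U, p, hU⟩ := h.exists_cylinder hpos hqn hq
    exact ⟨U, p, Or.inr hU⟩

end Models

/-! ### Base change and round hypersurfaces -/

section BaseChange

variable {V W : Type*} [AddCommGroup V] [Module ℝ V] [AddCommGroup W] [Module ℝ W]

theorem reC_baseChange (f : V →ₗ[ℝ] W) (w : ℂ ⊗[ℝ] V) :
    reC (LinearMap.baseChange ℂ f w) = f (reC w) := by
  induction w using TensorProduct.induction_on with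
  | zero => simp
  | tmul z v => rw [LinearMap.baseChange_tmul, reC_tmul, reC_tmul, map_smul]
  | add x y hx hy => simp only [map_add, hx, hy]

theorem imC_baseChange (f : V →ₗ[ℝ] W) (w : ℂ ⊗[ℝ] V) :
    imC (LinearMap.baseChange ℂ f w) = f (imC w) := by
  induction w using TensorProduct.induction_on with
  | zero => simp
  | tmul z v => rw [LinearMap.baseChange_tmul, imC_tmul, imC_tmul, map_smul]
  | add x y hx hy => simp only [map_add, hx, hy]

end BaseChange

/-- `ρ` is the defining function of the points at distance `r` from the kernel of the orthogonal
projection `L`. -/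
structure RoundModel (ρ : C2 → ℝ) (L : C2 →L[ℝ] C2) (r : ℝ) : Prop where
  pos : 0 < r
  idem : ∀ p, L (L p) = L p
  symm : ∀ p q, inner ℝ (L p) q = inner ℝ p (L q)
  rho_eq : ∀ p, ρ p = ‖L p‖ ^ 2 - r ^ 2

namespace RoundModel

variable {ρ : C2 → ℝ} {L : C2 →L[ℝ] C2} {r : ℝ}

theorem norm_eq (h : RoundModel ρ L r) {p : C2} (hp : ρ p = 0) : ‖L p‖ = r := by
  rw [h.rho_eq, sub_eq_zero] at hp
  exact (sq_eq_sq₀ (norm_nonneg _) h.pos.le).1 hp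

theorem eq_zero_iff (h : RoundModel ρ L r) {p : C2} : ρ p = 0 ↔ ‖L p‖ = r :=
  ⟨h.norm_eq, fun hp => by rw [h.rho_eq, hp, sub_self]⟩

theorem inner_self (h : RoundModel ρ L r) {p : C2} (hp : ρ p = 0) :
    inner ℝ (L p) (L p) = r ^ 2 := by
  rw [real_inner_self_eq_norm_sq, h.norm_eq hp]

theorem inner_map (h : RoundModel ρ L r) (p q : C2) :
    inner ℝ (L p) (L q) = inner ℝ (L p) q := by
  rw [← h.symm, h.idem]

theorem fderiv_apply (h : RoundModel ρ L r) (p a : C2) : fderiv ℝ ρ p a = 2 * inner ℝ (L p) a := by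
  have e : ρ = fun p => ‖L p‖ ^ 2 - r ^ 2 := funext h.rho_eq
  have hd := ((L.hasFDerivAt (x := p)).norm_sq.sub_const (r ^ 2)).fderiv
  rw [e, hd, smul_apply, ContinuousLinearMap.comp_apply, innerSL_apply_apply, h.inner_map]
  simp

/-- Coordinates adapted to the hypersurface: moving from it in a normal direction leaves it. -/
theorem eq_zero_of_normal (h : RoundModel ρ L r) {p n : C2} {t : ℝ} (hp : ρ p = 0) (hn : ρ n = 0)
    (hpt : ρ (p + t • L n) = 0) (hpos : 0 < 2 * inner ℝ (L p) (L n) + t * r ^ 2) : t = 0 := by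
  have e := h.inner_self hpt
  rw [map_add, map_smul, h.idem, inner_add_left, inner_add_right, inner_add_right,
    inner_smul_left, inner_smul_left, inner_smul_right, inner_smul_right, h.inner_self hp,
    h.inner_self hn, real_inner_comm (L p) (L n)] at e
  simp only [conj_trivial] at e
  have : t * (2 * inner ℝ (L p) (L n) + t * r ^ 2) = 0 := by linarith
  exact (mul_eq_zero.1 this).resolve_right hpos.ne'

end RoundModel

/-! ### Immersions into a round hypersurface are local CR diffeomorphisms -/

section LocalDiffeo

variable {M : Type*} [TopologicalSpace M] [ChartedSpace (EuclideanSpace ℝ (Fin 3)) M]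
  [IsManifold (𝓡 3) ∞ M] {S : CRStructure M} {P : Pseudohermitian S} {ψ : M → C2}
  {ρ : C2 → ℝ} {L : C2 →L[ℝ] C2} {r : ℝ}

namespace IsCRIsometricImmersion

theorem inner_normal (h : IsCRIsometricImmersion P ψ) (hρ : RoundModel ρ L r)
    (h0 : ∀ x, ρ (ψ x) = 0) (x : M) (a : TangentSpace (𝓡 3) x) :
    inner ℝ (L (ψ x)) (dif ψ x a) = 0 := by
  have hs : DifferentiableAt ℝ ρ (ψ x) := by
    have e : ρ = fun p => ‖L p‖ ^ 2 - r ^ 2 := funext hρ.rho_eq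
    rw [e]
    exact ((L.hasFDerivAt (x := ψ x)).norm_sq.sub_const (r ^ 2)).differentiableAt
  have h1 : (fun y => ρ (ψ y)) = fun _ => (0 : ℝ) := funext h0
  have h2 := mfderiv_comp x hs.mdifferentiableAt (h.mdifferentiableAt x)
  have h3 := congrArg (fun T : TangentSpace (𝓡 3) x →L[ℝ] ℝ => T a) h2
  have h4 : mfderiv (𝓡 3) 𝓘(ℝ, ℝ) (fun y => ρ (ψ y)) x a = 0 := by
    rw [h1, mfderiv_const]; rfl
  have h5 : fderiv ℝ ρ (ψ x) (dif ψ x a) = 0 := by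
    rw [← mfderiv_eq_fderiv]
    exact h3.symm.trans h4
  rw [hρ.fderiv_apply] at h5
  linarith

/-- The image of `dψ` and the normal `L (ψ x)` are independent, and 3 + 1 = 4; a vector orthogonal
to the normal thus lies in the image. -/
theorem exists_dif_eq (h : IsCRIsometricImmersion P ψ) (hρ : RoundModel ρ L r)
    (h0 : ∀ x, ρ (ψ x) = 0) (x : M) {p : C2} (hp : inner ℝ (L (ψ x)) p = 0) :
    ∃ a, dif ψ x a = p := by
  have : FiniteDimensional ℝ (TangentSpace (𝓡 3) x) :=
    inferInstanceAs (FiniteDimensional ℝ (EuclideanSpace ℝ (Fin 3)))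
  let T : TangentSpace (𝓡 3) x × ℝ →ₗ[ℝ] C2 :=
    (dif ψ x).toLinearMap.coprod (LinearMap.toSpanSingleton ℝ _ (L (ψ x)))
  have hT : ∀ a s, T (a, s) = dif ψ x a + s • L (ψ x) := fun a s => rfl
  have hin : ∀ a s, inner ℝ (L (ψ x)) (T (a, s)) = s * r ^ 2 := by
    intro a s
    rw [hT, inner_add_right, h.inner_normal hρ h0, inner_smul_right, hρ.inner_self (h0 x), zero_add]
  have hr : r ^ 2 ≠ 0 := pow_ne_zero 2 hρ.pos.ne'
  have hinj : Function.Injective T := by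
    rw [← LinearMap.ker_eq_bot, LinearMap.ker_eq_bot']
    rintro ⟨a, s⟩ hz
    have h1 := hin a s
    rw [hz, inner_zero_right] at h1
    have hs : s = 0 := (mul_eq_zero.1 h1.symm).resolve_right hr
    subst hs
    rw [hT, zero_smul, add_zero] at hz
    have := h.injective x (hz.trans (map_zero (dif ψ x)).symm)
    rw [this]; rfl
  have hfin : Module.finrank ℝ (TangentSpace (𝓡 3) x × ℝ) = Module.finrank ℝ C2 := by
    rw [Module.finrank_prod, Module.finrank_self, finrank_real_C2]
    exact congrArg (· + 1) finrank_euclideanSpace_fin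
  obtain ⟨⟨a, s⟩, has⟩ := (LinearMap.injective_iff_surjective_of_finrank_eq_finrank hfin).1 hinj p
  have h1 := hin a s
  rw [has, hp] at h1
  have hs : s = 0 := (mul_eq_zero.1 h1.symm).resolve_right hr
  subst hs
  rw [hT, zero_smul, add_zero] at has
  exact ⟨a, has⟩

theorem baseChange_image (h : IsCRIsometricImmersion P ψ) (hpos : LeviPositive P)
    (hρ : RoundModel ρ L r) (h0 : ∀ x, ρ (ψ x) = 0) (x : M) :
    (LinearMap.baseChange ℂ (dif ψ x).toLinearMap) '' (S.T10 x : Set (CTangent x))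
      = hypT10 ρ (ψ x) := by
  ext w
  constructor
  · rintro ⟨z, hz, rfl⟩
    refine ⟨?_, ?_, ?_⟩
    · rw [reC_baseChange, hρ.fderiv_apply]
      exact (congrArg (2 * ·) (h.inner_normal hρ h0 x (reC z))).trans (mul_zero 2)
    · rw [imC_baseChange, hρ.fderiv_apply]
      exact (congrArg (2 * ·) (h.inner_normal hρ h0 x (imC z))).trans (mul_zero 2)
    · rw [reC_baseChange, imC_baseChange]
      exact h.map_imC x z hz
  · rintro ⟨h1, h2, h3⟩
    rw [hρ.fderiv_apply] at h1 h2
    obtain ⟨a, ha⟩ := h.exists_dif_eq hρ h0 x (p := reC w) (by linarith)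
    obtain ⟨b, hb⟩ := h.exists_dif_eq hρ h0 x (p := imC w) (by linarith)
    obtain ⟨u, v, hf⟩ := exists_isFrameAt hpos x
    -- `⟨N, dψ b⟩ = -i θ(a)` must be real, as `dψ b = -i dψ a`; so `a` lies in the contact plane.
    have hθ : P.θ x a = 0 := by
      have e1 := h.inner_reebMap hpos x a
      have e2 := h.inner_reebMap hpos x b
      rw [hb, h3, ← ha, inner_neg_right, inner_smul_right, e1] at e2
      have := congrArg Complex.im e2
      simpa using this
    obtain ⟨α, β, hab⟩ := hf.ker a hθ
    set z : CTangent x := ((α : ℂ) - (β : ℂ) * Complex.I) • mkC u v with hz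
    have hzT : z ∈ S.T10 x := Submodule.smul_mem _ _ hf.mem_T10
    have hre : reC z = a := by
      rw [hz, reC_smul, reC_mkC, imC_mkC, hab]; simp
    refine ⟨z, hzT, ext_mkC ?_ ?_⟩
    · rw [reC_baseChange, hre]; exact ha
    · rw [imC_baseChange, h3, ← ha, ← hre]
      exact h.map_imC x z hzT

/-- An immersion into a round hypersurface is locally invertible by smooth maps. -/
theorem exists_local_inverse (h : IsCRIsometricImmersion P ψ) (hρ : RoundModel ρ L r)
    (h0 : ∀ x, ρ (ψ x) = 0) (x : M) :
    ∃ (U : Set M) (V : Set C2) (G : C2 → M), IsOpen U ∧ x ∈ U ∧ IsOpen V ∧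
      ψ '' U = {q | ρ q = 0 ∧ q ∈ V} ∧ ContMDiffOn 𝓘(ℝ, C2) (𝓡 3) ∞ G V ∧
      ∀ y ∈ U, G (ψ y) = y := by
  set φ := extChartAt (𝓡 3) x with hφ
  set y₀ := φ x with hy₀
  have htO : IsOpen φ.target := isOpen_extChartAt_target x
  have hy₀t : y₀ ∈ φ.target := mem_extChartAt_target x
  set n := L (ψ x) with hn
  set ψc := ψ ∘ φ.symm with hψc
  have hψy₀ : ψc y₀ = ψ x := by rw [hψc, Function.comp_apply, hy₀, hφ, extChartAt_to_inv]
  have cψ : ContDiffOn ℝ ∞ ψc φ.target := h.contDiffOn_chart x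
  -- Thickening along the normal at `ψ x` gives a map between spaces of dimension 4, to which the
  -- inverse function theorem applies.
  let Ψ : EuclideanSpace ℝ (Fin 3) × ℝ → C2 := fun z => ψc z.1 + z.2 • n
  have cΨ : ∀ z : EuclideanSpace ℝ (Fin 3) × ℝ, z.1 ∈ φ.target → ContDiffAt ℝ ∞ Ψ z := by
    intro z hz
    exact ((cψ.contDiffAt (htO.mem_nhds hz)).comp z contDiffAt_fst).add
      (contDiffAt_snd.smul contDiffAt_const)
  have dΨ : fderiv ℝ Ψ (y₀, 0) = (fderiv ℝ ψc y₀).comp (ContinuousLinearMap.fst ℝ _ _)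
      + (ContinuousLinearMap.toSpanSingleton ℝ n).comp (ContinuousLinearMap.snd ℝ _ _) := by
    have d1 := ((cψ.contDiffAt (htO.mem_nhds hy₀t)).differentiableAt
      (by simp : (∞ : ℕ∞ω) ≠ 0)).hasFDerivAt
    have d2 : HasFDerivAt (fun z : EuclideanSpace ℝ (Fin 3) × ℝ => ψc z.1)
        ((fderiv ℝ ψc y₀).comp (ContinuousLinearMap.fst ℝ _ _)) (y₀, 0) :=
      HasFDerivAt.comp (y₀, (0 : ℝ)) (f := Prod.fst) d1 hasFDerivAt_fst
    have d3 : HasFDerivAt (fun z : EuclideanSpace ℝ (Fin 3) × ℝ => z.2 • n)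
        ((ContinuousLinearMap.toSpanSingleton ℝ n).comp (ContinuousLinearMap.snd ℝ _ _)) (y₀, 0) :=
      ((ContinuousLinearMap.toSpanSingleton ℝ n).comp
        (ContinuousLinearMap.snd ℝ (EuclideanSpace ℝ (Fin 3)) ℝ)).hasFDerivAt
    exact (d2.add d3).fderiv
  have hbase : ∀ a, fderiv ℝ ψc y₀ a = dif ψ (φ.symm y₀) (chartSymmD x y₀ a) :=
    fun a => h.fderiv_chart hy₀t a
  have hinj : Function.Injective (fderiv ℝ Ψ (y₀, 0)).toLinearMap := by
    rw [← LinearMap.ker_eq_bot, LinearMap.ker_eq_bot']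
    rintro ⟨a, s⟩ hz
    have hz' : fderiv ℝ ψc y₀ a + s • n = 0 := by
      have h1 : fderiv ℝ Ψ (y₀, 0) (a, s) = 0 := hz
      rw [dΨ] at h1
      exact h1
    have hsymm : φ.symm y₀ = x := extChartAt_to_inv x
    have hperp : inner ℝ n (fderiv ℝ ψc y₀ a) = 0 := by
      have := h.inner_normal hρ h0 (φ.symm y₀) (chartSymmD x y₀ a)
      rw [hbase, hn]
      rwa [show L (ψ (φ.symm y₀)) = L (ψ x) by rw [hsymm]] at this
    have h1 := congrArg (inner ℝ n) hz'
    rw [inner_add_right, hperp, inner_smul_right, hn, hρ.inner_self (h0 x), inner_zero_right,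
      zero_add] at h1
    have hs : s = 0 := (mul_eq_zero.1 h1).resolve_right (pow_ne_zero 2 hρ.pos.ne')
    subst hs
    rw [zero_smul, add_zero, hbase] at hz'
    have h2 := congrArg (chartD x _)
      (h.injective _ (hz'.trans (map_zero (dif ψ (φ.symm y₀))).symm))
    rw [chartD_chartSymmD hy₀t, map_zero] at h2
    rw [h2]; rfl
  let e : (EuclideanSpace ℝ (Fin 3) × ℝ) ≃L[ℝ] C2 :=
    (LinearEquiv.ofInjectiveOfFinrankEq (fderiv ℝ Ψ (y₀, 0)).toLinearMap hinj
      (by rw [finrank_real_C2]; simp)).toContinuousLinearEquiv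
  have he : (e : (EuclideanSpace ℝ (Fin 3) × ℝ) →L[ℝ] C2) = fderiv ℝ Ψ (y₀, 0) := by
    exact ContinuousLinearMap.ext fun z => rfl
  have cΨ₀ := cΨ (y₀, 0) hy₀t
  have hΨd : HasFDerivAt Ψ (e : (EuclideanSpace ℝ (Fin 3) × ℝ) →L[ℝ] C2) (y₀, 0) := by
    rw [he]; exact (cΨ₀.differentiableAt (by simp)).hasFDerivAt
  let Φ := cΨ₀.toOpenPartialHomeomorph Ψ hΨd (by simp)
  have hΦ : ∀ z, Φ z = Ψ z := fun z => rfl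
  have hΦs : (y₀, (0 : ℝ)) ∈ Φ.source := cΨ₀.mem_toOpenPartialHomeomorph_source hΨd (by simp)
  have htO' : IsOpen {z : EuclideanSpace ℝ (Fin 3) × ℝ | z.1 ∈ φ.target} :=
    htO.preimage continuous_fst
  have hcont : ContinuousOn Ψ {z : EuclideanSpace ℝ (Fin 3) × ℝ | z.1 ∈ φ.target} :=
    fun z hz => (cΨ z hz).continuousAt.continuousWithinAt
  have hcont2 : ContinuousOn (fun z : EuclideanSpace ℝ (Fin 3) × ℝ =>
      2 * inner ℝ (L (ψc z.1)) n + z.2 * r ^ 2)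
      {z : EuclideanSpace ℝ (Fin 3) × ℝ | z.1 ∈ φ.target} := by
    have : ContinuousOn (fun z : EuclideanSpace ℝ (Fin 3) × ℝ => ψc z.1)
        {z : EuclideanSpace ℝ (Fin 3) × ℝ | z.1 ∈ φ.target} :=
      cψ.continuousOn.comp continuous_fst.continuousOn fun z hz => hz
    exact (continuousOn_const.mul ((L.continuous.comp_continuousOn this).inner
      continuousOn_const)).add (continuous_snd.continuousOn.mul continuousOn_const)
  -- The positivity condition on `W` is the one of `eq_zero_of_normal`: it ensures that the
  -- hypersurface meets the image of `W` only at `t = 0`.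
  have hW : ∃ W : Set (EuclideanSpace ℝ (Fin 3) × ℝ), IsOpen W ∧ (y₀, (0 : ℝ)) ∈ W ∧
      ∀ z ∈ W, z ∈ Φ.source ∧ z.1 ∈ φ.target ∧ 0 < 2 * inner ℝ (L (ψc z.1)) n + z.2 * r ^ 2 ∧
        ∃ e' : (EuclideanSpace ℝ (Fin 3) × ℝ) ≃L[ℝ] C2,
          (e' : (EuclideanSpace ℝ (Fin 3) × ℝ) →L[ℝ] C2) = fderiv ℝ Ψ z := by
    have e1 : ∀ᶠ z in 𝓝 (y₀, (0 : ℝ)), z ∈ Φ.source := Φ.open_source.mem_nhds hΦs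
    have e2 : ∀ᶠ z in 𝓝 (y₀, (0 : ℝ)), z.1 ∈ φ.target := htO'.mem_nhds hy₀t
    have e3 : ∀ᶠ z in 𝓝 (y₀, (0 : ℝ)), 0 < 2 * inner ℝ (L (ψc z.1)) n + z.2 * r ^ 2 := by
      refine (hcont2.continuousAt (htO'.mem_nhds hy₀t)).eventually_const_lt ?_
      simp only [hψy₀]
      rw [hn, hρ.inner_self (h0 x)]
      have := pow_pos hρ.pos 2
      linarith
    have e4 : ∀ᶠ z in 𝓝 (y₀, (0 : ℝ)), ∃ e' : (EuclideanSpace ℝ (Fin 3) × ℝ) ≃L[ℝ] C2,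
          (e' : (EuclideanSpace ℝ (Fin 3) × ℝ) →L[ℝ] C2) = fderiv ℝ Ψ z := by
      have hc : ContinuousAt (fderiv ℝ Ψ) (y₀, (0 : ℝ)) :=
        (cΨ₀.fderiv_right (m := 0) (by norm_cast)).continuousAt
      exact hc.eventually (he ▸ ContinuousLinearEquiv.nhds e)
    obtain ⟨W, hWs, hWo, hWm⟩ := eventually_nhds_iff.1 (e1.and (e2.and (e3.and e4)))
    exact ⟨W, hWo, hWm, hWs⟩
  obtain ⟨W, hWo, hWm, hWs⟩ := hW
  have hV : IsOpen (Φ '' W) := Φ.isOpen_image_of_subset_source hWo fun z hz => (hWs z hz).1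
  refine ⟨φ.source ∩ φ ⁻¹' {y | (y, (0 : ℝ)) ∈ W}, Φ '' W, fun q => φ.symm (Φ.symm q).1,
    (continuousOn_extChartAt x).isOpen_inter_preimage (isOpen_extChartAt_source x)
      (hWo.preimage (by fun_prop)), ⟨mem_extChartAt_source x, hWm⟩, hV, ?_, ?_, ?_⟩
  · ext q
    constructor
    · rintro ⟨z, ⟨hzs, hzW⟩, rfl⟩
      refine ⟨h0 z, (φ z, 0), hzW, ?_⟩
      change ψ (φ.symm (φ z)) + (0 : ℝ) • n = ψ z
      rw [φ.left_inv hzs, zero_smul, add_zero]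
    · rintro ⟨hq0, ⟨y, t⟩, hyt, rfl⟩
      obtain ⟨-, h2, h3, -⟩ := hWs _ hyt
      have ht : t = 0 := hρ.eq_zero_of_normal (h0 (φ.symm y)) (h0 x) hq0 h3
      subst ht
      refine ⟨φ.symm y, ⟨φ.map_target h2, ?_⟩, ?_⟩
      · change (φ (φ.symm y), (0 : ℝ)) ∈ W
        rwa [φ.right_inv h2]
      · change ψ (φ.symm y) = ψ (φ.symm y) + (0 : ℝ) • n
        rw [zero_smul, add_zero]
  · rintro q ⟨z, hz, rfl⟩
    obtain ⟨hz1, hz2, -, e', he'⟩ := hWs z hz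
    have hzz : Φ.symm (Φ z) = z := Φ.left_inv hz1
    have c1 : ContDiffAt ℝ ∞ Φ.symm (Φ z) := by
      refine Φ.contDiffAt_symm (f₀' := e') (Φ.map_source hz1) ?_ ?_
      · rw [hzz, he']; exact ((cΨ z hz2).differentiableAt (by simp)).hasFDerivAt
      · rw [hzz]; exact cΨ z hz2
    have c2 : ContMDiffAt 𝓘(ℝ, C2) 𝓘(ℝ, EuclideanSpace ℝ (Fin 3)) ∞ (fun q => (Φ.symm q).1) (Φ z) :=
      (contDiffAt_fst.comp _ c1).contMDiffAt
    refine (ContMDiffAt.comp (Φ z) (g := φ.symm) ?_ c2).contMDiffWithinAt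
    rw [hzz]
    exact contMDiffAt_chart_symm hz2
  · rintro z ⟨hzs, hzW⟩
    have e1 : ψ z = Φ (φ z, 0) := by
      change ψ z = ψ (φ.symm (φ z)) + (0 : ℝ) • n
      rw [φ.left_inv hzs, zero_smul, add_zero]
    simp only [e1]
    rw [Φ.left_inv (hWs _ hzW).1, φ.left_inv hzs]

theorem isLocalCRDiffeo (h : IsCRIsometricImmersion P ψ) (hpos : LeviPositive P)
    (hρ : RoundModel ρ L r) (h0 : ∀ x, ρ (ψ x) = 0) :
    IsLocalCRDiffeo S ρ fun x => (⟨ψ x, h0 x⟩ : Hypersurface ρ) := by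
  refine ⟨h.smooth, fun x => ?_, fun x => h.baseChange_image hpos hρ h0 x⟩
  obtain ⟨U, V, G, hU, hx, hV, him, hG, hGU⟩ := h.exists_local_inverse hρ h0 x
  refine ⟨U, V, G, hU, hx, hV, ?_, hG, hGU⟩
  ext q
  constructor
  · rintro ⟨y, hy, rfl⟩
    exact (him.subset ⟨y, hy, rfl⟩ : ψ y ∈ {q | ρ q = 0 ∧ q ∈ V}).2
  · intro hq
    obtain ⟨y, hy, hyq⟩ := him.superset (⟨q.2, hq⟩ : (q : C2) ∈ {q | ρ q = 0 ∧ q ∈ V})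
    exact ⟨y, hy, Subtype.ext hyq⟩

end IsCRIsometricImmersion

/-- A local CR diffeomorphism is a local homeomorphism. -/
theorem IsLocalCRDiffeo.isLocalHomeomorph {Ψ : M → Hypersurface ρ} (h : IsLocalCRDiffeo S ρ Ψ) :
    IsLocalHomeomorph Ψ := by
  have hcont : Continuous Ψ := h.1.continuous.subtype_mk fun x => (Ψ x).2
  refine IsLocalHomeomorph.mk Ψ fun x => ?_
  obtain ⟨U, V, G, hU, hx, hV, him, hG, hGU⟩ := h.2.1 x
  refine ⟨{ toFun := Ψ, invFun := fun q => G q, source := U,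
            target := {q : Hypersurface ρ | (q : C2) ∈ V},
            map_source' := fun y hy => him.subset ⟨y, hy, rfl⟩,
            map_target' := fun q hq => ?_,
            left_inv' := fun y hy => hGU y hy,
            right_inv' := fun q hq => ?_,
            open_source := hU,
            open_target := hV.preimage continuous_subtype_val,
            continuousOn_toFun := hcont.continuousOn,
            continuousOn_invFun := hG.continuousOn.comp continuous_subtype_val.continuousOn
              fun q hq => hq }, hx, fun y _ => rfl⟩
  · obtain ⟨y, hy, rfl⟩ := him.superset hq
    rwa [hGU y hy]
  · obtain ⟨y, hy, rfl⟩ := him.superset hq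
    rw [hGU y hy]

end LocalDiffeo

/-! ### Local inverses and prolongation of lifts -/

section Sheets

open Set

variable {M : Type*} [TopologicalSpace M] {ψ : M → C2} {ρ : C2 → ℝ}

/-- The path `c` has a lift with initial point `x` on `[0, T]`. -/
def LiftsUpTo (ψ : M → C2) (c : ℝ → C2) (x : M) (T : ℝ) (γ : ℝ → M) : Prop :=
  ContinuousOn γ (Icc 0 T) ∧ γ 0 = x ∧ ∀ t ∈ Icc 0 T, ψ (γ t) = c t

theorem LiftsUpTo.mono {c : ℝ → C2} {x : M} {T T' : ℝ} {γ : ℝ → M} (hl : LiftsUpTo ψ c x T γ)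
    (hT : T' ≤ T) : LiftsUpTo ψ c x T' γ :=
  ⟨hl.1.mono (Icc_subset_Icc le_rfl hT), hl.2.1, fun t ht => hl.2.2 t ⟨ht.1, ht.2.trans hT⟩⟩

variable [ChartedSpace (EuclideanSpace ℝ (Fin 3)) M]

/-- A local inverse of the immersion near the point `x`. -/
structure IsSheet (ρ : C2 → ℝ) (ψ : M → C2) (x : M) (V : Set C2) (G : C2 → M) : Prop where
  isOpen : IsOpen V
  mem : ψ x ∈ V
  smooth : ContMDiffOn 𝓘(ℝ, C2) (𝓡 3) ∞ G V
  right_inv : ∀ q ∈ V, ρ q = 0 → ψ (G q) = q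
  left_inv : ∀ᶠ y in 𝓝 x, G (ψ y) = y

/-- A lift that enters a sheet is prolonged by the local inverse. -/
theorem LiftsUpTo.extend {c : ℝ → C2} {x z : M} {T T' : ℝ} {γ : ℝ → M}
    (hl : LiftsUpTo ψ c x T γ) (hT : 0 ≤ T) {V : Set C2} {G : C2 → M} (hs : IsSheet ρ ψ z V G)
    (hTT' : T ≤ T') (hc : ContinuousOn c (Icc T T')) (hcρ : ∀ t ∈ Icc T T', ρ (c t) = 0)
    (hV : ∀ t ∈ Icc T T', c t ∈ V) (hG : G (c T) = γ T) :
    ∃ γ', LiftsUpTo ψ c x T' γ' := by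
  set γ' : ℝ → M := fun t => if t ≤ T then γ t else G (c t) with hγ'
  have e1 : EqOn γ' γ (Icc 0 T) := fun t ht => if_pos ht.2
  have e2 : EqOn γ' (G ∘ c) (Icc T T') := fun t ht => by
    rcases ht.1.eq_or_lt with rfl | hlt
    · exact (if_pos le_rfl).trans hG.symm
    · exact if_neg (not_le.2 hlt)
  refine ⟨γ', ?_, (if_pos hT).trans hl.2.1, fun t ht => ?_⟩
  · rw [← Icc_union_Icc_eq_Icc hT hTT']
    exact (hl.1.congr e1).union_of_isClosed ((hs.smooth.continuousOn.comp hc hV).congr e2)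
      isClosed_Icc isClosed_Icc
  · rcases le_total t T with h1 | h1
    · rw [e1 ⟨ht.1, h1⟩]; exact hl.2.2 t ⟨ht.1, h1⟩
    · rw [e2 ⟨h1, ht.2⟩]; exact hs.right_inv _ (hV t ⟨h1, ht.2⟩) (hcρ t ⟨h1, ht.2⟩)

end Sheets

/-! ### Completeness and path lifting -/

section PathLifting

open Set MeasureTheory

variable {M : Type*} [TopologicalSpace M] [ChartedSpace (EuclideanSpace ℝ (Fin 3)) M]
  [IsManifold (𝓡 3) ∞ M] {S : CRStructure M} {P : Pseudohermitian S} {ψ : M → C2}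
  {ρ : C2 → ℝ} {L : C2 →L[ℝ] C2} {r : ℝ}

/-- The norm of the Webster metric. -/
abbrev websterENorm (P : Pseudohermitian S) (z : M) : ENorm (TangentSpace (𝓡 3) z) :=
  ⟨fun v => ENNReal.ofReal (Real.sqrt (webster P z v v))⟩

/-- The length of a path for the Webster metric. -/
def websterLength (P : Pseudohermitian S) (γ : ℝ → M) (a b : ℝ) : ℝ≥0∞ :=
  letI := websterENorm P
  Manifold.pathELength (𝓡 3) γ a b

namespace IsCRIsometricImmersion

theorem enorm_eq (h : IsCRIsometricImmersion P ψ) (z : M) (v : TangentSpace (𝓡 3) z) :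
    ENNReal.ofReal (Real.sqrt (webster P z v v)) = ‖dif ψ z v‖ₑ := by
  have e : webster P z v v = ‖dif ψ z v‖ ^ 2 :=
    (h.re_inner z v v).symm.trans (inner_self_eq_norm_sq (𝕜 := ℂ) (E := C2) _)
  rw [e, Real.sqrt_sq (norm_nonneg _), ofReal_norm]

/-- Homogeneity is what the symmetry and length estimates of the Riemannian distance require; it is
inherited from ℂ² through `dψ`. -/
theorem enormSMulClass (h : IsCRIsometricImmersion P ψ) (z : M) :
    letI := websterENorm P
    ENormSMulClass ℝ (TangentSpace (𝓡 3) z) := by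
  let _ := websterENorm P
  refine ⟨fun t v => ?_⟩
  change ENNReal.ofReal (Real.sqrt (webster P z (t • v) (t • v)))
    = ‖t‖ₑ * ENNReal.ofReal (Real.sqrt (webster P z v v))
  rw [h.enorm_eq, h.enorm_eq, map_smul]
  exact enorm_smul t (dif ψ z v)

theorem websterEDist_comm (h : IsCRIsometricImmersion P ψ) (x y : M) :
    websterEDist P x y = websterEDist P y x := by
  let _ := websterENorm P
  let _ := h.enormSMulClass
  exact Manifold.riemannianEDist_comm

theorem websterEDist_le_websterLength (h : IsCRIsometricImmersion P ψ) {γ : ℝ → M} {a b : ℝ}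
    (hγ : ContMDiffOn 𝓘(ℝ, ℝ) (𝓡 3) 1 γ (Icc a b)) (hab : a ≤ b) :
    websterEDist P (γ a) (γ b) ≤ websterLength P γ a b := by
  let _ := websterENorm P
  let _ := h.enormSMulClass
  exact Manifold.riemannianEDist_le_pathELength hγ rfl rfl hab

theorem websterLength_eq (h : IsCRIsometricImmersion P ψ) {γ : ℝ → M} {a b : ℝ}
    (hγ : ContMDiffOn 𝓘(ℝ, ℝ) (𝓡 3) 1 γ (Icc a b)) :
    websterLength P γ a b = ∫⁻ t in Ioo a b, ‖deriv (ψ ∘ γ) t‖ₑ := by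
  let _ := websterENorm P
  rw [websterLength, Manifold.pathELength_eq_lintegral_mfderiv_Ioo]
  refine setLIntegral_congr_fun measurableSet_Ioo fun t ht => ?_
  have hd : MDifferentiableAt 𝓘(ℝ, ℝ) (𝓡 3) γ t :=
    (hγ.contMDiffAt (Icc_mem_nhds ht.1 ht.2)).mdifferentiableAt (by simp)
  have e := mfderiv_comp t (h.mdifferentiableAt (γ t)) hd
  rw [mfderiv_eq_fderiv] at e
  have e' := congrArg (fun T : ℝ →L[ℝ] C2 => T 1) e
  refine (h.enorm_eq (γ t) _).trans (congrArg (fun w : C2 => ‖w‖ₑ) ?_)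
  exact e'.symm

theorem contDiffOn_comp (h : IsCRIsometricImmersion P ψ) {γ : ℝ → M} {s : Set ℝ}
    (hγ : ContMDiffOn 𝓘(ℝ, ℝ) (𝓡 3) 1 γ s) : ContDiffOn ℝ 1 (ψ ∘ γ) s :=
  ((h.smooth.of_le (by norm_cast)).comp_contMDiffOn hγ).contDiffOn

/-- The distance between two points of a path is bounded by the length of its image. -/
theorem websterEDist_le (h : IsCRIsometricImmersion P ψ) {γ : ℝ → M} {a b C : ℝ}
    (hγ : ContMDiffOn 𝓘(ℝ, ℝ) (𝓡 3) 1 γ (Icc a b)) (hab : a ≤ b)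
    (hC : ∀ t ∈ Ioo a b, ‖deriv (ψ ∘ γ) t‖ ≤ C) :
    websterEDist P (γ a) (γ b) ≤ ENNReal.ofReal C * ENNReal.ofReal (b - a) := by
  refine (h.websterEDist_le_websterLength hγ hab).trans ?_
  rw [h.websterLength_eq hγ]
  refine (setLIntegral_mono' (g := fun _ => ENNReal.ofReal C) measurableSet_Ioo
    fun t ht => ?_).trans ?_
  · rw [← ofReal_norm]
    exact ENNReal.ofReal_le_ofReal (hC t ht)
  · rw [setLIntegral_const, Real.volume_Ioo]

/-- Points at small distance are joined by a path whose image is small. -/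
theorem exists_path (h : IsCRIsometricImmersion P ψ) {x y : M} {δ : ℝ≥0∞}
    (hxy : websterEDist P x y < δ) :
    ∃ γ : ℝ → M, ContinuousOn γ (Icc 0 1) ∧ γ 0 = x ∧ γ 1 = y ∧
      ∀ t ∈ Icc (0 : ℝ) 1, ‖ψ (γ t) - ψ x‖ₑ < δ := by
  let _ := websterENorm P
  obtain ⟨γ, h0, h1, hγ, hl⟩ := Manifold.exists_lt_of_riemannianEDist_lt hxy
  refine ⟨γ, hγ.continuousOn, h0, h1, fun t ht => ?_⟩
  have hsub : Icc 0 t ⊆ Icc 0 1 := Icc_subset_Icc le_rfl ht.2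
  have e1 := enorm_sub_le_lintegral_deriv_of_contDiffOn_Icc
    (h.contDiffOn_comp (hγ.mono hsub)) ht.1
  rw [← restrict_Ioo_eq_restrict_Icc, ← h.websterLength_eq (hγ.mono hsub)] at e1
  simp only [Function.comp_apply, h0] at e1
  exact (e1.trans (Manifold.pathELength_mono le_rfl ht.2)).trans_lt hl

theorem exists_isSheet (h : IsCRIsometricImmersion P ψ) (hρ : RoundModel ρ L r)
    (h0 : ∀ x, ρ (ψ x) = 0) (x : M) : ∃ V G, IsSheet ρ ψ x V G := by
  obtain ⟨U, V, G, hU, hx, hV, him, hG, hGU⟩ := h.exists_local_inverse hρ h0 x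
  refine ⟨V, G, hV, (him.subset ⟨x, hx, rfl⟩).2, hG, fun q hq hq0 => ?_, ?_⟩
  · obtain ⟨y, hy, rfl⟩ := him.superset ⟨hq0, hq⟩
    rw [hGU y hy]
  · filter_upwards [hU.mem_nhds hx] with y hy using hGU y hy

theorem isLocallyInjective (h : IsCRIsometricImmersion P ψ) (hρ : RoundModel ρ L r)
    (h0 : ∀ x, ρ (ψ x) = 0) : IsLocallyInjective ψ := by
  rw [isLocallyInjective_iff_nhds]
  intro x
  obtain ⟨V, G, hs⟩ := h.exists_isSheet hρ h0 x
  exact ⟨_, hs.left_inv, fun y hy z hz hyz => by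
    rw [← (hy : G (ψ y) = y), ← (hz : G (ψ z) = z), hyz]⟩

/-- Uniqueness of lifts: `ψ` is locally injective and `M` is Hausdorff. -/
theorem eqOn_of_comp_eqOn [T2Space M] (h : IsCRIsometricImmersion P ψ) (hρ : RoundModel ρ L r)
    (h0 : ∀ x, ρ (ψ x) = 0) {A : Type*} [TopologicalSpace A] {s : Set A} (hs : IsPreconnected s)
    {γ γ' : A → M} (hγ : ContinuousOn γ s) (hγ' : ContinuousOn γ' s)
    (he : ∀ t ∈ s, ψ (γ t) = ψ (γ' t)) {a : A} (ha : a ∈ s) (hea : γ a = γ' a) : EqOn γ γ' s :=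
  (T2Space.isSeparatedMap ψ).eqOn_of_comp_eqOn (h.isLocallyInjective hρ h0) hs hγ hγ' he ha hea

/-- Lifts of `C¹` paths are `C¹`. -/
theorem contMDiffOn_lift (h : IsCRIsometricImmersion P ψ) (hρ : RoundModel ρ L r)
    (h0 : ∀ x, ρ (ψ x) = 0) {γ : ℝ → M} {s : Set ℝ} (hγ : ContinuousOn γ s)
    (hc : ContDiffOn ℝ 1 (ψ ∘ γ) s) : ContMDiffOn 𝓘(ℝ, ℝ) (𝓡 3) 1 γ s := by
  intro t ht
  obtain ⟨V, G, hs⟩ := h.exists_isSheet hρ h0 (γ t)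
  have h1 : ContMDiffWithinAt 𝓘(ℝ, ℝ) (𝓡 3) 1 (G ∘ (ψ ∘ γ)) s t :=
    ((hs.smooth.contMDiffAt (hs.isOpen.mem_nhds hs.mem)).of_le
      (by norm_cast)).comp_contMDiffWithinAt t (hc t ht).contMDiffWithinAt
  refine h1.congr_of_eventuallyEq ?_ hs.left_inv.self_of_nhds.symm
  filter_upwards [(hγ t ht).eventually hs.left_inv] with t' ht' using ht'.symm

theorem enorm_sub_le_websterEDist (h : IsCRIsometricImmersion P ψ) (x y : M) :
    ‖ψ y - ψ x‖ₑ ≤ websterEDist P x y := by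
  refine le_of_forall_gt fun δ hδ => ?_
  obtain ⟨γ, -, -, h1, hγ⟩ := h.exists_path hδ
  rw [← h1]
  exact hγ 1 (by simp)

/-- A neighbourhood for the Webster distance is contained in a sheet. -/
theorem exists_ball_of_isSheet [T2Space M] (h : IsCRIsometricImmersion P ψ) (hρ : RoundModel ρ L r)
    (h0 : ∀ x, ρ (ψ x) = 0) {x : M} {V : Set C2} {G : C2 → M} (hs : IsSheet ρ ψ x V G) :
    ∃ δ > 0, ∀ y, websterEDist P x y < δ → G (ψ y) = y := by
  obtain ⟨δ, hδ, hball⟩ := EMetric.mem_nhds_iff.1 (hs.isOpen.mem_nhds hs.mem)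
  refine ⟨δ, hδ, fun y hy => ?_⟩
  obtain ⟨γ, hγ, g0, g1, hγδ⟩ := h.exists_path hy
  have hV : ∀ t ∈ Icc (0 : ℝ) 1, ψ (γ t) ∈ V := fun t ht => hball (by
    rw [Metric.mem_eball, edist_eq_enorm_sub]; exact hγδ t ht)
  have hc : ContinuousOn (G ∘ ψ ∘ γ) (Icc 0 1) :=
    hs.smooth.continuousOn.comp (h.smooth.continuous.comp_continuousOn hγ) hV
  -- Both `G ∘ ψ ∘ γ` and `γ` lift `ψ ∘ γ` starting at `x`, so they agree at the endpoint `y`.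
  have := h.eqOn_of_comp_eqOn hρ h0 isPreconnected_Icc hc hγ
    (fun t ht => hs.right_inv _ (hV t ht) (h0 _)) (left_mem_Icc.2 zero_le_one) (by
      simp only [Function.comp_apply, g0]
      exact hs.left_inv.self_of_nhds)
  have e := this (right_mem_Icc.2 zero_le_one)
  simp only [Function.comp_apply, g1] at e
  exact e

/-- Continuity method: the times up to which a lift exists form a closed set in `[0, 1]`, by
completeness, and any such `T < 1` can be increased, by a sheet at the endpoint. A lift has the same
length as its image, so the speed bound for `c` controls Webster distances. -/
theorem exists_liftsUpTo [T2Space M] (h : IsCRIsometricImmersion P ψ)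
    (hcomplete : WebsterComplete P) (hρ : RoundModel ρ L r) (h0 : ∀ x, ρ (ψ x) = 0)
    {c : ℝ → C2} (hc : ContDiffOn ℝ 1 c (Icc 0 1)) (hcρ : ∀ t ∈ Icc (0 : ℝ) 1, ρ (c t) = 0) {x : M}
    (hx : ψ x = c 0) : ∃ γ, LiftsUpTo ψ c x 1 γ := by
  obtain ⟨C, hC⟩ : ∃ C, ∀ t ∈ Ioo (0 : ℝ) 1, ‖deriv c t‖ ≤ C := by
    obtain ⟨C, hC⟩ := isCompact_Icc.exists_bound_of_continuousOn
      (hc.continuousOn_derivWithin (uniqueDiffOn_Icc zero_lt_one) le_rfl)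
    refine ⟨C, fun t ht => ?_⟩
    rw [← derivWithin_of_mem_nhds (Icc_mem_nhds ht.1 ht.2)]
    exact hC t (Ioo_subset_Icc_self ht)
  have hdist : ∀ {T γ}, T ≤ 1 → LiftsUpTo ψ c x T γ → ∀ s t, 0 ≤ s → s ≤ t → t ≤ T →
      websterEDist P (γ s) (γ t) ≤ ENNReal.ofReal C * ENNReal.ofReal (t - s) := by
    intro T γ hT hl s t hs hst ht
    have hsub : Icc s t ⊆ Icc 0 T := Icc_subset_Icc hs ht
    have hcγ : ContDiffOn ℝ 1 (ψ ∘ γ) (Icc s t) :=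
      (hc.mono (hsub.trans (Icc_subset_Icc le_rfl hT))).congr fun u hu => hl.2.2 u (hsub hu)
    refine h.websterEDist_le (h.contMDiffOn_lift hρ h0 (hl.1.mono hsub) hcγ) hst fun u hu => ?_
    have e : ψ ∘ γ =ᶠ[𝓝 u] c := by
      filter_upwards [Icc_mem_nhds hu.1 hu.2] with v hv using hl.2.2 v (hsub hv)
    rw [e.deriv_eq]
    exact hC u ⟨hs.trans_lt hu.1, hu.2.trans_le (ht.trans hT)⟩
  have hsub : Icc (0 : ℝ) 1 ⊆ {T | ∃ γ, LiftsUpTo ψ c x T γ} := by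
    refine IsClosed.Icc_subset_of_forall_exists_gt ?_ ?_ ?_
    · refine isClosed_of_closure_subset fun T hT => ?_
      obtain ⟨t, ht, htT⟩ := mem_closure_iff_seq_limit.1 hT
      have hT01 : T ∈ Icc (0 : ℝ) 1 := isClosed_Icc.mem_of_tendsto htT
        (Filter.Eventually.of_forall fun n => (ht n).2)
      refine ⟨?_, hT01⟩
      by_cases hex : ∃ n, T ≤ t n
      · obtain ⟨n, hn⟩ := hex
        obtain ⟨γ, hγ⟩ := (ht n).1
        exact ⟨γ, hγ.mono hn⟩
      push Not at hex
      choose γ hγ using fun n => (ht n).1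
      -- By uniqueness the lift up to `t m` is a restriction of the lift up to `t n`, so the
      -- endpoints are joined by a piece of a single lift.
      have hle : ∀ m n, t m ≤ t n → websterEDist P (γ m (t m)) (γ n (t n))
          ≤ ENNReal.ofReal C * ENNReal.ofReal (t n - t m) := by
        intro m n hmn
        have e := h.eqOn_of_comp_eqOn hρ h0 isPreconnected_Icc (hγ m).1 ((hγ n).mono hmn).1
          (fun s hs => ((hγ m).2.2 s hs).trans (((hγ n).mono hmn).2.2 s hs).symm)
          (left_mem_Icc.2 (ht m).2.1) ((hγ m).2.1.trans (hγ n).2.1.symm)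
        rw [e (right_mem_Icc.2 (ht m).2.1)]
        exact hdist (ht n).2.2 (hγ n) _ _ (ht m).2.1 hmn le_rfl
      have hle' : ∀ m n, websterEDist P (γ m (t m)) (γ n (t n))
          ≤ ENNReal.ofReal C * ENNReal.ofReal |t n - t m| := by
        intro m n
        rcases le_total (t m) (t n) with hmn | hmn
        · rw [abs_of_nonneg (sub_nonneg.2 hmn)]; exact hle m n hmn
        · rw [abs_of_nonpos (sub_nonpos.2 hmn), neg_sub, h.websterEDist_comm]; exact hle n m hmn
      obtain ⟨x', hx'⟩ := hcomplete (fun n => γ n (t n)) (by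
        intro ε hε
        have hlim : Filter.Tendsto (fun δ : ℝ => ENNReal.ofReal C * ENNReal.ofReal δ) (𝓝 0)
            (𝓝 0) := by
          have := ENNReal.Tendsto.const_mul (a := ENNReal.ofReal C)
            (ENNReal.continuous_ofReal.tendsto 0) (Or.inr ENNReal.ofReal_ne_top)
          simpa using this
        obtain ⟨δ, hδ, hδε⟩ := Metric.eventually_nhds_iff.1 (hlim.eventually_lt_const hε)
        obtain ⟨N, hN⟩ := Metric.cauchySeq_iff.1 htT.cauchySeq δ hδ
        refine ⟨N, fun m hm n hn => (hle' m n).trans_lt (hδε ?_)⟩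
        rw [Real.dist_eq, sub_zero, abs_abs, ← Real.dist_eq]
        exact hN n hn m hm)
      -- Convergence to `x'` holds for the Webster distance. A sheet at `x'` inverts `ψ` on a
      -- Webster ball, hence at the endpoint of some late lift, which is then prolonged to `T`.
      obtain ⟨V, G, hs⟩ := h.exists_isSheet hρ h0 x'
      obtain ⟨δ, hδ, hball⟩ := h.exists_ball_of_isSheet hρ h0 hs
      have hψt : ∀ n, ψ (γ n (t n)) = c (t n) := fun n =>
        (hγ n).2.2 _ (right_mem_Icc.2 (ht n).2.1)
      have hcT : Filter.Tendsto (fun n => c (t n)) Filter.atTop (𝓝 (c T)) :=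
        (hc.continuousOn T hT01).tendsto.comp (tendsto_nhdsWithin_iff.2
          ⟨htT, Filter.Eventually.of_forall fun n => (ht n).2⟩)
      have hcx : Filter.Tendsto (fun n => c (t n)) Filter.atTop (𝓝 (ψ x')) := by
        rw [EMetric.tendsto_nhds]
        intro ε hε
        filter_upwards [hx'.eventually_lt_const hε] with n hn
        rw [edist_comm, edist_eq_enorm_sub, ← hψt]
        exact (h.enorm_sub_le_websterEDist _ _).trans_lt hn
      have hcTx : c T = ψ x' := tendsto_nhds_unique hcT hcx
      have hVn : c ⁻¹' V ∈ 𝓝[Icc 0 1] T :=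
        (hc.continuousOn T hT01) (by rw [hcTx]; exact hs.isOpen.mem_nhds hs.mem)
      obtain ⟨ε, hε, hεV⟩ := Metric.mem_nhdsWithin_iff.1 hVn
      obtain ⟨n, hn1, hn2⟩ := ((hx'.eventually_lt_const hδ).and
        (htT.eventually (Metric.ball_mem_nhds T hε))).exists
      have hsubn : Icc (t n) T ⊆ Icc 0 1 := Icc_subset_Icc (ht n).2.1 hT01.2
      refine (hγ n).extend (ht n).2.1 hs (hex n).le (hc.continuousOn.mono hsubn)
        (fun s hs => hcρ s (hsubn hs)) (fun s hs => hεV ⟨?_, hsubn hs⟩) ?_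
      · rw [Real.dist_eq] at hn2
        rw [Metric.mem_ball, Real.dist_eq]
        rw [abs_of_nonpos (by linarith [hs.2])]
        have := hs.1
        have := neg_le_abs (t n - T)
        linarith
      · rw [← hψt]
        exact hball _ (by rw [h.websterEDist_comm]; exact hn1)
    · refine ⟨fun _ => x, continuousOn_const, rfl, fun t ht => ?_⟩
      rw [le_antisymm ht.2 ht.1, hx]
    · rintro T ⟨⟨γ, hγ⟩, hT⟩ T' hT'
      obtain ⟨V, G, hs⟩ := h.exists_isSheet hρ h0 (γ T)
      have hψT := hγ.2.2 T (right_mem_Icc.2 hT.1)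
      have hT01 : T ∈ Icc (0 : ℝ) 1 := ⟨hT.1, hT.2.le⟩
      have hVn : c ⁻¹' V ∈ 𝓝[Icc 0 1] T :=
        (hc.continuousOn T hT01) (by rw [← hψT]; exact hs.isOpen.mem_nhds hs.mem)
      obtain ⟨ε, hε, hεV⟩ := Metric.mem_nhdsWithin_iff.1 hVn
      set T'' := min (min (T + ε / 2) T') 1 with hT''
      have hT1 : T < T'' := lt_min (lt_min (by linarith) hT') hT.2
      have hT2 : T'' ≤ T + ε / 2 := (min_le_left _ _).trans (min_le_left _ _)
      have hT3 : T'' ≤ T' := (min_le_left _ _).trans (min_le_right _ _)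
      have hsubn : Icc T T'' ⊆ Icc 0 1 := Icc_subset_Icc hT.1 (min_le_right _ _)
      refine ⟨T'', hγ.extend hT.1 hs hT1.le (hc.continuousOn.mono hsubn)
        (fun s hs => hcρ s (hsubn hs)) (fun s hs => hεV ⟨?_, hsubn hs⟩) ?_, hT1, hT3⟩
      · rw [Metric.mem_ball, Real.dist_eq, abs_of_nonneg (by linarith [hs.1])]
        linarith [hs.2]
      · rw [← hψT]
        exact hs.left_inv.self_of_nhds
  exact hsub (right_mem_Icc.2 zero_le_one)

end IsCRIsometricImmersion

end PathLifting

/-! ### Covering maps from liftings of a contraction -/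

section Covering

open Set unitInterval

variable {E X : Type*} [TopologicalSpace E] [TopologicalSpace X] {f : E → X}

/-- A local homeomorphism is evenly covered over an open set on which its points are organized in
disjoint continuous sections. -/
theorem isEvenlyCovered_of_sections (hf : IsLocalHomeomorph f) {U : Set X}
    (hU : IsOpen U) (p : U) (s : f ⁻¹' {(p : X)} → U → E) (hs : ∀ i, Continuous (s i))
    (hfs : ∀ i q, f (s i q) = q) (hsurj : ∀ y, ∀ hy : f y ∈ U, ∃ i, s i ⟨f y, hy⟩ = y)
    (hinj : ∀ i j q, s i q = s j q → i = j) :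
    IsEvenlyCovered f p (f ⁻¹' {(p : X)}) := by
  have hdisc : DiscreteTopology (f ⁻¹' {(p : X)}) := by
    rw [discreteTopology_iff_locallyInjective (p : X)]
    have h := hf.isLocallyInjective.comp_right (g := ((↑) : f ⁻¹' {(p : X)} → E))
      continuous_subtype_val Subtype.val_injective
    have e : f ∘ ((↑) : f ⁻¹' {(p : X)} → E) = fun _ => (p : X) := funext fun i => i.2
    rwa [e] at h
  -- A section of a local homeomorphism over an open set is an open embedding, since its composite
  -- with `f` is the inclusion.
  have hopen : ∀ i, IsOpenMap (s i) := fun i =>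
    (hf.isOpenEmbedding_of_comp (f := s i)
      ((funext (hfs i) : f ∘ s i = Subtype.val) ▸ hU.isOpenEmbedding_subtypeVal) (hs i)).isOpenMap
  set F : U × f ⁻¹' {(p : X)} → f ⁻¹' U := fun a => ⟨s a.2 a.1, by
    rw [mem_preimage, hfs]; exact a.1.2⟩ with hF
  have hFc : Continuous F :=
    continuous_prod_of_discrete_right.2 fun i => (hs i).subtype_mk _
  have hFb : Function.Bijective F := by
    refine ⟨fun a b hab => ?_, fun y => ?_⟩
    · have e : s a.2 a.1 = s b.2 b.1 := congrArg Subtype.val hab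
      have e1 : a.1 = b.1 := Subtype.ext (by rw [← hfs a.2 a.1, e, hfs])
      rw [e1] at e
      exact Prod.ext e1 (hinj _ _ _ e)
    · obtain ⟨i, hi⟩ := hsurj y y.2
      exact ⟨(⟨f y, y.2⟩, i), Subtype.ext hi⟩
  have hFo : IsOpenMap F := by
    intro W hW
    have e : F '' W = Subtype.val ⁻¹' ⋃ i, s i '' ((fun q => (q, i)) ⁻¹' W) := by
      ext y
      simp only [mem_image, mem_preimage, mem_iUnion]
      constructor
      · rintro ⟨a, ha, rfl⟩
        exact ⟨a.2, a.1, ha, rfl⟩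
      · rintro ⟨i, q, hq, e⟩
        exact ⟨(q, i), hq, Subtype.ext e⟩
    rw [e]
    exact (isOpen_iUnion fun i => hopen i _ (hW.preimage (by fun_prop))).preimage
      continuous_subtype_val
  refine ⟨hdisc, U, p.2, hU, hU.preimage hf.continuous,
    ((Equiv.ofBijective F hFb).toHomeomorphOfContinuousOpen hFc hFo).symm, fun y => ?_⟩
  obtain ⟨a, rfl⟩ := hFb.2 y
  have e : ((Equiv.ofBijective F hFb).toHomeomorphOfContinuousOpen hFc hFo).symm (F a) = a :=
    ((Equiv.ofBijective F hFb).toHomeomorphOfContinuousOpen hFc hFo).symm_apply_apply a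
  rw [e]
  exact (hfs a.2 a.1).symm

/-- A map has the lifting property for the path `c`. -/
def LiftsPath (f : E → X) (c : I → X) : Prop :=
  ∀ x, f x = c 0 → ∃ γ : C(I, E), γ 0 = x ∧ ∀ t, f (γ t) = c t

/-- If a local homeomorphism lifts the paths of a contraction of `A` to a point and their
reverses, then the points over `A` are organized in disjoint continuous sections. -/
theorem exists_sections [T2Space E] (hf : IsLocalHomeomorph f) {A : Set X}
    (p : A) (H : C(I × A, X)) (H0 : ∀ q, H (0, q) = p) (H1 : ∀ q, H (1, q) = q)
    (Hp : ∀ t, H (t, p) = p) (hl : ∀ q, LiftsPath f fun t => H (t, q))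
    (hl' : ∀ q, LiftsPath f fun t => H (σ t, q)) :
    ∃ s : f ⁻¹' {(p : X)} → A → E, (∀ i, Continuous (s i)) ∧ (∀ i q, f (s i q) = q) ∧
      (∀ i, s i p = i) ∧ (∀ y, ∀ hy : f y ∈ A, ∃ i, s i ⟨f y, hy⟩ = y) ∧
      ∀ i j q, s i q = s j q → i = j := by
  have sep : IsSeparatedMap f := T2Space.isSeparatedMap f
  -- The section through a point `i` of the fibre sends `q` to the endpoint of the lift of `t ↦ H
  -- (t, q)` from `i`.
  choose g hg0 hg using fun (i : f ⁻¹' {(p : X)}) (q : A) => hl q i (i.2.trans (H0 q).symm)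
  have huniq : ∀ i q (γ : C(I, E)), (∀ t, f (γ t) = H (t, q)) → ∀ t₀, γ t₀ = g i q t₀ →
      ∀ t, γ t = g i q t := fun i q γ hγ t₀ ht₀ t =>
    congrFun (sep.eq_of_comp_eq hf.isLocallyInjective γ.continuous (g i q).continuous
      (funext fun t => (hγ t).trans (hg i q t).symm) t₀ ht₀) t
  refine ⟨fun i q => g i q 1, fun i => ?_, fun i q => (hg i q 1).trans (H1 q), fun i => ?_,
    fun y hy => ?_, fun i j q hij => ?_⟩
  · have hc := hf.continuous_lift sep H (g := fun a => g i a.2 a.1)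
      (funext fun a => hg i a.2 a.1)
      (continuous_const.congr fun q => (hg0 i q).symm) fun q => (g i q).continuous
    exact hc.comp (by fun_prop : Continuous fun q : A => ((1 : I), q))
  · exact (huniq i p (.const I i) (fun t => i.2.trans (Hp t).symm) 0 (hg0 i p).symm 1).symm
  -- Lift the reversed path from `y` to find the point of the fibre whose section passes through
  -- `y`.
  · obtain ⟨γ, hγ0, hγ⟩ := hl' ⟨f y, hy⟩ y (by simp [H1])
    have hi : f (γ 1) = p := by simp [hγ, H0]
    refine ⟨⟨γ 1, hi⟩, ?_⟩
    have h := huniq ⟨γ 1, hi⟩ ⟨f y, hy⟩ (γ.comp ⟨σ, continuous_symm⟩)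
      (fun t => by simp [hγ]) 0 (by simp [hg0]) 1
    simpa [hγ0] using h.symm
  · have h := huniq j q (g i q) (hg i q) 1 hij 0
    rw [hg0, hg0] at h
    exact Subtype.ext h

end Covering

theorem norm_quatJ (v : C2) : ‖quatJ v‖ = ‖v‖ := by
  rw [← sq_eq_sq₀ (norm_nonneg _) (norm_nonneg _), ← inner_self_eq_norm_sq (𝕜 := ℂ),
    ← inner_self_eq_norm_sq (𝕜 := ℂ), inner_quatJ_quatJ]
  exact RCLike.conj_re _

/-! ### Projected chords on a round hypersurface -/

section Chords

open Set unitInterval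

/-- The segment from `p` to `q`, projected radially to the hypersurface `‖L v‖ = r`. -/
def chord (L : C2 →L[ℝ] C2) (r : ℝ) (p q : C2) (t : ℝ) : C2 :=
  let v := (1 - t) • p + t • q
  (v - L v) + (r / ‖L v‖) • L v

variable {ρ : C2 → ℝ} {L : C2 →L[ℝ] C2} {r : ℝ}

theorem chord_symm (L : C2 →L[ℝ] C2) (r : ℝ) (p q : C2) (t : ℝ) :
    chord L r p q (1 - t) = chord L r q p t := by
  simp only [chord, sub_sub_cancel]
  rw [add_comm (t • p)]

theorem RoundModel.chord_self (h : RoundModel ρ L r) {p : C2} (hp : ρ p = 0) (t : ℝ) :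
    chord L r p p t = p := by
  have e : (1 - t) • p + t • p = p := by rw [← add_smul]; simp
  simp only [chord, e]
  rw [h.norm_eq hp, div_self h.pos.ne', one_smul, sub_add_cancel]

theorem RoundModel.chord_zero (h : RoundModel ρ L r) {p q : C2} (hp : ρ p = 0) :
    chord L r p q 0 = p := by
  simp [chord, h.norm_eq hp, h.pos.ne']

theorem RoundModel.chord_one (h : RoundModel ρ L r) {p q : C2} (hq : ρ q = 0) :
    chord L r p q 1 = q := by
  simp [chord, h.norm_eq hq, h.pos.ne']

/-- `L p` and `L q` have the same norm, so a convex combination of them can vanish only at `t =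
1/2`, and then they are opposite. -/
theorem RoundModel.map_segment_ne_zero (h : RoundModel ρ L r) {p q : C2} (hp : ρ p = 0)
    (hq : ρ q = 0) (hpq : L q ≠ -L p) {t : ℝ} (ht : t ∈ Icc (0 : ℝ) 1) :
    L ((1 - t) • p + t • q) ≠ 0 := by
  intro h0
  rw [map_add, map_smul, map_smul] at h0
  have e1 : (1 - t) • L p = -(t • L q) := eq_neg_of_add_eq_zero_left h0
  have e2 := congrArg norm e1
  rw [norm_neg, norm_smul, norm_smul, h.norm_eq hp, h.norm_eq hq, Real.norm_of_nonneg ht.1,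
    Real.norm_of_nonneg (sub_nonneg.2 ht.2)] at e2
  have e3 : 1 - t = t := mul_right_cancel₀ h.pos.ne' e2
  have ht0 : t ≠ 0 := by rintro rfl; norm_num at e3
  rw [e3, ← smul_neg] at e1
  exact hpq (by rw [smul_right_injective C2 ht0 e1, neg_neg])

theorem RoundModel.rho_chord (h : RoundModel ρ L r) {p q : C2} (hp : ρ p = 0)
    (hq : ρ q = 0) (hpq : L q ≠ -L p) {t : ℝ} (ht : t ∈ Icc (0 : ℝ) 1) :
    ρ (chord L r p q t) = 0 := by
  have h0 := h.map_segment_ne_zero hp hq hpq ht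
  rw [h.eq_zero_iff]
  simp only [chord]
  rw [map_add, map_sub, map_smul, h.idem, sub_self, zero_add, norm_smul, norm_div, norm_norm,
    Real.norm_of_nonneg h.pos.le, div_mul_cancel₀ _ (norm_ne_zero_iff.2 h0)]

theorem RoundModel.contDiffOn_chord (h : RoundModel ρ L r) {p q : C2} (hp : ρ p = 0)
    (hq : ρ q = 0) (hpq : L q ≠ -L p) : ContDiffOn ℝ 1 (chord L r p q) (Icc 0 1) := by
  intro t ht
  have h0 := h.map_segment_ne_zero hp hq hpq ht
  have hv : ContDiffAt ℝ 1 (fun t : ℝ => (1 - t) • p + t • q) t := by fun_prop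
  have hL : ContDiffAt ℝ 1 (fun t : ℝ => L ((1 - t) • p + t • q)) t :=
    L.contDiff.contDiffAt.comp t hv
  exact ((hv.sub hL).add ((contDiffAt_const.div (hL.norm ℝ h0)
    (norm_ne_zero_iff.2 h0)).smul hL)).contDiffWithinAt

/-- The points of the hypersurface joined to `p` by a chord. -/
def nonAntipodal (ρ : C2 → ℝ) (L : C2 →L[ℝ] C2) (p : Hypersurface ρ) : Set (Hypersurface ρ) :=
  {q | L q ≠ -L p}

theorem isOpen_nonAntipodal (p : Hypersurface ρ) : IsOpen (nonAntipodal ρ L p) :=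
  isOpen_ne_fun (L.continuous.comp continuous_subtype_val) continuous_const

theorem RoundModel.self_mem_nonAntipodal (h : RoundModel ρ L r) (p : Hypersurface ρ) :
    p ∈ nonAntipodal ρ L p := by
  intro e
  have e0 : L p = 0 := by
    have e2 : (2 : ℝ) • L p = 0 := by rw [two_smul]; exact eq_neg_iff_add_eq_zero.1 e
    exact (smul_eq_zero.1 e2).resolve_left two_ne_zero
  have e1 := h.norm_eq p.2
  rw [e0, norm_zero] at e1
  exact h.pos.ne e1

/-- The chords issuing from a point. -/
def RoundModel.chordMap (h : RoundModel ρ L r) (p : Hypersurface ρ) :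
    C(I × nonAntipodal ρ L p, Hypersurface ρ) where
  toFun a := ⟨chord L r p a.2 a.1, h.rho_chord p.2 a.2.1.2 a.2.2 a.1.2⟩
  continuous_toFun := by
    have hv : Continuous fun a : I × nonAntipodal ρ L p =>
        (1 - (a.1 : ℝ)) • (p : C2) + (a.1 : ℝ) • ((a.2 : Hypersurface ρ) : C2) := by fun_prop
    have hL := L.continuous.comp hv
    exact ((hv.sub hL).add ((continuous_const.div hL.norm fun a => norm_ne_zero_iff.2
      (h.map_segment_ne_zero p.2 a.2.1.2 a.2.2 a.1.2)).smul hL)).subtype_mk _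

end Chords

/-! ### The immersion covers its model -/

section ModelCovering

open Set unitInterval

variable {M : Type*} [TopologicalSpace M] [T2Space M] [ChartedSpace (EuclideanSpace ℝ (Fin 3)) M]
  [IsManifold (𝓡 3) ∞ M] {S : CRStructure M} {P : Pseudohermitian S} {ψ : M → C2}
  {ρ : C2 → ℝ} {L : C2 →L[ℝ] C2} {r : ℝ}

namespace IsCRIsometricImmersion

theorem liftsPath_chordMap (h : IsCRIsometricImmersion P ψ) (hcomplete : WebsterComplete P)
    (hρ : RoundModel ρ L r) (h0 : ∀ x, ρ (ψ x) = 0) (p : Hypersurface ρ)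
    (q : nonAntipodal ρ L p) :
    LiftsPath (fun x => (⟨ψ x, h0 x⟩ : Hypersurface ρ)) fun t => hρ.chordMap p (t, q) := by
  intro x hx
  have hx' : ψ x = chord L r p q 0 := congrArg Subtype.val hx
  obtain ⟨γ, hγ, hγ0, hγψ⟩ := h.exists_liftsUpTo hcomplete hρ h0
    (hρ.contDiffOn_chord p.2 q.1.2 q.2) (fun t ht => hρ.rho_chord p.2 q.1.2 q.2 ht) hx'
  exact ⟨⟨fun t => γ t, continuousOn_iff_continuous_domRestrict.1 hγ⟩, hγ0,
    fun t => Subtype.ext (hγψ t t.2)⟩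

theorem liftsPath_chordMap_symm (h : IsCRIsometricImmersion P ψ) (hcomplete : WebsterComplete P)
    (hρ : RoundModel ρ L r) (h0 : ∀ x, ρ (ψ x) = 0) (p : Hypersurface ρ)
    (q : nonAntipodal ρ L p) :
    LiftsPath (fun x => (⟨ψ x, h0 x⟩ : Hypersurface ρ)) fun t => hρ.chordMap p (σ t, q) := by
  have hq : p ∈ nonAntipodal ρ L q.1 := fun e => q.2 (by rw [e, neg_neg])
  have e : (fun t => hρ.chordMap p (σ t, q)) = fun t => hρ.chordMap q.1 (t, ⟨p, hq⟩) :=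
    funext fun t => Subtype.ext (chord_symm L r p q t)
  rw [e]
  exact h.liftsPath_chordMap hcomplete hρ h0 q.1 ⟨p, hq⟩

/-- The chords from `p` contract the non-antipodal set to `p`; they and their reverses, again
chords, lift by completeness. -/
theorem exists_sections (h : IsCRIsometricImmersion P ψ) (hpos : LeviPositive P)
    (hcomplete : WebsterComplete P)
    (hρ : RoundModel ρ L r) {Ψ : M → Hypersurface ρ} (hΨ : ∀ x, (Ψ x : C2) = ψ x)
    (p : Hypersurface ρ) :
    ∃ s : Ψ ⁻¹' {p} → nonAntipodal ρ L p → M, (∀ i, Continuous (s i)) ∧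
      (∀ i q, Ψ (s i q) = q) ∧ (∀ i, s i ⟨p, hρ.self_mem_nonAntipodal p⟩ = i) ∧
      (∀ y, ∀ hy : Ψ y ∈ nonAntipodal ρ L p, ∃ i, s i ⟨Ψ y, hy⟩ = y) ∧
      ∀ i j q, s i q = s j q → i = j := by
  have h0 : ∀ x, ρ (ψ x) = 0 := fun x => hΨ x ▸ (Ψ x).2
  obtain rfl : Ψ = fun x => ⟨ψ x, h0 x⟩ := funext fun x => Subtype.ext (hΨ x)
  exact CRGeom.exists_sections (h.isLocalCRDiffeo hpos hρ h0).isLocalHomeomorph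
    ⟨p, hρ.self_mem_nonAntipodal p⟩ (hρ.chordMap p)
    (fun q => Subtype.ext (hρ.chord_zero p.2)) (fun q => Subtype.ext (hρ.chord_one q.1.2))
    (fun t => Subtype.ext (hρ.chord_self p.2 t))
    (h.liftsPath_chordMap hcomplete hρ h0 p) (h.liftsPath_chordMap_symm hcomplete hρ h0 p)

theorem isCoveringMap (h : IsCRIsometricImmersion P ψ) (hpos : LeviPositive P)
    (hcomplete : WebsterComplete P) (hρ : RoundModel ρ L r) {Ψ : M → Hypersurface ρ}
    (hΨ : ∀ x, (Ψ x : C2) = ψ x) (hloc : IsLocalHomeomorph Ψ) : IsCoveringMap Ψ := by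
  intro p
  obtain ⟨s, hs, hfs, -, hsurj, hinj⟩ := h.exists_sections hpos hcomplete hρ hΨ p
  exact isEvenlyCovered_of_sections hloc (isOpen_nonAntipodal p)
    ⟨p, hρ.self_mem_nonAntipodal p⟩ s hs hfs hsurj hinj

theorem exists_of_ne_neg (h : IsCRIsometricImmersion P ψ) (hpos : LeviPositive P)
    (hcomplete : WebsterComplete P) (hρ : RoundModel ρ L r) {Ψ : M → Hypersurface ρ}
    (hΨ : ∀ x, (Ψ x : C2) = ψ x) (x : M) {q : Hypersurface ρ} (hq : L q ≠ -L (Ψ x)) :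
    ∃ y, Ψ y = q := by
  obtain ⟨s, -, hfs, -⟩ := h.exists_sections hpos hcomplete hρ hΨ (Ψ x)
  exact ⟨s ⟨x, rfl⟩ ⟨q, hq⟩, hfs _ _⟩

/-- The only points that a chord from `Ψ x` may miss are antipodal, and these are reached in two
steps through `quatJ (Ψ x)`. As `L` commutes with `quatJ`, its projection is orthogonal to `L (Ψ
x)`, hence antipodal to neither end. -/
theorem surjective [Nonempty M] (h : IsCRIsometricImmersion P ψ) (hpos : LeviPositive P)
    (hcomplete : WebsterComplete P) (hρ : RoundModel ρ L r)
    (hJ : ∀ v, L (quatJ v) = quatJ (L v)) {Ψ : M → Hypersurface ρ}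
    (hΨ : ∀ x, (Ψ x : C2) = ψ x) : Function.Surjective Ψ := by
  intro q
  obtain ⟨x⟩ := ‹Nonempty M›
  by_cases hq : L q = -L (Ψ x)
  · have hm : ρ (quatJ (Ψ x)) = 0 := by
      rw [hρ.eq_zero_iff, hJ, norm_quatJ, hρ.norm_eq (Ψ x).2]
    have hne : L (Ψ x) ≠ 0 := by
      rw [← norm_ne_zero_iff, hρ.norm_eq (Ψ x).2]; exact hρ.pos.ne'
    have hself := inner_quatJ_self (L (Ψ x))
    have hpp : inner ℂ (L (Ψ x)) (L (Ψ x)) ≠ (0 : ℂ) := inner_self_ne_zero.2 hne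
    obtain ⟨y, hy⟩ := h.exists_of_ne_neg hpos hcomplete hρ hΨ x (q := ⟨quatJ (Ψ x), hm⟩) (by
      intro e
      rw [hJ] at e
      rw [e, inner_neg_left, neg_eq_zero] at hself
      exact hpp hself)
    refine h.exists_of_ne_neg hpos hcomplete hρ hΨ y ?_
    rw [hy, hq]
    intro e
    rw [hJ, neg_inj] at e
    rw [← e] at hself
    exact hpp hself
  · exact h.exists_of_ne_neg hpos hcomplete hρ hΨ x hq

end IsCRIsometricImmersion

end ModelCovering

/-! ### Gluing sections -/

section Gluing

open Set

variable {E X : Type*} [TopologicalSpace E] [TopologicalSpace X] {f : E → X}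

/-- Sections over two open sets that cover the base and have a connected intersection are glued
if they agree at one point. -/
theorem exists_glued_section [T2Space E] (hf : IsLocalHomeomorph f) {A B : Set X} (hA : IsOpen A)
    (hB : IsOpen B) (hAB : A ∪ B = univ) (hc : IsPreconnected (A ∩ B)) {s : A → E} {s' : B → E}
    (hs : Continuous s) (hs' : Continuous s') (hfs : ∀ q, f (s q) = q) (hfs' : ∀ q, f (s' q) = q)
    {m : X} (hmA : m ∈ A) (hmB : m ∈ B) (hm : s ⟨m, hmA⟩ = s' ⟨m, hmB⟩) :
    ∃ g : X → E, Continuous g ∧ ∀ q, f (g q) = q := by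
  classical
  have : PreconnectedSpace ↥(A ∩ B) := isPreconnected_iff_preconnectedSpace.1 hc
  have heq : ∀ q : ↥(A ∩ B), s ⟨q, q.2.1⟩ = s' ⟨q, q.2.2⟩ := fun q =>
    congrFun ((T2Space.isSeparatedMap f).eq_of_comp_eq hf.isLocallyInjective
      (g₁ := fun q : ↥(A ∩ B) => s ⟨q, q.2.1⟩) (g₂ := fun q => s' ⟨q, q.2.2⟩)
      (hs.comp (by fun_prop)) (hs'.comp (by fun_prop))
      (funext fun q => (hfs ⟨q, q.2.1⟩).trans (hfs' ⟨q, q.2.2⟩).symm) ⟨m, hmA, hmB⟩ hm) q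
  have hBA : ∀ q, q ∉ A → q ∈ B := fun q hq =>
    (hAB.symm ▸ mem_univ q : q ∈ A ∪ B).resolve_left hq
  let g : X → E := fun q => if hq : q ∈ A then s ⟨q, hq⟩ else s' ⟨q, hBA q hq⟩
  have gA : A.domRestrict g = s := funext fun q => dif_pos q.2
  have gB : B.domRestrict g = s' := funext fun q => by
    by_cases hq : (q : X) ∈ A
    · exact (dif_pos hq).trans (heq ⟨q, hq, q.2⟩)
    · exact dif_neg hq
  refine ⟨g, ?_, fun q => ?_⟩
  · rw [← continuousOn_univ, ← hAB]
    exact (continuousOn_iff_continuous_domRestrict.2 (gA ▸ hs)).union_of_isOpen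
      (continuousOn_iff_continuous_domRestrict.2 (gB ▸ hs')) hA hB
  · by_cases hq : q ∈ A
    · exact (congrArg f (dif_pos hq)).trans (hfs _)
    · exact (congrArg f (dif_neg hq)).trans (hfs' _)

/-- The image of a section is open, and it is closed as the set where `s ∘ f` is the identity;
connectedness concludes. -/
theorem surjective_of_section [T2Space E] [ConnectedSpace E] [Nonempty X]
    (hf : IsLocalHomeomorph f) {s : X → E}
    (hs : Continuous s) (hfs : ∀ q, f (s q) = q) : Function.Surjective s := by
  have hopen : IsOpen (range s) := (hf.isOpenEmbedding_of_comp (f := s)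
    ((funext hfs : f ∘ s = id) ▸ Topology.IsOpenEmbedding.id) hs).isOpen_range
  have e : range s = {x | s (f x) = x} := by
    ext x
    exact ⟨by rintro ⟨q, rfl⟩; exact congrArg s (hfs q), fun hx => ⟨f x, hx⟩⟩
  have hclosed : IsClosed (range s) := by
    rw [e]
    exact isClosed_eq (hs.comp hf.continuous) continuous_id
  exact range_eq_univ.1 (IsClopen.eq_univ ⟨hclosed, hopen⟩ (range_nonempty s))

end Gluing

/-! ### Topology of the two models -/

section Models

open Set

variable {ρ : C2 → ℝ} {r : ℝ}

/-- The set is the radial image of the complement of the real line through `p`, which is connected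
because that line has codimension 3 in ℂ². -/
theorem RoundModel.isPreconnected_inter (h : RoundModel ρ (.id ℝ C2) r) {p : C2}
    (hp : ρ p = 0) : IsPreconnected {q : Hypersurface ρ | (q : C2) ≠ -p ∧ (q : C2) ≠ p} := by
  have hpn : ‖p‖ = r := h.norm_eq hp
  have hp0 : p ≠ 0 := norm_ne_zero_iff.1 (hpn ▸ h.pos.ne')
  have hcodim : 1 < Module.rank ℝ (C2 ⧸ Submodule.span ℝ {p}) := by
    have e := Submodule.finrank_quotient_add_finrank (Submodule.span ℝ {p})
    rw [finrank_span_singleton hp0, finrank_real_C2] at e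
    rw [← Module.finrank_eq_rank]
    exact_mod_cast (by omega : 1 < Module.finrank ℝ (C2 ⧸ Submodule.span ℝ {p}))
  have : PreconnectedSpace ↥((Submodule.span ℝ {p} : Set C2)ᶜ) :=
    isPreconnected_iff_preconnectedSpace.1 (isConnected_compl_of_one_lt_codim hcodim).2
  have hv0 : ∀ v : ↥((Submodule.span ℝ {p} : Set C2)ᶜ), ‖(v : C2)‖ ≠ 0 := fun v e =>
    v.2 (norm_eq_zero.1 e ▸ Submodule.zero_mem _)
  let g : ↥((Submodule.span ℝ {p} : Set C2)ᶜ) → Hypersurface ρ := fun v =>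
    ⟨(r / ‖(v : C2)‖) • v, h.eq_zero_iff.2 (by
      rw [ContinuousLinearMap.id_apply, norm_smul, norm_div, norm_norm,
        Real.norm_of_nonneg h.pos.le, div_mul_cancel₀ _ (hv0 v)])⟩
  have hg : Continuous g := Continuous.subtype_mk
    ((continuous_const.div continuous_subtype_val.norm hv0).smul continuous_subtype_val) _
  have e : {q : Hypersurface ρ | (q : C2) ≠ -p ∧ (q : C2) ≠ p} = range g := by
    ext q
    constructor
    · intro hq
      have hqn : ‖(q : C2)‖ = r := h.norm_eq q.2
      refine ⟨⟨q, fun hs => ?_⟩, Subtype.ext ?_⟩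
      · obtain ⟨t, ht⟩ := Submodule.mem_span_singleton.1 hs
        have e1 := congrArg norm ht
        rw [norm_smul, hpn, hqn] at e1
        have e2 : |t| = 1 := mul_right_cancel₀ h.pos.ne' (e1.trans (one_mul r).symm)
        rcases eq_or_eq_neg_of_abs_eq e2 with rfl | rfl
        · exact hq.2 (by rw [← ht, one_smul])
        · exact hq.1 (by rw [← ht, neg_one_smul])
      · change (r / ‖(q : C2)‖) • (q : C2) = q
        rw [hqn, div_self h.pos.ne', one_smul]
    · rintro ⟨v, rfl⟩
      have hc : r / ‖(v : C2)‖ ≠ 0 := div_ne_zero h.pos.ne' (hv0 v)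
      have hmem : (r / ‖(v : C2)‖) • (v : C2) ∉ Submodule.span ℝ {p} := fun hm =>
        v.2 ((Submodule.smul_mem_iff _ hc).1 hm)
      refine ⟨fun hv => hmem ?_, fun hv => hmem ?_⟩
      · rw [show (r / ‖(v : C2)‖) • (v : C2) = -p from hv]
        exact Submodule.neg_mem _ (Submodule.mem_span_singleton_self p)
      · rw [show (r / ‖(v : C2)‖) • (v : C2) = p from hv]
        exact Submodule.mem_span_singleton_self p
  rw [e]
  exact isPreconnected_range hg

theorem roundModel_rhoSphere : RoundModel rhoSphere (.id ℝ C2) 2 where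
  pos := two_pos
  idem _ := rfl
  symm _ _ := rfl
  rho_eq p := by
    rw [rhoSphere, ContinuousLinearMap.id_apply, EuclideanSpace.norm_sq_eq, Fin.sum_univ_two]
    norm_num

/-- The projection `(z, w) ↦ (Re z, Re w)`. -/
def rePart : C2 →L[ℝ] C2 :=
  LinearMap.toContinuousLinearMap
    { toFun := fun p => !₂[((p 0).re : ℂ), ((p 1).re : ℂ)]
      map_add' := fun p q => by ext i; fin_cases i <;> simp
      map_smul' := fun t p => by ext i; fin_cases i <;> simp }

@[simp] theorem rePart_apply_zero (p : C2) : rePart p 0 = (p 0).re := rfl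

@[simp] theorem rePart_apply_one (p : C2) : rePart p 1 = (p 1).re := rfl

theorem rePart_quatJ (p : C2) : rePart (quatJ p) = quatJ (rePart p) := by
  ext i; fin_cases i <;> simp

theorem roundModel_rhoCylinder : RoundModel rhoCylinder rePart 1 where
  pos := one_pos
  idem p := by ext i; fin_cases i <;> simp
  symm p q := by
    rw [← re_inner_C2, ← re_inner_C2]
    simp [PiLp.inner_apply, Fin.sum_univ_two]
  rho_eq p := by
    rw [rhoCylinder, EuclideanSpace.norm_sq_eq, Fin.sum_univ_two]
    simp

theorem compactSpace_rhoSphere : CompactSpace (Hypersurface rhoSphere) := by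
  refine isCompact_iff_compactSpace.1 (Metric.isCompact_of_isClosed_isBounded ?_ ?_)
  · exact isClosed_eq (by unfold rhoSphere; fun_prop) continuous_const
  · refine (Metric.isBounded_closedBall (x := (0 : C2)) (r := 2)).subset fun p hp => ?_
    rw [mem_closedBall_zero_iff]
    exact (roundModel_rhoSphere.norm_eq hp).le

theorem not_compactSpace_rhoCylinder : ¬ CompactSpace (Hypersurface rhoCylinder) := by
  intro hc
  have hb := (isCompact_range (continuous_subtype_val (p := fun p => rhoCylinder p = 0))).isBounded
  obtain ⟨R, hR⟩ := hb.exists_norm_le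
  have hp : rhoCylinder !₂[(1 : ℂ) + (R + 1 : ℝ) * Complex.I, 0] = 0 := by
    simp [rhoCylinder]
  have h1 := hR _ ⟨⟨_, hp⟩, rfl⟩
  have h2 : |((1 : ℂ) + (R + 1 : ℝ) * Complex.I).im| ≤ R :=
    (Complex.abs_im_le_norm _).trans ((PiLp.norm_apply_le _ (0 : Fin 2)).trans h1)
  have h3 : ((1 : ℂ) + (R + 1 : ℝ) * Complex.I).im = R + 1 := by simp
  rw [h3] at h2
  linarith [le_abs_self (R + 1)]

end Models

/-! ### Injectivity over the sphere -/

section Global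

open Set

variable {M : Type*} [TopologicalSpace M] [T2Space M] [ConnectedSpace M]
  [ChartedSpace (EuclideanSpace ℝ (Fin 3)) M]
  [IsManifold (𝓡 3) ∞ M] {S : CRStructure M} {P : Pseudohermitian S} {ψ : M → C2}
  {ρ : C2 → ℝ} {r : ℝ}

/-- The complements of `-p` and of `p` cover the sphere, carry sections by chord lifting, and meet
in a connected set. This replaces simple connectedness of the sphere. -/
theorem IsCRIsometricImmersion.exists_global_section (h : IsCRIsometricImmersion P ψ)
    (hpos : LeviPositive P) (hcomplete : WebsterComplete P) (hρ : RoundModel ρ (.id ℝ C2) r)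
    {Ψ : M → Hypersurface ρ} (hΨ : ∀ x, (Ψ x : C2) = ψ x) (hloc : IsLocalHomeomorph Ψ) :
    ∃ s : Hypersurface ρ → M, Continuous s ∧ ∀ q, Ψ (s q) = q := by
  obtain ⟨x⟩ := (inferInstance : Nonempty M)
  set p := Ψ x with hp
  have hne : (p : C2) ≠ 0 := fun e => by
    have := hρ.norm_eq p.2
    rw [e] at this
    exact hρ.pos.ne (by simpa using this)
  have hn : ρ (-p) = 0 := by
    rw [hρ.eq_zero_iff, map_neg, norm_neg, hρ.norm_eq p.2]
  have hm : ρ (quatJ p) = 0 := by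
    rw [hρ.eq_zero_iff]
    exact (norm_quatJ _).trans (hρ.norm_eq p.2)
  have hself := inner_quatJ_self (p : C2)
  have hpp : inner ℂ (p : C2) (p : C2) ≠ (0 : ℂ) := inner_self_ne_zero.2 hne
  let n : Hypersurface ρ := ⟨-p, hn⟩
  let m : Hypersurface ρ := ⟨quatJ p, hm⟩
  have hmp : m ∈ nonAntipodal ρ (.id ℝ C2) p := fun e => by
    have e : quatJ (p : C2) = -p := e
    rw [e, inner_neg_left, neg_eq_zero] at hself
    exact hpp hself
  have hmn : m ∈ nonAntipodal ρ (.id ℝ C2) n := fun e => by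
    have e : quatJ (p : C2) = - -p := e
    rw [neg_neg] at e
    rw [e] at hself
    exact hpp hself
  obtain ⟨s, hs, hfs, -⟩ := h.exists_sections hpos hcomplete hρ hΨ p
  obtain ⟨s', hs', hfs', -, hsurj, -⟩ := h.exists_sections hpos hcomplete hρ hΨ n
  -- The section around `-p` is chosen to pass through the value at `m = quatJ p` of the section
  -- around `p`, so that the two agree at a point of the overlap.
  have hy : Ψ (s ⟨x, rfl⟩ ⟨m, hmp⟩) = m := hfs _ _
  obtain ⟨i, hi⟩ := hsurj (s ⟨x, rfl⟩ ⟨m, hmp⟩) (hy.symm ▸ hmn)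
  refine exists_glued_section hloc (isOpen_nonAntipodal p) (isOpen_nonAntipodal n) ?_ ?_
    (hs ⟨x, rfl⟩) (hs' i) (hfs _) (hfs' _) hmp hmn ?_
  · refine eq_univ_of_forall fun q => ?_
    by_contra hq
    rw [mem_union, not_or] at hq
    have h1 : (q : C2) = -p := not_not.1 hq.1
    have h2 : (q : C2) = - -p := not_not.1 hq.2
    rw [h1, neg_neg] at h2
    exact hρ.self_mem_nonAntipodal p h2.symm
  · have e : nonAntipodal ρ (.id ℝ C2) p ∩ nonAntipodal ρ (.id ℝ C2) n
        = {q : Hypersurface ρ | (q : C2) ≠ -p ∧ (q : C2) ≠ p} := by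
      ext q
      change _ ∧ (q : C2) ≠ - -p ↔ _
      rw [neg_neg]
      rfl
    rw [e]
    exact hρ.isPreconnected_inter p.2
  · rw [← hi]
    congr 1
    exact Subtype.ext hy

/-- A global section of `Ψ` is surjective onto the connected `M`, so `Ψ` is its two-sided inverse.
-/
theorem IsCRIsometricImmersion.bijective_of_id (h : IsCRIsometricImmersion P ψ)
    (hpos : LeviPositive P) (hcomplete : WebsterComplete P) (hρ : RoundModel ρ (.id ℝ C2) r)
    {Ψ : M → Hypersurface ρ} (hΨ : ∀ x, (Ψ x : C2) = ψ x) (hloc : IsLocalHomeomorph Ψ) :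
    Function.Bijective Ψ := by
  obtain ⟨s, hs, hfs⟩ := h.exists_global_section hpos hcomplete hρ hΨ hloc
  obtain ⟨x⟩ := (inferInstance : Nonempty M)
  have : Nonempty (Hypersurface ρ) := ⟨Ψ x⟩
  exact ⟨((show Function.LeftInverse Ψ s from hfs).rightInverse_of_surjective
    (surjective_of_section hloc hs hfs)).injective, fun q => ⟨s q, hfs q⟩⟩

end Global

end CRGeom

end

theorem mainTheorem4 {M : Type*} [TopologicalSpace M] [T2Space M] [SecondCountableTopology M]
    [ConnectedSpace M] [ChartedSpace (EuclideanSpace ℝ (Fin 3)) M] [IsManifold (𝓡 3) ∞ M]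
    (S : CRGeom.CRStructure M) (P : CRGeom.Pseudohermitian S)
    (hpos : CRGeom.LeviPositive P) (hcomplete : CRGeom.WebsterComplete P)
    (f : M → EuclideanSpace ℝ (Fin 4))
    (hiso : CRGeom.IsIsometricImmersion P f) (hplu : CRGeom.IsCRPluriharmonic S f) :
    (¬ CompactSpace M →
      ∃ (ψ : M → CRGeom.Hypersurface CRGeom.rhoCylinder)
        (φ : CRGeom.C2 ≃ᵢ EuclideanSpace ℝ (Fin 4)),
        CRGeom.IsLocalCRDiffeo S CRGeom.rhoCylinder ψ ∧
        IsCoveringMap ψ ∧ Function.Surjective ψ ∧ ∀ x, f x = φ (ψ x)) ∧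
    (CompactSpace M →
      ∃ (ψ : M → CRGeom.Hypersurface CRGeom.rhoSphere)
        (φ : CRGeom.C2 ≃ᵢ EuclideanSpace ℝ (Fin 4)),
        CRGeom.IsCRDiffeo S CRGeom.rhoSphere ψ ∧ ∀ x, f x = φ (ψ x)) := by
  obtain ⟨ψ₀, φ₀, h₀, hf⟩ := CRGeom.exists_isCRIsometricImmersion hpos hiso hplu
  obtain ⟨U, p, hmodel⟩ := h₀.exists_model hpos
  have h := h₀.comp_motion U p
  -- `φ` undoes the holomorphic motion that brings `ψ₀` into standard position; the translation
  -- makes it affine.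
  let φ : CRGeom.C2 ≃ᵢ EuclideanSpace ℝ (Fin 4) :=
    (U.symm.toIsometryEquiv.trans (IsometryEquiv.addRight p)).trans φ₀.toIsometryEquiv
  have hφ : ∀ x, f x = φ (U (ψ₀ x - p)) := fun x => by
    rw [hf]
    change φ₀ (ψ₀ x) = φ₀ (U.symm (U (ψ₀ x - p)) + p)
    rw [U.symm_apply_apply, sub_add_cancel]
  -- On the sphere bijectivity forces `M` to be compact; over the cylinder surjectivity forbids it.
  -- Each model thus contradicts the hypothesis of the other case.
  rcases hmodel with h0 | h0
  · have hρ := CRGeom.roundModel_rhoSphere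
    have hΨ := h.isLocalCRDiffeo hpos hρ h0
    have hbij := h.bijective_of_id hpos hcomplete hρ (fun _ => rfl) hΨ.isLocalHomeomorph
    have hcompact : CompactSpace M := by
      have := CRGeom.compactSpace_rhoSphere
      exact (hΨ.isLocalHomeomorph.toHomeomorphOfBijective hbij).symm.compactSpace
    exact ⟨fun hn => (hn hcompact).elim, fun _ => ⟨_, φ, ⟨hbij, hΨ⟩, hφ⟩⟩
  · have hρ := CRGeom.roundModel_rhoCylinder
    have hΨ := h.isLocalCRDiffeo hpos hρ h0
    have hsurj := h.surjective hpos hcomplete hρ CRGeom.rePart_quatJ (fun _ => rfl)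
      (Ψ := fun x => ⟨U (ψ₀ x - p), h0 x⟩)
    refine ⟨fun _ => ⟨_, φ, hΨ, h.isCoveringMap hpos hcomplete hρ (fun _ => rfl)
      hΨ.isLocalHomeomorph, hsurj, hφ⟩, fun hc => ?_⟩
    exact (CRGeom.not_compactSpace_rhoCylinder
      (Function.Surjective.compactSpace hΨ.isLocalHomeomorph.continuous hsurj)).elim
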